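/- Let $B\subset\mathbb R^3$ be a nonempty bounded connected open set whose boundary is a (closed) surface of class $C^2$ with $B$ locally on one side, with outward unit normal $n$, and let $I=[0,t_0)$, $0<t_0\le+\infty$. Indices run over $1,2,3$, repeated indices are summed, $f_{,i}=\partial f/\partial x_i$, and a dot is the time derivative. Put $\mathcal D=n_i\partial/\partial x_i$ (normal derivative) and $\mathcal D_i=(\delta_{ij}-n_in_j)\partial/\partial x_j$ (surface gradient). For a displacement $u_i$, temperature difference $\theta$ and electric potential $\varphi$ put $$e_{ij}=\tfrac12(u_{i,j}+u_{j,i}),\quad \kappa_{ijk}=u_{k,ij},\quad E_i=-\varphi_{,i},\quad V_{ij}=E_{i,j},\quad \vartheta=\theta+\beta\dot\theta .$$ A homogeneous isotropic centrosymmetric thermopiezoelectric material has real constants $\rho,T_0,\beta,\lambda,\mu,\lambda^*,\mu^*,\tilde\lambda,\tilde\mu,\alpha_0,\beta_0,\gamma_1,\dots,\gamma_5,\alpha^{(4)},\alpha^{(14)},\alpha^{(33)},\alpha^{(47)},\alpha^{(66)},a^{(44)},a^{(55)},b^{(55)}$, with $\gamma=a^{(55)}-\beta^2a^{(44)}-\alpha^{(4)}b^{(55)}$,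 and constitutive equations $$\tau_{ij}=\lambda e_{kk}\delta_{ij}+2\mu e_{ij}+\alpha^{(14)}\delta_{ij}\vartheta+\lambda^*V_{kk}\delta_{ij}+2\mu^*V_{ij},$$ $$\begin{aligned}\mu_{ijk}={}&\gamma_1(\kappa_{hhi}\delta_{jk}+2\kappa_{khh}\delta_{ij}+\kappa_{hhj}\delta_{ik})+2\gamma_2(\kappa_{ihh}\delta_{jk}+\kappa_{jhh}\delta_{ik})+\gamma_3\kappa_{hhk}\delta_{ij}\\&+2\gamma_4\kappa_{ijk}+2\gamma_5(\kappa_{kji}+\kappa_{kij})+\alpha_0\delta_{ij}E_k+\beta_0(\delta_{ik}E_j+\delta_{jk}E_i),\end{aligned}$$ $$-\sigma_i=\alpha_0\kappa_{kki}+2\beta_0\kappa_{ikk}+\alpha^{(33)}E_i,\qquad -\rho\eta=\alpha^{(14)}e_{kk}+a^{(44)}\vartheta+\alpha^{(47)}V_{kk}+\tfrac1\beta\gamma\dot\theta+\alpha^{(4)},$$ $$-Q_{ij}=\lambda^*e_{kk}\delta_{ij}+2\mu^*e_{ij}+\alpha^{(47)}\delta_{ij}\vartheta+\tilde\lambda V_{kk}\delta_{ij}+2\tilde\mu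 V_{ij},\qquad -\tfrac{q_i}{T_0}=\tfrac1\beta\alpha^{(66)}\theta_{,i}.$$ The mixed initial-boundary value problem consists of the equations, on $B\times I$, $$\tau_{ji,j}-\mu_{kji,kj}+\rho f_i=\rho\ddot u_i,\qquad \sigma_{i,i}-Q_{ji,ji}=g,\qquad \rho T_0\dot\eta+q_{i,i}-\rho r=0,$$ the initial conditions $u_i(0)=u_i^0$, $\dot u_i(0)=v_i^0$, $\theta(0)=\theta^0$, $\eta(0)=\eta^0$ on $\bar B$, and the boundary conditions (for all $t\in I$) $$\begin{array}{ll}u_i=\hat u_i\text{ on }S_1,& P_i=\hat P_i\text{ on }\Sigma_1,\\ \mathcal Du_i=\hat d_i\text{ on }S_2,& R_i=\hat R_i\text{ on }\Sigma_2,\\ \theta=\hat\theta\text{ on }S_3,& q_in_i=\hat q\text{ on }\Sigma_3,\\ \varphi=\hat\varphi\text{ on }S_4,&\Lambda=\hat\Lambda\text{ on }\Sigma_4,\\ \mathcal D\varphi=\hat\xi\text{ on }S_5,& H=\hat H\text{ on }\Sigma_5,\end{array}$$ with prescribed functions $f_i,g,r,u_i^0,v_i^0,\theta^0,\eta^0,\hat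 u_i,\hat d_i,\hat\theta,\hat\varphi,\hat\xi,\hat P_i,\hat R_i,\hat q,\hat\Lambda,\hat H$, where $\bar S_i\cup\Sigma_i=\partial B$, $S_i\cap\Sigma_i=\varnothing$ $(i=1,\dots,5)$ and $$P_i=(\tau_{ji}-\mu_{kji,k})n_j-\mathcal D_j(\mu_{kji}n_k)+(\mathcal D_ln_l)\mu_{kji}n_kn_j,\qquad R_i=\mu_{kji}n_kn_j,$$ $$\Lambda=(\sigma_j-Q_{kj,k})n_j-\mathcal D_j(Q_{kj}n_k)+(\mathcal D_ln_l)Q_{kj}n_kn_j,\qquad H=Q_{kj}n_kn_j.$$ A solution is a triple $(u_i,\theta,\varphi)$ on $\bar B\times I$ satisfying all of these, with $u_i,\varphi$ of class $C^4$ and $\theta$ of class $C^3$ on $\bar B\times I$ (up to the boundary and the initial time). **Theorem 2 (isotropic uniqueness).** Assume $\rho>0$, $T_0>0$, $\beta>0$, $\gamma\ge0$, $\alpha^{(66)}\ge0$, and $$\mu\ge0,\qquad 3\lambda+2\mu\ge0;$$ $$\begin{gathered}\gamma_3+\gamma_4\ge0,\quad \gamma_4-\gamma_5\ge0,\quad \gamma_4+2\gamma_5\ge0,\quad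 2\gamma_2+\gamma_4+\gamma_5\ge0,\quad 4(\gamma_1+\gamma_2+\gamma_5)+(\gamma_3+2\gamma_4)\ge0,\\ (\gamma_3+\gamma_4)(4\gamma_2+3\gamma_4+4\gamma_5)\ge(2\gamma_1-\gamma_4)^2,\quad (\gamma_3+\gamma_4)(2\gamma_2+\gamma_4+\gamma_5)\ge2(\gamma_1+\gamma_5)^2,\\ (2\gamma_2+\gamma_4+\gamma_5)(\gamma_3+4\gamma_4+6\gamma_5)\ge2(\gamma_1-\gamma_4-\gamma_5)^2,\\ (\gamma_4+2\gamma_5)\big[(5\gamma_3+4\gamma_4-2\gamma_5)(10\gamma_2+3\gamma_4+\gamma_5)-2(5\gamma_1-\gamma_4+3\gamma_5)^2\big]\ge0;\end{gathered}$$ $$\tilde\mu<0,\quad 3\tilde\lambda+2\tilde\mu<0,\quad \alpha^{(33)}<0,\quad a^{(44)}+\frac{\gamma}{\beta^2}<0,\quad (3\tilde\lambda+2\tilde\mu)\Big(a^{(44)}+\frac{\gamma}{\beta^2}\Big)>3(\alpha^{(47)})^2 .$$ If $S_4$ is nonempty, then for any data the mixed initial-boundary value problem has at most one solution. -/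

import Mathlib

noncomputable section

namespace Thermopiezo

/-- Euclidean three-dimensional space with fixed rectangular Cartesian axes. -/
abbrev E3 : Type := EuclideanSpace ℝ (Fin 3)

/-- A scalar field depending on time and place. -/
abbrev Field : Type := ℝ → E3 → ℝ

/-- The time interval `I = [0, t0)`, where `t0` may be `+∞`. -/
def timeInterval (t0 : EReal) : Set ℝ := {t : ℝ | 0 ≤ t ∧ (t : EReal) < t0}

/-- Kronecker's delta. -/
def kron (i j : Fin 3) : ℝ := if i = j then 1 else 0

/-! ### The reference region and its boundary -/

/-- `g` is a `C²` local defining function of `B` on the open neighbourhood `U` of `x`: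
it is negative exactly on `B` and has nonvanishing gradient at `x`. -/
def IsLocalDefiningFunction (B : Set E3) (x : E3) (U : Set E3) (g : E3 → ℝ) : Prop :=
  IsOpen U ∧ x ∈ U ∧ ContDiffOn ℝ 2 g U ∧ gradient g x ≠ 0 ∧ ∀ y ∈ U, (y ∈ B ↔ g y < 0)

/-- The boundary of `B` is a closed surface of class `C²` with `B` on one side. -/
def HasC2Boundary (B : Set E3) : Prop :=
  ∀ x ∈ frontier B, ∃ U g, IsLocalDefiningFunction B x U g

/-- `v` is the outward unit normal vector of `B` at the boundary point `x`. -/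
def IsOuterNormal (B : Set E3) (x v : E3) : Prop :=
  ∃ U g, IsLocalDefiningFunction B x U g ∧ v = ‖gradient g x‖⁻¹ • gradient g x

open Classical in
/-- The field `n` of outward unit normals on the boundary (its values off the boundary are
never used). -/
def normal (B : Set E3) (x : E3) : E3 :=
  if h : ∃ v, IsOuterNormal B x v then h.choose else 0

/-! ### Derivatives

Fields live on `closure B × I`, so derivatives are taken within these sets.  At interior points
they are the usual ones, on the boundary and at the initial time they are one-sided. -/

/-- `f_{,j}`. -/
def dx (B : Set E3) (f : Field) (j : Fin 3) : Field := fun t x =>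
  fderivWithin ℝ (f t) (closure B) x (EuclideanSpace.single j 1)

/-- The time derivative of `f`. -/
def dt (t0 : EReal) (f : Field) : Field := fun t x =>
  derivWithin (fun s => f s x) (timeInterval t0) t

/-- The normal derivative `n_i ∂/∂x_i` on the boundary. -/
def dn (B : Set E3) (f : Field) : Field := fun t x =>
  ∑ i, normal B x i * dx B f i t x

/-- The surface gradient `(δ_{ij} - n_i n_j) ∂/∂x_j` of a function on the boundary surface: its
derivative along the surface in the direction of the tangential projection of the `i`-th basis
vector.  (A derivative within the surface is determined on tangent vectors.) -/
def surfGrad (B : Set E3) (h : E3 → ℝ) (i : Fin 3) (x : E3) : ℝ :=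
  fderivWithin ℝ h (frontier B) x
    (EuclideanSpace.single i 1 - normal B x i • normal B x)

/-! ### Material and constitutive equations -/

/-- Constants of a homogeneous, isotropic, centrosymmetric thermopiezoelectric material. -/
structure Material where
  /-- mass density -/
  rho : ℝ
  /-- reference absolute temperature -/
  T0 : ℝ
  /-- coefficient of the temperature rate in the thermal variable -/
  beta : ℝ
  /-- `b^(55)` -/
  b55 : ℝ
  /-- `α^(4)` -/
  alpha4 : ℝ
  /-- `a^(44)` -/
  a44 : ℝ
  /-- `a^(55)` -/
  a55 : ℝ
  /-- `λ` -/
  lam : ℝ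
  /-- `μ` -/
  mu : ℝ
  /-- `λ*` -/
  lamStar : ℝ
  /-- `μ*` -/
  muStar : ℝ
  /-- `λ` with tilde -/
  lamTilde : ℝ
  /-- `μ` with tilde -/
  muTilde : ℝ
  /-- `α^0` -/
  alpha0 : ℝ
  /-- `β^0` -/
  beta0 : ℝ
  gamma1 : ℝ
  gamma2 : ℝ
  gamma3 : ℝ
  gamma4 : ℝ
  gamma5 : ℝ
  /-- `α^(14)` -/
  alpha14 : ℝ
  /-- `α^(33)` -/
  alpha33 : ℝ
  /-- `α^(47)` -/
  alpha47 : ℝ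
  /-- `α^(66)`, that is, `a^(66)_{ij} = α^(66) δ_{ij}` -/
  alpha66 : ℝ

/-- `γ = a^(55) - β² a^(44) - α^(4) b^(55)`. -/
def Material.gamma (m : Material) : ℝ :=
  m.a55 - m.beta ^ 2 * m.a44 - m.alpha4 * m.b55

/-- Displacement `u_i`, temperature difference `θ`, electric potential `φ`. -/
structure State where
  u : Fin 3 → Field
  theta : Field
  phi : Field

/-- Strain `e_{ij} = (u_{i,j} + u_{j,i}) / 2`. -/
def strain (B : Set E3) (U : State) (i j : Fin 3) : Field := fun t x =>
  (1 / 2) * (dx B (U.u i) j t x + dx B (U.u j) i t x)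

/-- `κ_{ijk} = u_{k,ij}`. -/
def kappa (B : Set E3) (U : State) (i j k : Fin 3) : Field := dx B (dx B (U.u k) i) j

/-- Electric field `E_i = -φ_{,i}`. -/
def elField (B : Set E3) (U : State) (i : Fin 3) : Field := fun t x => -dx B U.phi i t x

/-- `V_{ij} = E_{i,j}`. -/
def elGrad (B : Set E3) (U : State) (i j : Fin 3) : Field := dx B (elField B U i) j

/-- `θ + β θ̇`. -/
def thermal (t0 : EReal) (m : Material) (U : State) : Field := fun t x =>
  U.theta t x + m.beta * dt t0 U.theta t x

/-- `τ_{ij}`. -/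
def tau (B : Set E3) (t0 : EReal) (m : Material) (U : State) (i j : Fin 3) : Field := fun t x =>
  m.lam * (∑ k, strain B U k k t x) * kron i j + 2 * m.mu * strain B U i j t x
    + m.alpha14 * kron i j * thermal t0 m U t x
    + m.lamStar * (∑ k, elGrad B U k k t x) * kron i j + 2 * m.muStar * elGrad B U i j t x

/-- Hyperstress `μ_{ijk}`. -/
def hyper (B : Set E3) (m : Material) (U : State) (i j k : Fin 3) : Field := fun t x =>
  m.gamma1 * ((∑ h, kappa B U h h i t x) * kron j k + 2 * (∑ h, kappa B U k h h t x) * kron i j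
      + (∑ h, kappa B U h h j t x) * kron i k)
    + 2 * m.gamma2 * ((∑ h, kappa B U i h h t x) * kron j k
      + (∑ h, kappa B U j h h t x) * kron i k)
    + m.gamma3 * (∑ h, kappa B U h h k t x) * kron i j
    + 2 * m.gamma4 * kappa B U i j k t x
    + 2 * m.gamma5 * (kappa B U k j i t x + kappa B U k i j t x)
    + m.alpha0 * kron i j * elField B U k t x
    + m.beta0 * (kron i k * elField B U j t x + kron j k * elField B U i t x)

/-- `σ_i`. -/
def sigma (B : Set E3) (m : Material) (U : State) (i : Fin 3) : Field := fun t x =>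
  -(m.alpha0 * (∑ k, kappa B U k k i t x) + 2 * m.beta0 * (∑ k, kappa B U i k k t x)
    + m.alpha33 * elField B U i t x)

/-- Entropy `η`. -/
def entropy (B : Set E3) (t0 : EReal) (m : Material) (U : State) : Field := fun t x =>
  -(1 / m.rho) * (m.alpha14 * (∑ k, strain B U k k t x) + m.a44 * thermal t0 m U t x
    + m.alpha47 * (∑ k, elGrad B U k k t x)
    + (1 / m.beta) * m.gamma * dt t0 U.theta t x + m.alpha4)

/-- Electric quadrupole `Q_{ij}`. -/
def quad (B : Set E3) (t0 : EReal) (m : Material) (U : State) (i j : Fin 3) : Field := fun t x =>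
  -(m.lamStar * (∑ k, strain B U k k t x) * kron i j + 2 * m.muStar * strain B U i j t x
    + m.alpha47 * kron i j * thermal t0 m U t x
    + m.lamTilde * (∑ k, elGrad B U k k t x) * kron i j + 2 * m.muTilde * elGrad B U i j t x)

/-- Heat flux `q_i`. -/
def heatFlux (B : Set E3) (m : Material) (U : State) (i : Fin 3) : Field := fun t x =>
  -(m.T0 * ((1 / m.beta) * m.alpha66 * dx B U.theta i t x))

/-! ### Boundary operators -/

/-- `P_i = (τ_{ji} - μ_{kji,k}) n_j - D_j (μ_{kji} n_k) + (D_l n_l) μ_{kji} n_k n_j`. -/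
def tractionP (B : Set E3) (t0 : EReal) (m : Material) (U : State) (i : Fin 3) : Field :=
  fun t x =>
    (∑ j, (tau B t0 m U j i t x - ∑ k, dx B (hyper B m U k j i) k t x) * normal B x j)
      - (∑ j, surfGrad B (fun y => ∑ k, hyper B m U k j i t y * normal B y k) j x)
      + (∑ l, surfGrad B (fun y => normal B y l) l x)
        * ∑ j, ∑ k, hyper B m U k j i t x * normal B x k * normal B x j

/-- `R_i = μ_{kji} n_k n_j`. -/
def hypertractionR (B : Set E3) (m : Material) (U : State) (i : Fin 3) : Field := fun t x =>
  ∑ j, ∑ k, hyper B m U k j i t x * normal B x k * normal B x j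

/-- `Λ = (σ_j - Q_{kj,k}) n_j - D_j (Q_{kj} n_k) + (D_l n_l) Q_{kj} n_k n_j`. -/
def chargeLambda (B : Set E3) (t0 : EReal) (m : Material) (U : State) : Field := fun t x =>
  (∑ j, (sigma B m U j t x - ∑ k, dx B (quad B t0 m U k j) k t x) * normal B x j)
    - (∑ j, surfGrad B (fun y => ∑ k, quad B t0 m U k j t y * normal B y k) j x)
    + (∑ l, surfGrad B (fun y => normal B y l) l x)
      * ∑ j, ∑ k, quad B t0 m U k j t x * normal B x k * normal B x j

/-- `H = Q_{kj} n_k n_j`. -/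
def chargeH (B : Set E3) (t0 : EReal) (m : Material) (U : State) : Field := fun t x =>
  ∑ j, ∑ k, quad B t0 m U k j t x * normal B x k * normal B x j

/-! ### The mixed initial-boundary value problem -/

/-- `S` and `Sig` are disjoint parts of the boundary with `closure S ∪ Sig` the whole boundary
(which is closed, so that the closure of `S` relative to it is the closure of `S`). -/
def IsSplit (B S Sig : Set E3) : Prop :=
  S ⊆ frontier B ∧ closure S ∪ Sig = frontier B ∧ Disjoint S Sig

/-- The parts `S_i`, `Σ_i` of the boundary, `i = 1, …, 5`. -/
structure BoundaryParts (B : Set E3) where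
  S1 : Set E3
  S2 : Set E3
  S3 : Set E3
  S4 : Set E3
  S5 : Set E3
  Sig1 : Set E3
  Sig2 : Set E3
  Sig3 : Set E3
  Sig4 : Set E3
  Sig5 : Set E3
  split1 : IsSplit B S1 Sig1
  split2 : IsSplit B S2 Sig2
  split3 : IsSplit B S3 Sig3
  split4 : IsSplit B S4 Sig4
  split5 : IsSplit B S5 Sig5

/-- The external data: body force, free charge density, heat supply, initial and boundary data. -/
structure ExternalData where
  f : Fin 3 → Field
  g : Field
  r : Field
  u0 : Fin 3 → E3 → ℝ
  v0 : Fin 3 → E3 → ℝ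
  theta0 : E3 → ℝ
  eta0 : E3 → ℝ
  uHat : Fin 3 → Field
  dHat : Fin 3 → Field
  thetaHat : Field
  phiHat : Field
  xiHat : Field
  PHat : Fin 3 → Field
  RHat : Fin 3 → Field
  qHat : Field
  LambdaHat : Field
  HHat : Field

/-- `U` is a classical solution on `closure B × I` of the mixed problem with data `Γ`: the fields
have continuous derivatives of the orders that occur in the equations, up to the boundary and to
the initial time. -/
structure IsSolution (B : Set E3) (t0 : EReal) (m : Material) (S : BoundaryParts B)
    (Γ : ExternalData) (U : State) : Prop where
  smooth_u : ∀ i, ContDiffOn ℝ 4 (fun p : ℝ × E3 => U.u i p.1 p.2)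
    (timeInterval t0 ×ˢ closure B)
  smooth_theta : ContDiffOn ℝ 3 (fun p : ℝ × E3 => U.theta p.1 p.2)
    (timeInterval t0 ×ˢ closure B)
  smooth_phi : ContDiffOn ℝ 4 (fun p : ℝ × E3 => U.phi p.1 p.2)
    (timeInterval t0 ×ˢ closure B)
  motion : ∀ t ∈ timeInterval t0, ∀ x ∈ B, ∀ i,
    (∑ j, dx B (tau B t0 m U j i) j t x)
      - (∑ j, ∑ k, dx B (dx B (hyper B m U k j i) k) j t x) + m.rho * Γ.f i t x
      = m.rho * dt t0 (dt t0 (U.u i)) t x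
  electric : ∀ t ∈ timeInterval t0, ∀ x ∈ B,
    (∑ i, dx B (sigma B m U i) i t x)
      - (∑ i, ∑ j, dx B (dx B (quad B t0 m U j i) j) i t x) = Γ.g t x
  energy : ∀ t ∈ timeInterval t0, ∀ x ∈ B,
    m.rho * m.T0 * dt t0 (entropy B t0 m U) t x + (∑ i, dx B (heatFlux B m U i) i t x)
      - m.rho * Γ.r t x = 0
  init_u : ∀ x ∈ closure B, ∀ i, U.u i 0 x = Γ.u0 i x
  init_v : ∀ x ∈ closure B, ∀ i, dt t0 (U.u i) 0 x = Γ.v0 i x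
  init_theta : ∀ x ∈ closure B, U.theta 0 x = Γ.theta0 x
  init_eta : ∀ x ∈ closure B, entropy B t0 m U 0 x = Γ.eta0 x
  bdry_u : ∀ t ∈ timeInterval t0, ∀ x ∈ S.S1, ∀ i, U.u i t x = Γ.uHat i t x
  bdry_P : ∀ t ∈ timeInterval t0, ∀ x ∈ S.Sig1, ∀ i, tractionP B t0 m U i t x = Γ.PHat i t x
  bdry_du : ∀ t ∈ timeInterval t0, ∀ x ∈ S.S2, ∀ i, dn B (U.u i) t x = Γ.dHat i t x
  bdry_R : ∀ t ∈ timeInterval t0, ∀ x ∈ S.Sig2, ∀ i, hypertractionR B m U i t x = Γ.RHat i t x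
  bdry_theta : ∀ t ∈ timeInterval t0, ∀ x ∈ S.S3, U.theta t x = Γ.thetaHat t x
  bdry_q : ∀ t ∈ timeInterval t0, ∀ x ∈ S.Sig3,
    ∑ i, heatFlux B m U i t x * normal B x i = Γ.qHat t x
  bdry_phi : ∀ t ∈ timeInterval t0, ∀ x ∈ S.S4, U.phi t x = Γ.phiHat t x
  bdry_Lambda : ∀ t ∈ timeInterval t0, ∀ x ∈ S.Sig4, chargeLambda B t0 m U t x = Γ.LambdaHat t x
  bdry_dphi : ∀ t ∈ timeInterval t0, ∀ x ∈ S.S5, dn B U.phi t x = Γ.xiHat t x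
  bdry_H : ∀ t ∈ timeInterval t0, ∀ x ∈ S.Sig5, chargeH B t0 m U t x = Γ.HHat t x

end Thermopiezo

end

noncomputable section
namespace Thermopiezo
open Set Filter Topology Metric
open scoped Manifold ContDiff

/-! ### Domains with `C²` boundary -/

/-! The difference of two solutions solves the problem with zero data (`IsSolution.sub`). The
constant `α^(4)` cancels in the difference of the entropies, so the difference belongs to the
material `Material.centered`. It remains to show that a solution with zero data vanishes, and this
is an energy argument.

The energy is the integral of `energyDensity`: kinetic energy, the quadratic potential of the
constitutive equations, thermal terms and `ρ η ϑ`. Test the equation of motion with `u̇`, the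
electric equation with `φ̇` and the heat equation with `ϑ = θ + β θ̇`. The derivative of the energy
is then minus the integral of `(γ/β) θ̇² + (α^(66)/β) |∇θ|²`, so the energy does not increase. Its
density has no evident sign. However, the work of the electric field integrates to zero by the
electric equation, and adding it cancels every coupling between mechanical fields and `E`, `V`, `ϑ`
(`energyDensity_eq`). What is left is kinetic energy, strain energy, strain gradient energy, a form
in `(E, V, ϑ)`, and multiples of `θ²` and `|∇θ|²`. The algebraic hypotheses make all of these
nonnegative, and make the form in `(E, V, ϑ)` definite in `E` and `ϑ`.

Neither `φ` nor `θ̇` has a prescribed initial value, so the vanishing of the initial energy needs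
its own argument (`integral_energyDensity_zero`): `θ = 0` and `η = 0` tie `ϑ` to `V_kk`, and under
this relation the electric work at time zero is a definite form with zero integral. Hence the energy
is zero at all times, and `u̇`, `E`, `ϑ` vanish (`rate_fields_eq_zero`). Then `u` stays at its
initial value zero, `θ + β θ̇ = 0` forces `θ = 0`, and `φ` is constant in space on the connected set
`B` with a zero on `S_4`.

The integrations by parts use no surface measure. The local defining functions are glued to a global
`G`, and integrals over `B` are approximated with cut-offs that are functions of `G`; a flux that
vanishes on the boundary is lost in the limit (`integral_div_eq_zero`). The surface divergence
theorem, needed for the tangential derivatives in `P_i` and `Λ`, appears as the fact that the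
divergence of an antisymmetric tensor field is itself weakly divergence-free. `virtual_work`
combines the two. -/

theorem eventually_neg_of_dir {g : E3 → ℝ} {L : E3 →L[ℝ] ℝ} {x v : E3} (hg : HasFDerivAt g L x)
    (h0 : g x ≤ 0) (hv : L v < 0) : ∀ᶠ t : ℝ in 𝓝[>] 0, g (x + t • v) < 0 := by
  have h1 : HasDerivAt (fun t : ℝ => g (x + t • v)) (L v) 0 := hg.hasLineDerivAt v
  have h2 := (hasDerivAt_iff_tendsto_slope.1 h1).eventually (gt_mem_nhds hv)
  have h3 := h2.filter_mono (nhdsWithin_mono 0 (fun t (ht : (0:ℝ) < t) => ht.ne'))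
  filter_upwards [h3, self_mem_nhdsWithin] with t ht htpos
  have htp : (0:ℝ) < t := htpos
  rw [slope_def_field, zero_smul, add_zero, sub_zero, div_lt_iff₀ htp, zero_mul] at ht
  linarith

theorem eventually_pos_of_dir {g : E3 → ℝ} {L : E3 →L[ℝ] ℝ} {x v : E3} (hg : HasFDerivAt g L x)
    (h0 : 0 ≤ g x) (hv : 0 < L v) : ∀ᶠ t : ℝ in 𝓝[>] 0, 0 < g (x + t • v) := by
  have := eventually_neg_of_dir (v := v) hg.neg (by simpa using h0) (by simpa using hv)
  simpa using this

theorem tendsto_line (x v : E3) : Tendsto (fun t : ℝ => x + t • v) (𝓝[>] 0) (𝓝 x) := by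
  have : Continuous (fun t : ℝ => x + t • v) := by fun_prop
  simpa using (this.tendsto 0).mono_left nhdsWithin_le_nhds

theorem segment_inter_frontier {B : Set E3} (hB : IsOpen B) {a b : E3} (ha : a ∈ B) (hb : b ∉ B) :
    ∃ c ∈ segment ℝ a b, c ∈ frontier B := by
  by_contra! h
  have hc : IsPreconnected (segment ℝ a b) := (convex_segment a b).isPreconnected
  have hsub : segment ℝ a b ⊆ B ∪ (closure B)ᶜ := by
    intro y hy
    by_cases hyB : y ∈ closure B
    · left
      by_contra hn
      exact h y hy (by rw [hB.frontier_eq]; exact ⟨hyB, hn⟩)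
    · exact Or.inr hyB
  have := hc.subset_left_of_subset_union hB isClosed_closure.isOpen_compl
    (disjoint_compl_right.mono_left subset_closure) hsub ⟨a, left_mem_segment ℝ a b, ha⟩
  exact hb (this (right_mem_segment ℝ a b))

/-! ### Local defining functions and uniqueness of the normal -/

section local_defining

variable {B : Set E3} {x : E3} {U : Set E3} {g : E3 → ℝ}

theorem IsLocalDefiningFunction.hasFDerivAt (h : IsLocalDefiningFunction B x U g) {y : E3}
    (hy : y ∈ U) : HasFDerivAt g (fderiv ℝ g y) y :=
  ((h.2.2.1.contDiffAt (h.1.mem_nhds hy)).differentiableAt (by norm_num)).hasFDerivAt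

theorem IsLocalDefiningFunction.eq_zero (h : IsLocalDefiningFunction B x U g)
    {y : E3} (hy : y ∈ U) (hyf : y ∈ frontier B) (hB : IsOpen B) : g y = 0 := by
  rw [hB.frontier_eq] at hyf
  apply le_antisymm
  · have hc : ContinuousAt g y := (h.hasFDerivAt hy).continuousAt
    by_contra! hpos
    have h1 : ∀ᶠ z in 𝓝 y, 0 < g z ∧ z ∈ U :=
      (hc.eventually (lt_mem_nhds hpos)).and (h.1.mem_nhds hy)
    obtain ⟨z, hz, hzB⟩ := mem_closure_iff_nhds.1 hyf.1 _ h1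
    exact absurd ((h.2.2.2.2 z hz.2).1 hzB) (not_lt.2 hz.1.le)
  · by_contra! hneg
    exact hyf.2 ((h.2.2.2.2 y hy).2 hneg)

theorem IsLocalDefiningFunction.fderiv_ne_zero (h : IsLocalDefiningFunction B x U g) :
    fderiv ℝ g x ≠ 0 := by
  intro h0
  apply h.2.2.2.1
  simp [gradient, h0]

theorem inner_gradient_eq (g : E3 → ℝ) (x v : E3) : inner ℝ (gradient g x) v = fderiv ℝ g x v := by
  simp [gradient]

/-- Two defining functions have the same unit normal. -/
theorem IsLocalDefiningFunction.normal_unique (h : IsLocalDefiningFunction B x U g)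
    {U' : Set E3} {g' : E3 → ℝ} (h' : IsLocalDefiningFunction B x U' g') (hB : IsOpen B)
    (hx : x ∈ frontier B) :
    ‖gradient g x‖⁻¹ • gradient g x = ‖gradient g' x‖⁻¹ • gradient g' x := by
  set a := gradient g x with ha
  set b := gradient g' x with hb
  have ha0 : 0 < ‖a‖ := norm_pos_iff.2 h.2.2.2.1
  have hb0 : 0 < ‖b‖ := norm_pos_iff.2 h'.2.2.2.1
  have hna : ‖‖a‖⁻¹ • a‖ = 1 := by rw [norm_smul, norm_inv, norm_norm, inv_mul_cancel₀ ha0.ne']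
  have hnb : ‖‖b‖⁻¹ • b‖ = 1 := by rw [norm_smul, norm_inv, norm_norm, inv_mul_cancel₀ hb0.ne']
  by_contra hne
  have hlt : inner ℝ (‖a‖⁻¹ • a) (‖b‖⁻¹ • b) < 1 :=
    inner_lt_one_iff_real_of_norm_eq_one hna hnb |>.2 hne
  -- If the unit normals differ, a short move along their difference makes `g` negative and `g'`
  -- positive, so the point reached lies both inside and outside `B`.
  set v := ‖b‖⁻¹ • b - ‖a‖⁻¹ • a with hv
  have h1 : fderiv ℝ g x v < 0 := by
    rw [← inner_gradient_eq, ← ha]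
    have : inner ℝ (‖a‖⁻¹ • a) v < 0 := by
      rw [hv, inner_sub_right, real_inner_self_eq_norm_sq, hna]; linarith
    rw [inner_smul_left] at this
    simp only [conj_trivial] at this
    exact (pos_iff_neg_of_mul_neg this).1 (inv_pos.2 ha0)
  have h2 : 0 < fderiv ℝ g' x v := by
    rw [← inner_gradient_eq, ← hb]
    have : 0 < inner ℝ (‖b‖⁻¹ • b) v := by
      rw [hv, inner_sub_right, real_inner_self_eq_norm_sq, hnb, real_inner_comm]; linarith
    rw [inner_smul_left] at this
    simp only [conj_trivial] at this
    exact (mul_pos_iff_of_pos_left (inv_pos.2 hb0)).1 this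
  have e1 := eventually_neg_of_dir (h.hasFDerivAt h.2.1) (h.eq_zero h.2.1 hx hB).le h1
  have e2 := eventually_pos_of_dir (h'.hasFDerivAt h'.2.1) (h'.eq_zero h'.2.1 hx hB).ge h2
  have e3 := (tendsto_line x v).eventually ((h.1.inter h'.1).mem_nhds ⟨h.2.1, h'.2.1⟩)
  obtain ⟨t, ⟨ht1, ht2⟩, ht3⟩ := ((e1.and e2).and e3).exists
  have := (h.2.2.2.2 _ ht3.1).2 ht1
  exact absurd ((h'.2.2.2.2 _ ht3.2).1 this) (not_lt.2 ht2.le)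

theorem IsLocalDefiningFunction.normal_eq (h : IsLocalDefiningFunction B x U g) (hB : IsOpen B)
    (hx : x ∈ frontier B) : normal B x = ‖gradient g x‖⁻¹ • gradient g x := by
  have hex : ∃ v, IsOuterNormal B x v := ⟨_, U, g, h, rfl⟩
  unfold normal
  rw [dif_pos hex]
  obtain ⟨U', g', h', he⟩ := hex.choose_spec
  rw [he]
  exact h'.normal_unique h hB hx

/-- The defining function may be assumed to have nonvanishing gradient throughout. -/
theorem IsLocalDefiningFunction.exists_forall (h : IsLocalDefiningFunction B x U g) :
    ∃ V, x ∈ V ∧ ∀ y ∈ V, IsLocalDefiningFunction B y V g := by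
  have hc : ContinuousOn (fderiv ℝ g) U := h.2.2.1.continuousOn_fderiv_of_isOpen h.1 (by norm_num)
  refine ⟨U ∩ (fderiv ℝ g) ⁻¹' {0}ᶜ, ⟨h.2.1, h.fderiv_ne_zero⟩, fun y hy => ?_⟩
  refine ⟨hc.isOpen_inter_preimage h.1 isOpen_compl_singleton, hy, h.2.2.1.mono inter_subset_left,
    ?_, fun z hz => h.2.2.2.2 z hz.1⟩
  intro h0
  apply hy.2
  ext v
  rw [← inner_gradient_eq, h0]; simp

end local_defining

/-! ### Global defining functions and tangent cones -/

/-- A global `C²` defining function. -/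
structure IsDefiningFunction (B : Set E3) (G : E3 → ℝ) : Prop where
  contDiff : ContDiff ℝ 2 G
  mem_iff : ∀ y, y ∈ B ↔ G y < 0
  gradient_ne : ∀ x ∈ frontier B, gradient G x ≠ 0

/-- Local defining functions all have the same sign pattern with respect to `B`, so a smooth
partition of unity glues them without spoiling the sign. Only the gradient on the boundary needs an
argument. -/
theorem HasC2Boundary.exists_isDefiningFunction {B : Set E3} (hB : IsOpen B)
    (h : HasC2Boundary B) : ∃ G, IsDefiningFunction B G := by
  have hloc : ∀ x : frontier B, ∃ V g, (x : E3) ∈ V ∧ ∀ y ∈ V, IsLocalDefiningFunction B y V g := by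
    intro x
    obtain ⟨U, g, hg⟩ := h x x.2
    obtain ⟨V, hV⟩ := hg.exists_forall
    exact ⟨V, g, hV⟩
  choose V g hxV hV using hloc
  -- The index `none` stands for the open set `B` itself, with the constant `-1` as local function.
  let W : Option (frontier B) → Set E3 := fun o => o.elim B V
  let k : Option (frontier B) → E3 → ℝ := fun o => o.elim (fun _ => -1) g
  have hWo : ∀ i, IsOpen (W i) := by
    rintro (_ | i)
    · exact hB
    · exact (hV i _ (hxV i)).1
  have hcov : closure B ⊆ ⋃ i, W i := by
    intro y hy
    by_cases hyB : y ∈ B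
    · exact mem_iUnion.2 ⟨none, hyB⟩
    · exact mem_iUnion.2 ⟨some ⟨y, by rw [hB.frontier_eq]; exact ⟨hy, hyB⟩⟩, hxV _⟩
  obtain ⟨f, hf⟩ := SmoothPartitionOfUnity.exists_isSubordinate 𝓘(ℝ, E3) isClosed_closure W hWo hcov
  have hk : ∀ i, ∀ y ∈ W i, ContDiffAt ℝ 2 (k i) y := by
    rintro (_ | i) y hy
    · exact contDiffAt_const
    · exact (hV i _ (hxV i)).2.2.1.contDiffAt ((hWo (some i)).mem_nhds hy)
  have hsupp : ∀ i y, f i y ≠ 0 → y ∈ W i := fun i y hy => hf i (subset_tsupport _ hy)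
  have hkneg : ∀ i, ∀ y ∈ W i, y ∈ B → k i y < 0 := by
    rintro (_ | i) y hy hyB
    · show (-1 : ℝ) < 0; norm_num
    · exact ((hV i _ (hxV i)).2.2.2.2 y hy).1 hyB
  have hkpos : ∀ i, ∀ y ∈ W i, y ∉ B → 0 ≤ k i y := by
    rintro (_ | i) y hy hyB
    · exact absurd hy hyB
    · by_contra! hn
      exact hyB (((hV i _ (hxV i)).2.2.2.2 y hy).2 hn)
  set G : E3 → ℝ := fun y => ∑ᶠ i, f i y • k i y with hG
  have hsum : ∀ y, G y = ∑ i ∈ f.finsupport y, f i y * k i y := fun y =>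
    (f.sum_finsupport_smul_eq_finsum y k).symm
  have hGC : ContDiff ℝ 2 G := contDiff_iff_contDiffAt.2 fun y =>
    f.contDiffAt_finsum fun i hi => hk i y (hf i hi)
  have hterm : ∀ i y, y ∉ B → 0 ≤ f i y * k i y := by
    intro i y hy
    by_cases h0 : f i y = 0
    · simp [h0]
    · exact mul_nonneg (f.nonneg i y) (hkpos i y (hsupp i y h0) hy)
  have hGnn : ∀ y, y ∉ B → 0 ≤ G y := by
    intro y hy
    rw [hsum]
    exact Finset.sum_nonneg fun i _ => hterm i y hy
  have hmem : ∀ y, y ∈ B ↔ G y < 0 := by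
    intro y
    refine ⟨fun hy => ?_, fun hy => by by_contra hn; exact absurd hy (not_lt.2 (hGnn y hn))⟩
    rw [hsum]
    obtain ⟨i, hi⟩ := f.exists_pos_of_mem (subset_closure hy)
    refine Finset.sum_neg' (fun i _ => ?_) ⟨i, ?_, ?_⟩
    · by_cases h0 : f i y = 0
      · simp [h0]
      · exact mul_nonpos_of_nonneg_of_nonpos (f.nonneg i y) (hkneg i y (hsupp i y h0) hy).le
    · rw [SmoothPartitionOfUnity.mem_finsupport]; exact hi.ne'
    · exact mul_neg_of_pos_of_neg hi (hkneg i y (hsupp i y hi.ne') hy)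
  refine ⟨G, hGC, hmem, fun x hx h0 => ?_⟩
  have hx' := hx
  rw [hB.frontier_eq] at hx'
  obtain ⟨o, ho⟩ := f.exists_pos_of_mem hx'.1
  have hoW := hsupp o x ho.ne'
  obtain _ | i := o
  · exact hx'.2 hoW
  have hloc := hV i x hoW
  have hg0 : g i x = 0 := hloc.eq_zero hoW hx hB
  set v := gradient (g i) x with hv
  have hgv : 0 < fderiv ℝ (g i) x v := by
    rw [← inner_gradient_eq, ← hv, real_inner_self_eq_norm_sq]
    exact pow_pos (norm_pos_iff.2 hloc.2.2.2.1) 2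
  have hfd : HasFDerivAt (f (some i)) (fderiv ℝ (f (some i)) x) x :=
    ((f (some i)).contMDiff.contDiff.differentiable (by simp) x).hasFDerivAt
  have hprod := hfd.mul (hloc.hasFDerivAt hoW)
  have hGd : HasFDerivAt G (fderiv ℝ G x) x :=
    (hGC.differentiable (by norm_num) x).hasFDerivAt
  have hG0 : fderiv ℝ G x = 0 := by
    ext w; rw [← inner_gradient_eq, h0]; simp
  have hGx : G x ≤ 0 := by
    by_contra! hpos
    obtain ⟨z, hz, hzB⟩ := mem_closure_iff_nhds.1 hx'.1 _
      (hGC.continuous.continuousAt.eventually (lt_mem_nhds hpos))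
    exact absurd ((hmem z).1 hzB) (not_lt.2 (le_of_lt hz))
  -- If the gradient of `G` vanished, `G - f_i g_i` would decrease along `∇g_i`, so `G < f_i g_i` at
  -- nearby points outside `B`. Outside `B` every summand of `G` is nonnegative, hence `f_i g_i ≤
  -- G`, a contradiction.
  have e1 := eventually_neg_of_dir (v := v) (hGd.sub hprod)
    (by simp [hg0, hGx]) (by simp [hG0, hg0, ho, hgv])
  have e2 := eventually_pos_of_dir (hloc.hasFDerivAt hoW) hg0.ge hgv
  have e3 := (tendsto_line x v).eventually (hloc.1.mem_nhds hoW)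
  obtain ⟨t, ⟨ht1, ht2⟩, ht3⟩ := ((e1.and e2).and e3).exists
  have hnB : x + t • v ∉ B := fun hb => absurd ((hloc.2.2.2.2 _ ht3).1 hb) (not_lt.2 ht2.le)
  have : f (some i) (x + t • v) * g i (x + t • v) ≤ G (x + t • v) := by
    rw [hsum]
    by_cases h00 : f (some i) (x + t • v) = 0
    · rw [h00, zero_mul]; exact Finset.sum_nonneg fun j _ => hterm j _ hnB
    · exact Finset.single_le_sum (f := fun j => f j (x + t • v) * k j (x + t • v))
        (fun j _ => hterm j _ hnB) ((SmoothPartitionOfUnity.mem_finsupport f _).2 h00)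
  simp only [Pi.sub_apply, Pi.mul_apply] at ht1
  linarith

namespace IsDefiningFunction

variable {B : Set E3} {G : E3 → ℝ} {x : E3}

theorem isOpen (hG : IsDefiningFunction B G) : IsOpen B := by
  have : B = G ⁻¹' Iio 0 := by ext y; exact hG.mem_iff y
  rw [this]
  exact isOpen_Iio.preimage hG.contDiff.continuous

theorem isLocal (hG : IsDefiningFunction B G) (hx : x ∈ frontier B) :
    IsLocalDefiningFunction B x univ G :=
  ⟨isOpen_univ, mem_univ x, hG.contDiff.contDiffOn, hG.gradient_ne x hx, fun y _ => hG.mem_iff y⟩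

theorem eq_zero (hG : IsDefiningFunction B G) (hx : x ∈ frontier B) : G x = 0 :=
  (hG.isLocal hx).eq_zero (mem_univ x) hx hG.isOpen

theorem hasFDerivAt (hG : IsDefiningFunction B G) (x : E3) : HasFDerivAt G (fderiv ℝ G x) x :=
  (hG.contDiff.differentiable (by norm_num) x).hasFDerivAt

theorem normal_eq (hG : IsDefiningFunction B G) (hx : x ∈ frontier B) :
    normal B x = ‖gradient G x‖⁻¹ • gradient G x :=
  (hG.isLocal hx).normal_eq hG.isOpen hx

theorem mem_tangentCone (hG : IsDefiningFunction B G) (hx : x ∈ frontier B) {v : E3}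
    (hv : fderiv ℝ G x v < 0) : v ∈ tangentConeAt ℝ B x := by
  have e1 := eventually_neg_of_dir (hG.hasFDerivAt x) (hG.eq_zero hx).le hv
  refine mem_tangentConeAt_of_add_smul_mem (l := 𝓝[>] (0:ℝ)) (c := id)
    (tendsto_id'.mpr (nhdsGT_le_nhdsNE 0)) ?_
  filter_upwards [e1] with t ht
  exact (hG.mem_iff _).2 ht

/-- At a boundary point the tangent cone contains the open half-space of directions in which `G`
decreases, and this spans. Unique differentiability is what gives one-sided derivatives on `closure
B` the usual calculus rules. -/
theorem uniqueDiffOn_closure (hG : IsDefiningFunction B G) : UniqueDiffOn ℝ (closure B) := by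
  intro x hx
  by_cases hxB : x ∈ B
  · exact (hG.isOpen.uniqueDiffWithinAt hxB).mono subset_closure
  have hxf : x ∈ frontier B := by rw [hG.isOpen.frontier_eq]; exact ⟨hx, hxB⟩
  apply UniqueDiffWithinAt.closure
  refine ⟨?_, hx⟩
  set p := gradient G x with hp
  have hpp : fderiv ℝ G x p = ‖p‖ ^ 2 := by
    rw [← inner_gradient_eq, ← hp, real_inner_self_eq_norm_sq]
  have hp0 : 0 < ‖p‖ ^ 2 := pow_pos (norm_pos_iff.2 (hG.gradient_ne x hxf)) 2
  have : Submodule.span ℝ (tangentConeAt ℝ B x) = ⊤ := by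
    rw [eq_top_iff]
    intro w _
    have hpm : -p ∈ Submodule.span ℝ (tangentConeAt ℝ B x) :=
      Submodule.subset_span (hG.mem_tangentCone hxf (by rw [map_neg, hpp]; linarith))
    -- Chosen so that `G` decreases along `w - c p`; then `w` is a combination of this direction and
    -- `-p`.
    set c : ℝ := (|fderiv ℝ G x w| + 1) / ‖p‖ ^ 2
    have hc : c * ‖p‖ ^ 2 = |fderiv ℝ G x w| + 1 := div_mul_cancel₀ _ hp0.ne'
    have hw : w + c • (-p) ∈ Submodule.span ℝ (tangentConeAt ℝ B x) := by
      refine Submodule.subset_span (hG.mem_tangentCone hxf ?_)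
      rw [map_add, map_smul, map_neg, hpp, smul_eq_mul, mul_neg, hc]
      linarith [le_abs_self (fderiv ℝ G x w)]
    have := Submodule.sub_mem _ hw (Submodule.smul_mem _ c hpm)
    simpa using this
  rw [this]
  exact dense_univ

/-- Vectors orthogonal to the gradient are tangent to the boundary. -/
theorem mem_tangentCone_frontier (hG : IsDefiningFunction B G) (hx : x ∈ frontier B) {v : E3}
    (hv : fderiv ℝ G x v = 0) : v ∈ tangentConeAt ℝ (frontier B) x := by
  set p := gradient G x with hp
  have hpp : fderiv ℝ G x p = ‖p‖ ^ 2 := by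
    rw [← inner_gradient_eq, ← hp, real_inner_self_eq_norm_sq]
  have hp0 : 0 < ‖p‖ ^ 2 := pow_pos (norm_pos_iff.2 (hG.gradient_ne x hx)) 2
  -- Tilting `v` slightly by `-p` or by `p` leads into or out of `B`, and the segment between the
  -- two end points crosses the boundary at a smaller tilt `s`. Letting the tilt tend to zero
  -- realizes `v` as a tangent vector.
  have key : ∀ n : ℕ, ∃ t : ℝ, 0 < t ∧ t < 1 / ((n:ℝ) + 1) ∧ ∃ s : ℝ, |s| ≤ 1 / ((n:ℝ) + 1) ∧
      x + t • (v + s • p) ∈ frontier B := by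
    intro n
    set d : ℝ := 1 / ((n:ℝ) + 1) with hd
    have hdpos : 0 < d := by positivity
    have e1 := eventually_neg_of_dir (v := v + (-d) • p) (hG.hasFDerivAt x) (hG.eq_zero hx).le
      (by rw [map_add, map_smul, hv, hpp, smul_eq_mul]; nlinarith)
    have e2 := eventually_pos_of_dir (v := v + d • p) (hG.hasFDerivAt x) (hG.eq_zero hx).ge
      (by rw [map_add, map_smul, hv, hpp, smul_eq_mul]; nlinarith)
    have e3 : ∀ᶠ t : ℝ in 𝓝[>] 0, t ∈ Ioo 0 d := Ioo_mem_nhdsGT hdpos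
    obtain ⟨t, ⟨ht1, ht2⟩, ht3⟩ := ((e1.and e2).and e3).exists
    refine ⟨t, ht3.1, ht3.2, ?_⟩
    obtain ⟨c, hc, hcf⟩ := segment_inter_frontier hG.isOpen ((hG.mem_iff _).2 ht1)
      (fun hb => absurd ((hG.mem_iff _).1 hb) (not_lt.2 ht2.le))
    obtain ⟨a, b, ha, hb, hab, rfl⟩ := hc
    refine ⟨a * (-d) + b * d, ?_, ?_⟩
    · rw [abs_le]; constructor <;> nlinarith
    · convert hcf using 1
      obtain rfl : a = 1 - b := by linarith
      module
  choose t ht0 ht1 s hs hf using key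
  have hlim := tendsto_one_div_add_atTop_nhds_zero_nat (𝕜 := ℝ)
  have htl : Tendsto t atTop (𝓝 0) := squeeze_zero (fun n => (ht0 n).le) (fun n => (ht1 n).le) hlim
  have hsl : Tendsto s atTop (𝓝 0) := squeeze_zero_norm hs hlim
  have hvl : Tendsto (fun n => v + s n • p) atTop (𝓝 v) := by
    simpa using tendsto_const_nhds.add (hsl.smul_const p)
  refine mem_tangentConeAt_of_seq atTop (fun n => (t n)⁻¹) (fun n => t n • (v + s n • p)) ?_
    (Eventually.of_forall hf) ?_
  · simpa using htl.smul hvl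
  · refine hvl.congr fun n => ?_
    rw [smul_smul, inv_mul_cancel₀ (ht0 n).ne', one_smul]

theorem fderiv_normal_proj (hG : IsDefiningFunction B G) (hx : x ∈ frontier B) (w : E3) :
    fderiv ℝ G x (w - inner ℝ (normal B x) w • normal B x) = 0 := by
  have h0 : ‖gradient G x‖ ≠ 0 := norm_ne_zero_iff.2 (hG.gradient_ne x hx)
  rw [← inner_gradient_eq, hG.normal_eq hx, inner_sub_right, inner_smul_right, inner_smul_left,
    inner_smul_right, real_inner_self_eq_norm_sq]
  simp only [conj_trivial]
  field_simp
  ring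

/-- The surface gradient of a function that is differentiable along the boundary. -/
theorem surfGrad_eq (hG : IsDefiningFunction B G) (hx : x ∈ frontier B) {h : E3 → ℝ}
    {L : E3 →L[ℝ] ℝ} (hL : HasFDerivWithinAt h L (frontier B) x) (i : Fin 3) :
    surfGrad B h i x = L (EuclideanSpace.single i 1 - normal B x i • normal B x) := by
  unfold surfGrad
  -- A derivative within a surface is not unique, but any two choices agree on the tangent cone, and
  -- the projected basis vector lies there.
  refine hL.differentiableWithinAt.hasFDerivWithinAt.unique_on hL ?_
  refine hG.mem_tangentCone_frontier hx ?_
  have := hG.fderiv_normal_proj hx (EuclideanSpace.single i 1)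
  simpa [EuclideanSpace.inner_single_right] using this

end IsDefiningFunction

end Thermopiezo
end

noncomputable section
namespace Thermopiezo
open Set Filter Topology Metric MeasureTheory
open scoped ContDiff

/-! ### A divergence theorem without surface measure -/

/-- The `j`-th partial derivative within the closure of `B`. -/
def pd (B : Set E3) (F : E3 → ℝ) (j : Fin 3) (x : E3) : ℝ :=
  fderivWithin ℝ F (closure B) x (EuclideanSpace.single j 1)

theorem pd_eq_fderiv {B : Set E3} (hB : IsOpen B) (F : E3 → ℝ) (j : Fin 3) {x : E3} (hx : x ∈ B) :
    pd B F j x = fderiv ℝ F x (EuclideanSpace.single j 1) := by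
  unfold pd
  rw [fderivWithin_of_mem_nhds (mem_of_superset (hB.mem_nhds hx) subset_closure)]

theorem ContinuousOn.integrableOn_of_closure {B : Set E3} (hb : Bornology.IsBounded B) {f : E3 → ℝ}
    (hf : ContinuousOn f (closure B)) : IntegrableOn f B :=
  (hf.integrableOn_compact hb.isCompact_closure).mono_set subset_closure

theorem integrable_of_support {B K : Set E3} (hK : IsCompact K) (hKB : K ⊆ B) {f : E3 → ℝ}
    (hf : ContinuousOn f B) (h0 : ∀ x ∉ K, f x = 0) : Integrable f :=
  ((hf.mono hKB).integrableOn_compact hK).integrable_of_forall_notMem_eq_zero h0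

/-- Integration by parts against a function with compact support in `B`. -/
theorem setIntegral_mul_fderiv {B : Set E3} (hB : IsOpen B) {F η : E3 → ℝ}
    (hF : ContDiffOn ℝ 1 F B) (hη : ContDiff ℝ 1 η) (hc : HasCompactSupport η)
    (hs : tsupport η ⊆ B) (v : E3) :
    ∫ x in B, F x * fderiv ℝ η x v = -∫ x in B, fderiv ℝ F x v * η x := by
  have hη0 : ∀ x ∉ tsupport η, η x = 0 := fun x hx => image_eq_zero_of_notMem_tsupport hx
  have hdη0 : ∀ x ∉ tsupport η, fderiv ℝ η x v = 0 := by
    intro x hx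
    rw [fderiv_of_notMem_tsupport _ hx]; rfl
  have hFc : ContinuousOn F B := hF.continuousOn
  have hdF : ContinuousOn (fun x => fderiv ℝ F x v) B :=
    (hF.continuousOn_fderiv_of_isOpen hB le_rfl).clm_apply continuousOn_const
  have hdη : Continuous (fun x => fderiv ℝ η x v) :=
    (hη.continuous_fderiv (by norm_num)).clm_apply continuous_const
  rw [setIntegral_eq_integral_of_forall_compl_eq_zero, setIntegral_eq_integral_of_forall_compl_eq_zero]
  · refine integral_mul_fderiv_eq_neg_fderiv_mul_of_integrable ?_ ?_ ?_ ?_ ?_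
    · exact integrable_of_support hc hs (hdF.mul hη.continuous.continuousOn)
        fun x hx => by rw [hη0 x hx, mul_zero]
    · exact integrable_of_support hc hs (hFc.mul hdη.continuousOn)
        fun x hx => by rw [hdη0 x hx, mul_zero]
    · exact integrable_of_support hc hs (hFc.mul hη.continuous.continuousOn)
        fun x hx => by rw [hη0 x hx, mul_zero]
    · exact fun x hx => (hF.contDiffAt (hB.mem_nhds (hs hx))).differentiableAt (by norm_num)
    · exact fun x _ => hη.differentiable (by norm_num) x
  · exact fun x hx => by rw [hη0 x (fun h => hx (hs h)), mul_zero]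
  · exact fun x hx => by rw [hdη0 x (fun h => hx (hs h)), mul_zero]

/-! ### Cut-off functions, boundary layers and the divergence theorem -/

/-- Cut-off functions exhausting `{G < 0}`. -/
def cutoff (G : E3 → ℝ) (n : ℕ) (x : E3) : ℝ := Real.smoothTransition (-((n:ℝ) + 1) * G x - 1)

/-- The density of the gradient of the cut-off with respect to the gradient of `G`. -/
def layer (G : E3 → ℝ) (n : ℕ) (x : E3) : ℝ :=
  ((n:ℝ) + 1) * deriv Real.smoothTransition (-((n:ℝ) + 1) * G x - 1)

theorem abs_cutoff_le_one (G : E3 → ℝ) (n : ℕ) (x : E3) : |cutoff G n x| ≤ 1 := by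
  rw [cutoff, abs_of_nonneg (Real.smoothTransition.nonneg _)]
  exact Real.smoothTransition.le_one _

theorem fderiv_single_eq (g : E3 → ℝ) (x : E3) (j : Fin 3) :
    fderiv ℝ g x (EuclideanSpace.single j 1) = gradient g x j := by
  rw [← inner_gradient_eq, EuclideanSpace.inner_single_right]
  simp only [conj_trivial, one_mul]

theorem layer_nonneg (G : E3 → ℝ) (n : ℕ) (x : E3) : 0 ≤ layer G n x :=
  mul_nonneg (by positivity) Real.smoothTransition.monotone.deriv_nonneg

theorem layer_eq_zero {G : E3 → ℝ} {n : ℕ} {x : E3} (h : G x ≤ -2 / ((n:ℝ) + 1)) :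
    layer G n x = 0 := by
  have hn : (0:ℝ) < (n:ℝ) + 1 := by positivity
  rw [le_div_iff₀ hn] at h
  have h1 : 1 ≤ -((n:ℝ) + 1) * G x - 1 := by linarith
  -- From the argument `1` on, the transition function sits at its maximum `1`, so its derivative
  -- vanishes, including at the end point `1`.
  have : IsLocalMax Real.smoothTransition (-((n:ℝ) + 1) * G x - 1) := by
    refine Eventually.of_forall fun y => ?_
    rw [Real.smoothTransition.one_of_one_le h1]
    exact Real.smoothTransition.le_one y
  rw [layer, this.deriv_eq_zero, mul_zero]

namespace IsDefiningFunction

variable {B : Set E3} {G : E3 → ℝ}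

theorem contDiff_cutoff (hG : IsDefiningFunction B G) (n : ℕ) : ContDiff ℝ 2 (cutoff G n) :=
  (Real.smoothTransition.contDiff (n := 2)).comp
    ((contDiff_const.mul hG.contDiff).sub contDiff_const)

theorem tsupport_cutoff (hG : IsDefiningFunction B G) (n : ℕ) : tsupport (cutoff G n) ⊆ B := by
  have hn : (0:ℝ) < (n:ℝ) + 1 := by positivity
  have hcl : IsClosed {x | G x ≤ -1 / ((n:ℝ) + 1)} := isClosed_le hG.contDiff.continuous
    continuous_const
  have : tsupport (cutoff G n) ⊆ {x | G x ≤ -1 / ((n:ℝ) + 1)} := by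
    refine closure_minimal (fun x hx => ?_) hcl
    by_contra hlt
    apply hx
    have hlt' : -1 / ((n:ℝ) + 1) < G x := not_le.1 hlt
    rw [div_lt_iff₀ hn] at hlt'
    exact Real.smoothTransition.zero_of_nonpos (by linarith)
  intro x hx
  rw [hG.mem_iff]
  exact lt_of_le_of_lt (this hx) (div_neg_of_neg_of_pos (by norm_num) hn)

theorem hasCompactSupport_cutoff (hG : IsDefiningFunction B G) (hb : Bornology.IsBounded B)
    (n : ℕ) : HasCompactSupport (cutoff G n) :=
  isCompact_of_isClosed_isBounded (isClosed_tsupport _) (hb.subset (hG.tsupport_cutoff n))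

theorem fderiv_cutoff (hG : IsDefiningFunction B G) (n : ℕ) (x v : E3) :
    fderiv ℝ (cutoff G n) x v = -(layer G n x * fderiv ℝ G x v) := by
  have h1 : HasDerivAt Real.smoothTransition
      (deriv Real.smoothTransition (-((n:ℝ) + 1) * G x - 1)) (-((n:ℝ) + 1) * G x - 1) :=
    ((Real.smoothTransition.contDiff (n := 1)).differentiable (by norm_num) _).hasDerivAt
  have h2 := h1.comp_hasFDerivAt x (((hG.hasFDerivAt x).const_mul (-((n:ℝ) + 1))).sub_const 1)
  have h3 : HasFDerivAt (cutoff G n) _ x := h2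
  rw [h3.fderiv, layer]
  simp
  ring

theorem continuous_layer (hG : IsDefiningFunction B G) (n : ℕ) : Continuous (layer G n) := by
  have h1 : Continuous (deriv Real.smoothTransition) :=
    (Real.smoothTransition.contDiff (n := 1)).continuous_deriv le_rfl
  have := hG.contDiff.continuous
  unfold layer
  fun_prop

theorem contDiff_fderiv_apply (hG : IsDefiningFunction B G) (v : E3) :
    ContDiff ℝ 1 (fun x => fderiv ℝ G x v) :=
  (hG.contDiff.fderiv_right (m := 1) (by norm_num)).clm_apply contDiff_const

/-- The layers have uniformly bounded mass. -/
theorem exists_layer_bound (hG : IsDefiningFunction B G) (hb : Bornology.IsBounded B) :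
    ∃ C, ∀ n, ∫ x in B, layer G n x * ∑ j, fderiv ℝ G x (EuclideanSpace.single j 1) ^ 2 ≤ C := by
  set e : Fin 3 → E3 := fun j => EuclideanSpace.single j 1
  have hdc : ∀ j, Continuous (fun x => fderiv ℝ G x (e j)) :=
    fun j => (hG.contDiff_fderiv_apply (e j)).continuous
  have hddc : ∀ j, Continuous (fun x => fderiv ℝ (fun y => fderiv ℝ G y (e j)) x (e j)) := fun j =>
    ((hG.contDiff_fderiv_apply (e j)).continuous_fderiv (by norm_num)).clm_apply continuous_const
  refine ⟨∑ j, ∫ x in B, |fderiv ℝ (fun y => fderiv ℝ G y (e j)) x (e j)|, fun n => ?_⟩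
  simp_rw [Finset.mul_sum]
  rw [integral_finsetSum]
  swap
  · exact fun j _ => ContinuousOn.integrableOn_of_closure hb
      ((hG.continuous_layer n).mul ((hdc j).pow 2)).continuousOn
  refine Finset.sum_le_sum fun j _ => ?_
  -- Integrating by parts against `∂_j G` moves the derivative off the cut-off, leaving `∂_j ∂_j G`
  -- times a factor bounded by one. This is where two derivatives of `G` are needed.
  have h1 := setIntegral_mul_fderiv hG.isOpen (hG.contDiff_fderiv_apply (e j)).contDiffOn
    ((hG.contDiff_cutoff n).of_le (by norm_num)) (hG.hasCompactSupport_cutoff hb n)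
    (hG.tsupport_cutoff n) (e j)
  have h2 : ∫ x in B, layer G n x * fderiv ℝ G x (e j) ^ 2
      = ∫ x in B, fderiv ℝ (fun y => fderiv ℝ G y (e j)) x (e j) * cutoff G n x := by
    have h3 : ∫ x in B, layer G n x * fderiv ℝ G x (e j) ^ 2
        = -∫ x in B, fderiv ℝ G x (e j) * fderiv ℝ (cutoff G n) x (e j) := by
      rw [← integral_neg]
      congr 1
      ext x
      rw [hG.fderiv_cutoff]
      ring
    rw [h3, h1, neg_neg]
  rw [h2]
  refine integral_mono ?_ ?_ fun x => ?_
  · exact ContinuousOn.integrableOn_of_closure hb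
      ((hddc j).mul (hG.contDiff_cutoff n).continuous).continuousOn
  · exact ContinuousOn.integrableOn_of_closure hb (hddc j).abs.continuousOn
  · refine (le_abs_self _).trans ?_
    rw [abs_mul]
    exact mul_le_of_le_one_right (abs_nonneg _) (abs_cutoff_le_one G n x)

theorem sum_sq_pos (hG : IsDefiningFunction B G) {x : E3} (hx : x ∈ frontier B) :
    0 < ∑ j, fderiv ℝ G x (EuclideanSpace.single j 1) ^ 2 := by
  simp_rw [fderiv_single_eq]
  have := EuclideanSpace.real_norm_sq_eq (gradient G x)
  rw [← this]
  exact pow_pos (norm_pos_iff.2 (hG.gradient_ne x hx)) 2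

/-- The layers do not see functions that vanish on the boundary. -/
theorem tendsto_integral_layer (hG : IsDefiningFunction B G) (hb : Bornology.IsBounded B)
    {φ : E3 → ℝ} (hφ : ContinuousOn φ (closure B)) (h0 : ∀ x ∈ frontier B, φ x = 0) :
    Tendsto (fun n => ∫ x in B, layer G n x * φ x) atTop (𝓝 0) := by
  obtain ⟨C, hC⟩ := hG.exists_layer_bound hb
  set q : E3 → ℝ := fun x => ∑ j, fderiv ℝ G x (EuclideanSpace.single j 1) ^ 2 with hq
  have hqc : Continuous q := continuous_finsetSum _ fun j _ =>
    ((hG.contDiff_fderiv_apply _).continuous).pow 2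
  have hqn : ∀ x, 0 ≤ q x := fun x => Finset.sum_nonneg fun j _ => sq_nonneg _
  -- The set where `|φ| ≥ δ |∇G|²` is compact and misses the boundary, where `φ = 0` and `∇G ≠ 0`.
  -- So `G` is bounded away from zero on it and the layers eventually vanish there. Elsewhere `|φ|`
  -- is dominated by `δ |∇G|²`, whose integral against the layers is at most `δ C`.
  have hlayer : ∀ δ > 0, ∀ᶠ n : ℕ in atTop, ∀ x ∈ B, layer G n x * |φ x| ≤ layer G n x * (δ * q x) := by
    intro δ hδ
    have hK : IsCompact {x ∈ closure B | δ * q x ≤ |φ x|} := by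
      have := (hφ.abs.sub (continuousOn_const.mul hqc.continuousOn)
        (f := fun x => |φ x|) (g := fun x => δ * q x)).preimage_isClosed_of_isClosed
        isClosed_closure (isClosed_Ici (a := (0:ℝ)))
      refine hb.isCompact_closure.of_isClosed_subset ?_ (fun x hx => hx.1)
      convert! this using 1
      ext x
      simp
    set K := {x ∈ closure B | δ * q x ≤ |φ x|} with hKdef
    have hKB : ∀ x ∈ K, G x < 0 := by
      intro x hx
      by_contra hn
      have hxf : x ∈ frontier B := by
        rw [hG.isOpen.frontier_eq]
        exact ⟨hx.1, fun hb => hn ((hG.mem_iff x).1 hb)⟩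
      have h1 := hx.2
      rw [h0 x hxf, abs_zero] at h1
      have := mul_pos hδ (hG.sum_sq_pos hxf)
      exact absurd h1 (not_le.2 this)
    obtain ⟨m, hm0, hm⟩ : ∃ m > 0, ∀ x ∈ K, G x ≤ -m := by
      rcases K.eq_empty_or_nonempty with hE | hne
      · exact ⟨1, one_pos, by simp [hE]⟩
      · obtain ⟨z, hz, hmax⟩ := hK.exists_isMaxOn hne hG.contDiff.continuous.continuousOn
        exact ⟨-G z, by linarith [hKB z hz], fun x hx => by
          have : G x ≤ G z := hmax hx
          linarith⟩
    have hlim : Tendsto (fun n : ℕ => 2 * (1 / ((n:ℝ) + 1))) atTop (𝓝 (2 * 0)) :=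
      tendsto_one_div_add_atTop_nhds_zero_nat.const_mul 2
    rw [mul_zero] at hlim
    filter_upwards [hlim.eventually (gt_mem_nhds hm0)] with n hn x hx
    by_cases hxK : x ∈ K
    · rw [layer_eq_zero, zero_mul, zero_mul]
      have := hm x hxK
      have e : -2 / ((n:ℝ) + 1) = -(2 * (1 / ((n:ℝ) + 1))) := by ring
      rw [e]; linarith
    · refine mul_le_mul_of_nonneg_left ?_ (layer_nonneg G n x)
      by_contra hn'
      exact hxK ⟨subset_closure hx, (not_le.1 hn').le⟩
  rw [Metric.tendsto_atTop']
  intro ε hε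
  have hCp : 0 < |C| + 1 := by positivity
  obtain ⟨N, hN⟩ := eventually_atTop.1 (hlayer (ε / (2 * (|C| + 1))) (by positivity))
  refine ⟨N, fun n hn => ?_⟩
  rw [dist_zero_right]
  have hb1 : ‖∫ x in B, layer G n x * φ x‖ ≤ ∫ x in B, (ε / (2 * (|C| + 1))) * (layer G n x * q x) := by
    refine norm_integral_le_of_norm_le ?_ ?_
    · exact ContinuousOn.integrableOn_of_closure hb
        (continuous_const.mul ((hG.continuous_layer n).mul hqc)).continuousOn
    · refine (ae_restrict_iff' hG.isOpen.measurableSet).2 (Eventually.of_forall fun x hx => ?_)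
      rw [Real.norm_eq_abs, abs_mul, abs_of_nonneg (layer_nonneg G n x)]
      refine (hN n hn.le x hx).trans_eq ?_
      ring
  refine hb1.trans_lt ?_
  rw [integral_const_mul]
  have h2 : ∫ x in B, layer G n x * q x ≤ |C| := (hC n).trans (le_abs_self C)
  calc (ε / (2 * (|C| + 1))) * ∫ x in B, layer G n x * q x
      ≤ (ε / (2 * (|C| + 1))) * (|C| + 1) :=
        mul_le_mul_of_nonneg_left (by linarith) (by positivity)
    _ = ε / 2 := by field_simp
    _ < ε := by linarith

theorem tendsto_integral_cutoff (hG : IsDefiningFunction B G) (hb : Bornology.IsBounded B)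
    {f : E3 → ℝ} (hf : ContinuousOn f (closure B)) :
    Tendsto (fun n => ∫ x in B, f x * cutoff G n x) atTop (𝓝 (∫ x in B, f x)) := by
  refine tendsto_integral_of_dominated_convergence (fun x => |f x|) (fun n => ?_) ?_ (fun n => ?_) ?_
  · exact (ContinuousOn.integrableOn_of_closure hb
      (hf.mul (hG.contDiff_cutoff n).continuous.continuousOn)).aestronglyMeasurable
  · exact ContinuousOn.integrableOn_of_closure hb hf.abs
  · refine Eventually.of_forall fun x => ?_
    rw [Real.norm_eq_abs, abs_mul]
    exact mul_le_of_le_one_right (abs_nonneg _) (abs_cutoff_le_one G n x)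
  · refine (ae_restrict_iff' hG.isOpen.measurableSet).2 (Eventually.of_forall fun x hx => ?_)
    refine tendsto_const_nhds.congr' ?_
    have hneg := (hG.mem_iff x).1 hx
    have hlim : Tendsto (fun n : ℕ => 2 * (1 / ((n:ℝ) + 1))) atTop (𝓝 (2 * 0)) :=
      tendsto_one_div_add_atTop_nhds_zero_nat.const_mul 2
    rw [mul_zero] at hlim
    filter_upwards [hlim.eventually (gt_mem_nhds (neg_pos.2 hneg))] with n hn
    have hn1 : (0:ℝ) < (n:ℝ) + 1 := by positivity
    rw [mul_one_div, div_lt_iff₀ hn1] at hn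
    rw [cutoff, Real.smoothTransition.one_of_one_le (by linarith), mul_one]

/-- The divergence of an antisymmetric tensor field is weakly divergence-free. -/
theorem integral_fderiv_cutoff_antisymm (hG : IsDefiningFunction B G) (hb : Bornology.IsBounded B)
    {A : Fin 3 → Fin 3 → E3 → ℝ} (hA : ∀ j k, ContDiffOn ℝ 1 (A j k) B)
    (hAc : ∀ j k, ContinuousOn (pd B (A j k) k) (closure B))
    (hanti : ∀ j k x, A j k x = -A k j x) (n : ℕ) :
    ∫ x in B, ∑ j, ∑ k, pd B (A j k) k x *
      fderiv ℝ (cutoff G n) x (EuclideanSpace.single j 1) = 0 := by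
  set e : Fin 3 → E3 := fun j => EuclideanSpace.single j 1
  set η := cutoff G n
  have hη2 : ContDiff ℝ 2 η := hG.contDiff_cutoff n
  have hc := hG.hasCompactSupport_cutoff hb n
  have hηj : ∀ j, ContDiff ℝ 1 (fun x => fderiv ℝ η x (e j)) := fun j =>
    (hη2.fderiv_right (m := 1) (by norm_num)).clm_apply contDiff_const
  have hηjc : ∀ j, HasCompactSupport (fun x => fderiv ℝ η x (e j)) := fun j =>
    hc.fderiv_apply ℝ (e j)
  have hηjs : ∀ j, tsupport (fun x => fderiv ℝ η x (e j)) ⊆ B := fun j =>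
    (tsupport_fderiv_apply_subset ℝ (e j)).trans (hG.tsupport_cutoff n)
  have hddc : ∀ j k, Continuous (fun x => fderiv ℝ (fun y => fderiv ℝ η y (e j)) x (e k)) :=
    fun j k => ((hηj j).continuous_fderiv (by norm_num)).clm_apply continuous_const
  have hi1 : ∀ j k, IntegrableOn (fun x => pd B (A j k) k x * fderiv ℝ η x (e j)) B := fun j k =>
    ContinuousOn.integrableOn_of_closure hb ((hAc j k).mul (hηj j).continuous.continuousOn)
  have hi2 : ∀ j k, IntegrableOn
      (fun x => A j k x * fderiv ℝ (fun y => fderiv ℝ η y (e j)) x (e k)) B := by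
    intro j k
    refine (integrable_of_support (hηjc j) (hηjs j)
      ((hA j k).continuousOn.mul (hddc j k).continuousOn) fun x hx => ?_).integrableOn
    have h0 : fderiv ℝ (fun y => fderiv ℝ η y (e j)) x = 0 := fderiv_of_notMem_tsupport _ hx
    simp [h0]
  have hparts : ∀ j k, ∫ x in B, pd B (A j k) k x * fderiv ℝ η x (e j)
      = -∫ x in B, A j k x * fderiv ℝ (fun y => fderiv ℝ η y (e j)) x (e k) := by
    intro j k
    rw [setIntegral_mul_fderiv hG.isOpen (hA j k) (hηj j) (hηjc j) (hηjs j) (e k), neg_neg]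
    refine setIntegral_congr_fun hG.isOpen.measurableSet fun x hx => ?_
    show _ * _ = _ * _
    rw [pd_eq_fderiv hG.isOpen _ _ hx]
  rw [integral_finsetSum _ fun j _ => integrable_finsetSum _ fun k _ => hi1 j k]
  have : ∀ j, ∫ x in B, ∑ k, pd B (A j k) k x * fderiv ℝ η x (e j)
      = -∫ x in B, ∑ k, A j k x * fderiv ℝ (fun y => fderiv ℝ η y (e j)) x (e k) := by
    intro j
    rw [integral_finsetSum _ fun k _ => hi1 j k, integral_finsetSum _ fun k _ => hi2 j k,
      ← Finset.sum_neg_distrib]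
    exact Finset.sum_congr rfl fun k _ => hparts j k
  rw [Finset.sum_congr rfl fun j _ => this j, Finset.sum_neg_distrib,
    ← integral_finsetSum _ fun j _ => integrable_finsetSum _ fun k _ => hi2 j k, neg_eq_zero]
  -- After moving the derivative from `A` to the cut-off, the integrand is an antisymmetric tensor
  -- contracted with a Hessian, which is symmetric because the cut-off is `C²`.
  refine integral_eq_zero_of_ae (Eventually.of_forall fun x => ?_)
  have hsymm : ∀ j k, fderiv ℝ (fun y => fderiv ℝ η y (e j)) x (e k)
      = fderiv ℝ (fun y => fderiv ℝ η y (e k)) x (e j) := by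
    intro j k
    have hd : DifferentiableAt ℝ (fderiv ℝ η) x :=
      (hη2.fderiv_right (m := 1) (by norm_num)).differentiable (by norm_num) x
    have h1 : ∀ v w, fderiv ℝ (fun y => fderiv ℝ η y v) x w = fderiv ℝ (fderiv ℝ η) x w v := by
      intro v w
      rw [fderiv_clm_apply hd (differentiableAt_const v)]
      simp
    rw [h1, h1]
    exact (hη2.contDiffAt.isSymmSndFDerivAt (by simp)).eq _ _
  show ∑ j, ∑ k, A j k x * fderiv ℝ (fun y => fderiv ℝ η y (e j)) x (e k) = 0
  simp only [Fin.sum_univ_three]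
  have a00 := hanti 0 0 x
  have a11 := hanti 1 1 x
  have a22 := hanti 2 2 x
  rw [hanti 1 0, hanti 2 0, hanti 2 1, hsymm 1 0, hsymm 2 0, hsymm 2 1,
    show A 0 0 x = 0 by linarith, show A 1 1 x = 0 by linarith, show A 2 2 x = 0 by linarith]
  ring

theorem continuousOn_pd (hG : IsDefiningFunction B G) {F : E3 → ℝ}
    (hF : ContDiffOn ℝ 1 F (closure B)) (j : Fin 3) : ContinuousOn (pd B F j) (closure B) :=
  (hF.continuousOn_fderivWithin hG.uniqueDiffOn_closure le_rfl).clm_apply continuousOn_const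

/-- A divergence theorem: if the flux of `F` through the boundary equals the flux of the
divergence of an antisymmetric tensor field, then the divergence of `F` has integral zero. -/
theorem integral_div_eq_zero (hG : IsDefiningFunction B G) (hb : Bornology.IsBounded B)
    {F : Fin 3 → E3 → ℝ} (hF : ∀ j, ContDiffOn ℝ 1 (F j) (closure B))
    {A : Fin 3 → Fin 3 → E3 → ℝ} (hA : ∀ j k, ContDiffOn ℝ 1 (A j k) (closure B))
    (hanti : ∀ j k x, A j k x = -A k j x)
    (hbd : ∀ x ∈ frontier B, ∑ j, normal B x j * (F j x - ∑ k, pd B (A j k) k x) = 0) :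
    ∫ x in B, ∑ j, pd B (F j) j x = 0 := by
  have hpF : ∀ j, ContinuousOn (pd B (F j) j) (closure B) := fun j => hG.continuousOn_pd (hF j) j
  have hpA : ∀ j k, ContinuousOn (pd B (A j k) k) (closure B) :=
    fun j k => hG.continuousOn_pd (hA j k) k
  -- On the boundary this is `|∇G|` times the normal component of `F - div A`, hence zero there;
  -- unlike the normal it is defined on all of `closure B`.
  set φ : E3 → ℝ := fun x => ∑ j, fderiv ℝ G x (EuclideanSpace.single j 1) *
    (F j x - ∑ k, pd B (A j k) k x) with hφ
  have hφc : ContinuousOn φ (closure B) := continuousOn_finsetSum _ fun j _ =>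
    (hG.contDiff_fderiv_apply _).continuous.continuousOn.mul
      ((hF j).continuousOn.sub (continuousOn_finsetSum _ fun k _ => hpA j k))
  have hφ0 : ∀ x ∈ frontier B, φ x = 0 := by
    intro x hx
    have h1 : ∀ j, fderiv ℝ G x (EuclideanSpace.single j 1) = ‖gradient G x‖ * normal B x j := by
      intro j
      have : ‖gradient G x‖ ≠ 0 := norm_ne_zero_iff.2 (hG.gradient_ne x hx)
      rw [hG.normal_eq hx, fderiv_single_eq, PiLp.smul_apply, smul_eq_mul, mul_inv_cancel_left₀ this]
    rw [hφ]
    simp only [h1, mul_assoc]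
    rw [← Finset.mul_sum, hbd x hx, mul_zero]
  have hlim1 := hG.tendsto_integral_cutoff hb (continuousOn_finsetSum Finset.univ fun j _ => hpF j)
  have hlim2 := hG.tendsto_integral_layer hb hφc hφ0
  -- For each cut-off `η`, the integral of `η div F` equals that of `-F · ∇η`. The term `(div A) ·
  -- ∇η` can be added because its integral is zero, and `∇η = -layer · ∇G` turns the sum into the
  -- layer integral of `φ`.
  refine tendsto_nhds_unique hlim1 (hlim2.congr fun n => ?_)
  set η := cutoff G n with hη
  have hη1 : ContDiff ℝ 1 η := (hG.contDiff_cutoff n).of_le (by norm_num)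
  have hdη : ∀ j : Fin 3, Continuous (fun x => fderiv ℝ η x (EuclideanSpace.single j 1)) := fun j =>
    (hη1.continuous_fderiv (by norm_num)).clm_apply continuous_const
  have hanti0 := hG.integral_fderiv_cutoff_antisymm hb (fun j k => (hA j k).mono subset_closure)
    hpA hanti n
  have hparts : ∀ j, ∫ x in B, F j x * fderiv ℝ η x (EuclideanSpace.single j 1)
      = -∫ x in B, pd B (F j) j x * η x := by
    intro j
    rw [setIntegral_mul_fderiv hG.isOpen ((hF j).mono subset_closure) hη1
      (hG.hasCompactSupport_cutoff hb n) (hG.tsupport_cutoff n)]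
    congr 1
    refine setIntegral_congr_fun hG.isOpen.measurableSet fun x hx => ?_
    show _ * _ = _ * _
    rw [pd_eq_fderiv hG.isOpen _ _ hx]
  have hiF : ∀ j, IntegrableOn (fun x => F j x * fderiv ℝ η x (EuclideanSpace.single j 1)) B :=
    fun j => ContinuousOn.integrableOn_of_closure hb ((hF j).continuousOn.mul (hdη j).continuousOn)
  have hiA : IntegrableOn (fun x => ∑ j, ∑ k, pd B (A j k) k x *
      fderiv ℝ η x (EuclideanSpace.single j 1)) B :=
    ContinuousOn.integrableOn_of_closure hb (continuousOn_finsetSum _ fun j _ =>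
      continuousOn_finsetSum _ fun k _ => (hpA j k).mul (hdη j).continuousOn)
  have e1 : ∀ x, layer G n x * φ x = (∑ j, ∑ k, pd B (A j k) k x *
      fderiv ℝ η x (EuclideanSpace.single j 1))
      - ∑ j, F j x * fderiv ℝ η x (EuclideanSpace.single j 1) := by
    intro x
    simp only [hφ, hη, hG.fderiv_cutoff, Fin.sum_univ_three]
    ring
  simp_rw [e1]
  rw [integral_sub hiA (integrable_finsetSum _ fun j _ => hiF j), hanti0, zero_sub,
    integral_finsetSum _ fun j _ => hiF j, Finset.sum_congr rfl fun j _ => hparts j,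
    Finset.sum_neg_distrib, neg_neg]
  simp_rw [Finset.sum_mul]
  rw [integral_finsetSum]
  exact fun j _ => ContinuousOn.integrableOn_of_closure hb
    ((hpF j).mul hη1.continuous.continuousOn)

end IsDefiningFunction

end Thermopiezo
end

noncomputable section
namespace Thermopiezo
open Set Filter Topology Metric MeasureTheory
open scoped ContDiff

/-! ### Calculus of partial derivatives within the closure -/

section pd_calculus

variable {B : Set E3} {F H : E3 → ℝ} {x : E3}

theorem ContDiffOn.diffAt {n : WithTop ℕ∞} {s : Set E3} (hF : ContDiffOn ℝ n F s) (hn : n ≠ 0)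
    (hx : x ∈ s) : DifferentiableWithinAt ℝ F s x := hF.differentiableOn hn x hx

theorem pd_congr (h : EqOn F H (closure B)) (hx : x ∈ closure B) (j : Fin 3) :
    pd B F j x = pd B H j x := by
  unfold pd; rw [fderivWithin_congr h (h hx)]

theorem pd_add (hU : UniqueDiffOn ℝ (closure B)) (hF : ContDiffOn ℝ 1 F (closure B))
    (hH : ContDiffOn ℝ 1 H (closure B)) (hx : x ∈ closure B) (j : Fin 3) :
    pd B (fun y => F y + H y) j x = pd B F j x + pd B H j x := by
  unfold pd
  rw [fderivWithin_fun_add (hU x hx) (ContDiffOn.diffAt hF one_ne_zero hx)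
    (ContDiffOn.diffAt hH one_ne_zero hx)]
  rfl

theorem pd_sub (hU : UniqueDiffOn ℝ (closure B)) (hF : ContDiffOn ℝ 1 F (closure B))
    (hH : ContDiffOn ℝ 1 H (closure B)) (hx : x ∈ closure B) (j : Fin 3) :
    pd B (fun y => F y - H y) j x = pd B F j x - pd B H j x := by
  unfold pd
  rw [fderivWithin_fun_sub (hU x hx) (ContDiffOn.diffAt hF one_ne_zero hx)
    (ContDiffOn.diffAt hH one_ne_zero hx)]
  rfl

theorem pd_mul (hU : UniqueDiffOn ℝ (closure B)) (hF : ContDiffOn ℝ 1 F (closure B))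
    (hH : ContDiffOn ℝ 1 H (closure B)) (hx : x ∈ closure B) (j : Fin 3) :
    pd B (fun y => F y * H y) j x = pd B F j x * H x + F x * pd B H j x := by
  unfold pd
  rw [fderivWithin_fun_mul (hU x hx) (ContDiffOn.diffAt hF one_ne_zero hx)
    (ContDiffOn.diffAt hH one_ne_zero hx)]
  simp
  ring

theorem pd_sum (hU : UniqueDiffOn ℝ (closure B)) {K : Fin 3 → E3 → ℝ}
    (hK : ∀ k, ContDiffOn ℝ 1 (K k) (closure B)) (hx : x ∈ closure B) (j : Fin 3) :
    pd B (fun y => ∑ k, K k y) j x = ∑ k, pd B (K k) j x := by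
  unfold pd
  rw [fderivWithin_fun_sum (hU x hx) fun k _ => ContDiffOn.diffAt (hK k) one_ne_zero hx]
  simp

theorem contDiffOn_pd (hU : UniqueDiffOn ℝ (closure B)) {m n : WithTop ℕ∞}
    (hF : ContDiffOn ℝ n F (closure B)) (hmn : m + 1 ≤ n) (j : Fin 3) :
    ContDiffOn ℝ m (pd B F j) (closure B) :=
  (hF.fderivWithin hU hmn).clm_apply contDiffOn_const

theorem sum_single_eq (v : E3) : v = ∑ m, v m • EuclideanSpace.single m (1:ℝ) := by
  ext i
  simp [Fin.sum_univ_three]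
  fin_cases i <;> simp

theorem clm_apply_eq_sum (L : E3 →L[ℝ] ℝ) (v : E3) :
    L v = ∑ m, v m * L (EuclideanSpace.single m 1) := by
  conv_lhs => rw [sum_single_eq v]
  simp

end pd_calculus

/-! ### Extension of the normal into the region -/

namespace IsDefiningFunction

variable {B : Set E3} {G : E3 → ℝ}

/-- A `C¹` extension of the unit normal to the closure of the domain. -/
theorem exists_normal_extension (hG : IsDefiningFunction B G) :
    ∃ N : Fin 3 → E3 → ℝ, (∀ j, ContDiffOn ℝ 1 (N j) (closure B)) ∧
      (∀ x ∈ frontier B, ∀ j, N j x = normal B x j) ∧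
      (∀ x ∈ frontier B, ∑ k, N k x * N k x = 1) ∧
      ∀ x ∈ frontier B, ∀ j, ∑ k, N k x * pd B (N k) j x = 0 := by
  have hU := hG.uniqueDiffOn_closure
  set D : Fin 3 → E3 → ℝ := fun j x => fderiv ℝ G x (EuclideanSpace.single j 1) with hD
  have hD1 : ∀ j, ContDiff ℝ 1 (D j) := fun j => hG.contDiff_fderiv_apply _
  have hG1 : ContDiff ℝ 1 G := hG.contDiff.of_le (by norm_num)
  -- `∇G` may vanish inside `B`, so the extension is `∇G / √(|∇G|² + G²)`: the term `G²` keeps the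
  -- denominator positive where `G < 0` and disappears on the boundary.
  set q : E3 → ℝ := fun x => (∑ j, D j x ^ 2) + G x ^ 2 with hq
  have hqc : ContDiff ℝ 1 q := (ContDiff.sum fun j _ => (hD1 j).pow 2).add (hG1.pow 2)
  have hqpos : ∀ x ∈ closure B, 0 < q x := by
    intro x hx
    have h1 : 0 ≤ ∑ j, D j x ^ 2 := Finset.sum_nonneg fun j _ => sq_nonneg _
    by_cases hxB : x ∈ B
    · have := (hG.mem_iff x).1 hxB
      have : 0 < G x ^ 2 := by have := this.ne; positivity
      show 0 < (∑ j, D j x ^ 2) + G x ^ 2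
      linarith
    · have := hG.sum_sq_pos (x := x) (by rw [hG.isOpen.frontier_eq]; exact ⟨hx, hxB⟩)
      exact add_pos_of_pos_of_nonneg this (sq_nonneg _)
  set r : E3 → ℝ := fun x => (Real.sqrt (q x))⁻¹ with hr
  have hrc : ContDiffOn ℝ 1 r (closure B) :=
    (hqc.contDiffOn.sqrt fun x hx => (hqpos x hx).ne').inv
      fun x hx => (Real.sqrt_pos.2 (hqpos x hx)).ne'
  have hrq : ∀ x ∈ closure B, r x * r x * q x = 1 := by
    intro x hx
    have h0 := (Real.sqrt_pos.2 (hqpos x hx)).ne'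
    have h1 := Real.mul_self_sqrt (hqpos x hx).le
    simp only [hr]
    field_simp
    nlinarith
  have hN1 : ∀ j, ContDiffOn ℝ 1 (fun x => D j x * r x) (closure B) := fun j =>
    (hD1 j).contDiffOn.mul hrc
  have hGr : ContDiffOn ℝ 1 (fun x => G x * r x) (closure B) := hG1.contDiffOn.mul hrc
  have hf : ∀ x ∈ frontier B, x ∈ closure B := fun x hx => frontier_subset_closure hx
  refine ⟨fun j x => D j x * r x, hN1, fun x hx j => ?_, fun x hx => ?_, fun x hx j => ?_⟩
  · have : q x = ‖gradient G x‖ ^ 2 := by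
      simp only [hq, hD, hG.eq_zero hx, fderiv_single_eq]
      rw [EuclideanSpace.real_norm_sq_eq]
      simp
    rw [hG.normal_eq hx]
    simp only [hD, hr, this, fderiv_single_eq, Real.sqrt_sq (norm_nonneg _)]
    rw [PiLp.smul_apply, smul_eq_mul, mul_comm]
  · have h1 := hrq x (hf x hx)
    simp only [hq, hG.eq_zero hx, Fin.sum_univ_three] at h1 ⊢
    linear_combination h1
  · have hsq : ∀ {K : E3 → ℝ}, ContDiffOn ℝ 1 K (closure B) →
        pd B (fun y => K y * K y) j x = 2 * (K x * pd B K j x) := by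
      intro K hK
      rw [pd_mul hU hK hK (hf x hx)]; ring
    -- Differentiate the identity `|N|² + (G r)² = 1`. The second term is quadratic in `G`, so its
    -- derivative vanishes on the boundary and `∑ N_k ∂_j N_k = 0` remains, also in the normal
    -- direction.
    have hc : pd B (fun y => (∑ k, D k y * r y * (D k y * r y)) + G y * r y * (G y * r y)) j x
        = pd B (fun _ => 1) j x := by
      refine pd_congr (fun y hy => ?_) (hf x hx) j
      have h1 := hrq y hy
      simp only [hq, Fin.sum_univ_three] at h1 ⊢
      linear_combination h1
    rw [pd_add hU (ContDiffOn.sum fun k _ => (hN1 k).mul (hN1 k)) (hGr.mul hGr) (hf x hx),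
      pd_sum hU (fun k => (hN1 k).mul (hN1 k)) (hf x hx), hsq hGr,
      Finset.sum_congr rfl fun k _ => hsq (hN1 k), ← Finset.mul_sum] at hc
    have hc0 : pd B (fun _ => (1:ℝ)) j x = 0 := by unfold pd; simp
    rw [hc0, hG.eq_zero hx] at hc
    linarith

/-- Surface gradient of a function that agrees on the boundary with a `C¹` function. -/
theorem surfGrad_eq_pd (hG : IsDefiningFunction B G) {x : E3} (hx : x ∈ frontier B) {h H : E3 → ℝ}
    (hH : ContDiffOn ℝ 1 H (closure B)) (hhH : ∀ y ∈ frontier B, h y = H y) (i : Fin 3) :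
    surfGrad B h i x = pd B H i x - normal B x i * ∑ m, normal B x m * pd B H m x := by
  have h1 := (ContDiffOn.diffAt hH one_ne_zero (frontier_subset_closure hx)).hasFDerivWithinAt
  have h2 : HasFDerivWithinAt h (fderivWithin ℝ H (closure B) x) (frontier B) x :=
    (h1.mono frontier_subset_closure).congr hhH (hhH x hx)
  rw [hG.surfGrad_eq hx h2, map_sub, map_smul, clm_apply_eq_sum _ (normal B x)]
  rfl

end IsDefiningFunction

/-! ### Virtual work for second-gradient loads -/

/-- The generalized traction `(s_j - M_{kj,k}) n_j - D_j (M_{kj} n_k) + (D_l n_l) M_{kj} n_k n_j`. -/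
def traction (B : Set E3) (s : Fin 3 → E3 → ℝ) (M : Fin 3 → Fin 3 → E3 → ℝ) (x : E3) : ℝ :=
  (∑ j, (s j x - ∑ k, pd B (M k j) k x) * normal B x j)
    - (∑ j, surfGrad B (fun y => ∑ k, M k j y * normal B y k) j x)
    + (∑ l, surfGrad B (fun y => normal B y l) l x)
      * ∑ j, ∑ k, M k j x * normal B x k * normal B x j

/-- The generalized hypertraction `M_{kj} n_k n_j`. -/
def hypertraction (B : Set E3) (M : Fin 3 → Fin 3 → E3 → ℝ) (x : E3) : ℝ :=
  ∑ j, ∑ k, M k j x * normal B x k * normal B x j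

/-- With `A = n ⊗ w - w ⊗ n`, the normal component of `div A` is the surface divergence of the
tangential part of `w`, because `n_k ∂_j n_k = 0`. For `w = c v` this is the term that the surface
divergence theorem would discard. Subtracting it from the flux `a · n v + c · ∇v` removes the
tangential derivatives of `v` and leaves traction times `v` plus hypertraction times the normal
derivative of `v`. -/
theorem boundary_algebra (n c w dv a : Fin 3 → ℝ) (v : ℝ) (dN dc dw : Fin 3 → Fin 3 → ℝ)
    (M : Fin 3 → Fin 3 → ℝ) (hn : ∑ k, n k * n k = 1) (hdN : ∀ j, ∑ k, n k * dN k j = 0)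
    (hc : ∀ j, c j = ∑ k, M k j * n k) (hw : ∀ j, w j = c j * v)
    (hdw : ∀ j k, dw j k = dc j k * v + c j * dv k) :
    ∑ j, n j * (a j * v + ∑ k, M j k * dv k
      - ∑ k, (dN j k * w k + n j * dw k k - (dN k k * w j + n k * dw j k)))
    = ((∑ j, a j * n j) - (∑ j, (dc j j - n j * ∑ m, n m * dc j m))
        + (∑ l, (dN l l - n l * ∑ m, n m * dN l m)) * ∑ j, ∑ k, M k j * n k * n j) * v
      + (∑ j, ∑ k, M k j * n k * n j) * ∑ i, n i * dv i := by
  have h0 := hdN 0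
  have h1 := hdN 1
  have h2 := hdN 2
  simp only [hdw, hw, hc, Fin.sum_univ_three] at *
  set c0 := M 0 0 * n 0 + M 1 0 * n 1 + M 2 0 * n 2 with hc0
  set c1 := M 0 1 * n 0 + M 1 1 * n 1 + M 2 1 * n 2 with hc1
  set c2 := M 0 2 * n 0 + M 1 2 * n 1 + M 2 2 * n 2 with hc2
  have hR : M 0 0 * n 0 * n 0 + M 1 0 * n 1 * n 0 + M 2 0 * n 2 * n 0 +
      (M 0 1 * n 0 * n 1 + M 1 1 * n 1 * n 1 + M 2 1 * n 2 * n 1) +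
      (M 0 2 * n 0 * n 2 + M 1 2 * n 1 * n 2 + M 2 2 * n 2 * n 2)
      = c0 * n 0 + c1 * n 1 + c2 * n 2 := by rw [hc0, hc1, hc2]; ring
  rw [hR]
  have hS : (M 0 0 * dv 0 + M 0 1 * dv 1 + M 0 2 * dv 2) * n 0
      + (M 1 0 * dv 0 + M 1 1 * dv 1 + M 1 2 * dv 2) * n 1
      + (M 2 0 * dv 0 + M 2 1 * dv 1 + M 2 2 * dv 2) * n 2
      = c0 * dv 0 + c1 * dv 1 + c2 * dv 2 := by rw [hc0, hc1, hc2]; ring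
  clear_value c0 c1 c2
  linear_combination hS - ((dc 0 0 + dc 1 1 + dc 2 2) * v + c0 * dv 0 + c1 * dv 1 + c2 * dv 2) * hn
    + (-c0 * v + (c0 * n 0 + c1 * n 1 + c2 * n 2) * v * n 0) * h0
    + (-c1 * v + (c0 * n 0 + c1 * n 1 + c2 * n 2) * v * n 1) * h1
    + (-c2 * v + (c0 * n 0 + c1 * n 1 + c2 * n 2) * v * n 2) * h2

/-- Principle of virtual work for second-gradient materials, for test functions on which the
boundary loads do no work. -/
theorem IsDefiningFunction.virtual_work {B : Set E3} {G : E3 → ℝ} (hG : IsDefiningFunction B G)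
    (hb : Bornology.IsBounded B) {s : Fin 3 → E3 → ℝ} {M : Fin 3 → Fin 3 → E3 → ℝ} {v : E3 → ℝ}
    (hs : ∀ j, ContDiffOn ℝ 1 (s j) (closure B)) (hM : ∀ j k, ContDiffOn ℝ 2 (M j k) (closure B))
    (hv : ContDiffOn ℝ 2 v (closure B))
    (hP : ∀ x ∈ frontier B, traction B s M x * v x = 0)
    (hR : ∀ x ∈ frontier B, hypertraction B M x * ∑ i, normal B x i * pd B v i x = 0) :
    ∫ x in B, (((∑ j, pd B (s j) j x) - ∑ j, ∑ k, pd B (pd B (M k j) k) j x) * v x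
      + ∑ j, s j x * pd B v j x + ∑ j, ∑ k, M j k x * pd B (pd B v k) j x) = 0 := by
  have hU := hG.uniqueDiffOn_closure
  obtain ⟨N, hN, hNn, hN1, hNd⟩ := hG.exists_normal_extension
  have hv1 : ContDiffOn ℝ 1 v (closure B) := hv.of_le (by norm_num)
  have hM1 : ∀ j k, ContDiffOn ℝ 1 (M j k) (closure B) := fun j k => (hM j k).of_le (by norm_num)
  have hdM : ∀ j k l, ContDiffOn ℝ 1 (pd B (M j k) l) (closure B) := fun j k l =>
    contDiffOn_pd hU (hM j k) (by norm_num) l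
  have hdv : ∀ k, ContDiffOn ℝ 1 (pd B v k) (closure B) := fun k =>
    contDiffOn_pd hU hv (by norm_num) k
  set c : Fin 3 → E3 → ℝ := fun j x => ∑ k, M k j x * N k x with hc
  have hc1 : ∀ j, ContDiffOn ℝ 1 (c j) (closure B) := fun j =>
    ContDiffOn.sum fun k _ => (hM1 k j).mul (hN k)
  set w : Fin 3 → E3 → ℝ := fun j x => c j x * v x with hw
  have hw1 : ∀ j, ContDiffOn ℝ 1 (w j) (closure B) := fun j => (hc1 j).mul hv1
  set a : Fin 3 → E3 → ℝ := fun j x => s j x - ∑ k, pd B (M k j) k x with ha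
  have ha1 : ∀ j, ContDiffOn ℝ 1 (a j) (closure B) := fun j =>
    (hs j).sub (ContDiffOn.sum fun k _ => hdM k j k)
  set F : Fin 3 → E3 → ℝ := fun j x => a j x * v x + ∑ k, M j k x * pd B v k x with hF
  -- The antisymmetric field stands in for integration by parts along the closed surface. It uses
  -- the extended normal `N`, since `div A` needs derivatives in all directions.
  set A : Fin 3 → Fin 3 → E3 → ℝ := fun j k x => N j x * w k x - N k x * w j x with hA
  have hmv : ∀ j k, ContDiffOn ℝ 1 (fun x => M j k x * pd B v k x) (closure B) := fun j k =>
    (hM1 j k).mul (hdv k)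
  have hF1 : ∀ j, ContDiffOn ℝ 1 (F j) (closure B) := fun j =>
    ((ha1 j).mul hv1).add (ContDiffOn.sum fun k _ => hmv j k)
  have hA1 : ∀ j k, ContDiffOn ℝ 1 (A j k) (closure B) := fun j k =>
    ((hN j).mul (hw1 k)).sub ((hN k).mul (hw1 j))
  have hmain := hG.integral_div_eq_zero hb hF1 hA1 (fun j k x => by simp only [hA]; ring) ?_
  · rw [← hmain]
    refine setIntegral_congr_fun hG.isOpen.measurableSet fun x hxB => ?_
    have hx : x ∈ closure B := subset_closure hxB
    have e1 : ∀ j, pd B (F j) j x = ((pd B (s j) j x - ∑ k, pd B (pd B (M k j) k) j x) * v x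
        + a j x * pd B v j x)
        + ∑ k, (pd B (M j k) j x * pd B v k x + M j k x * pd B (pd B v k) j x) := by
      intro j
      rw [hF]
      simp only
      rw [pd_add hU ((ha1 j).mul hv1) (ContDiffOn.sum fun k _ => hmv j k) hx,
        pd_mul hU (ha1 j) hv1 hx, pd_sum hU (hmv j) hx,
        Finset.sum_congr rfl fun k _ => pd_mul hU (hM1 j k) (hdv k) hx j, ha]
      simp only
      rw [pd_sub hU (hs j) (ContDiffOn.sum fun k _ => hdM k j k) hx,
        pd_sum hU (fun k => hdM k j k) hx]
    simp only [e1, ha, Fin.sum_univ_three]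
    ring
  · intro x hxf
    have hx : x ∈ closure B := frontier_subset_closure hxf
    have hdA : ∀ j k, pd B (A j k) k x = pd B (N j) k x * w k x + N j x * pd B (w k) k x
        - (pd B (N k) k x * w j x + N k x * pd B (w j) k x) := by
      intro j k
      rw [hA]
      simp only
      rw [pd_sub hU ((hN j).mul (hw1 k)) ((hN k).mul (hw1 j)) hx, pd_mul hU (hN j) (hw1 k) hx,
        pd_mul hU (hN k) (hw1 j) hx]
    have halg := boundary_algebra (fun j => N j x) (fun j => c j x) (fun j => w j x)
      (fun j => pd B v j x) (fun j => a j x) (v x) (fun j k => pd B (N j) k x)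
      (fun j k => pd B (c j) k x) (fun j k => pd B (w j) k x) (fun j k => M j k x)
      (hN1 x hxf) (hNd x hxf) (fun j => rfl) (fun j => rfl)
      (fun j k => pd_mul hU (hc1 j) hv1 hx k)
    have hPx := hP x hxf
    have hRx := hR x hxf
    unfold traction at hPx
    unfold hypertraction at hRx
    simp only [hG.surfGrad_eq_pd hxf (hN _) (fun y hy => (hNn y hy _).symm)] at hPx
    have hsc : ∀ j i, surfGrad B (fun y => ∑ k, M k j y * normal B y k) i x = _ := fun j i =>
      hG.surfGrad_eq_pd hxf (hc1 j) (fun y hy => by simp only [hc, hNn y hy]) i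
    simp only [hsc] at hPx
    simp only [← hNn x hxf] at hPx hRx ⊢
    simp only [hdA, hF]
    rw [halg]
    linear_combination hPx + hRx

end Thermopiezo
end

noncomputable section
namespace Thermopiezo
open Set Filter Topology Metric MeasureTheory
open scoped ContDiff

/-! ### Fields of class `C^n` on `closure B × I` -/

theorem convex_timeInterval (t0 : EReal) : Convex ℝ (timeInterval t0) := by
  have : OrdConnected (timeInterval t0) := ⟨fun a ha b hb c hc =>
    ⟨ha.1.trans hc.1, lt_of_le_of_lt (EReal.coe_le_coe_iff.2 hc.2) hb.2⟩⟩
  exact this.convex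

theorem zero_mem_timeInterval {t0 : EReal} (h : 0 < t0) : (0:ℝ) ∈ timeInterval t0 :=
  ⟨le_rfl, by simpa using h⟩

theorem exists_gt_Icc_subset {t0 : EReal} {t : ℝ} (ht : t ∈ timeInterval t0) :
    ∃ b, t < b ∧ Icc 0 b ⊆ timeInterval t0 := by
  obtain ⟨b, hb1, hb2⟩ := EReal.lt_iff_exists_real_btwn.1 ht.2
  exact ⟨b, EReal.coe_lt_coe_iff.1 hb1, fun s hs =>
    ⟨hs.1, lt_of_le_of_lt (EReal.coe_le_coe_iff.2 hs.2) hb2⟩⟩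

theorem timeInterval_mem_nhds {t0 : EReal} {t : ℝ} (ht : t ∈ timeInterval t0) (hpos : 0 < t) :
    timeInterval t0 ∈ 𝓝 t := by
  obtain ⟨b, hb, hsub⟩ := exists_gt_Icc_subset ht
  exact mem_of_superset (Icc_mem_nhds hpos hb) hsub

theorem interior_timeInterval {t0 : EReal} {t : ℝ} (h : t ∈ interior (timeInterval t0)) :
    t ∈ timeInterval t0 ∧ 0 < t := by
  refine ⟨interior_subset h, ?_⟩
  have h1 : interior (timeInterval t0) ⊆ interior (Ici (0:ℝ)) := interior_mono fun s hs => hs.1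
  simpa using h1 h

theorem uniqueDiffOn_timeInterval {t0 : EReal} (h : 0 < t0) : UniqueDiffOn ℝ (timeInterval t0) := by
  refine uniqueDiffOn_convex (convex_timeInterval t0) ?_
  obtain ⟨b, hb, hsub⟩ := exists_gt_Icc_subset (zero_mem_timeInterval h)
  exact ⟨b / 2, mem_interior_iff_mem_nhds.2
    (mem_of_superset (Icc_mem_nhds (by linarith) (by linarith)) hsub)⟩

/-- `f` is of class `C^n` on `closure B × I`. -/
def IsClass (B : Set E3) (t0 : EReal) (n : WithTop ℕ∞) (f : Field) : Prop :=
  ContDiffOn ℝ n (fun p : ℝ × E3 => f p.1 p.2) (timeInterval t0 ×ˢ closure B)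

/-- `f` and `g` agree on `closure B × I`. -/
def EqField (B : Set E3) (t0 : EReal) (f g : Field) : Prop :=
  ∀ t ∈ timeInterval t0, ∀ x ∈ closure B, f t x = g t x

namespace IsClass

variable {B : Set E3} {t0 : EReal} {n m : WithTop ℕ∞} {f g : Field} {t : ℝ} {x : E3}

theorem of_le (hf : IsClass B t0 n f) (h : m ≤ n) : IsClass B t0 m f := ContDiffOn.of_le hf h

theorem congr (hf : IsClass B t0 n f) (h : EqField B t0 g f) : IsClass B t0 n g :=
  ContDiffOn.congr hf fun p hp => h p.1 hp.1 p.2 hp.2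

theorem slice (hf : IsClass B t0 n f) (ht : t ∈ timeInterval t0) :
    ContDiffOn ℝ n (f t) (closure B) := by
  have h1 : ContDiffOn ℝ n (fun y : E3 => ((t, y) : ℝ × E3)) (closure B) :=
    (contDiff_const.prodMk contDiff_id).contDiffOn
  have h2 : MapsTo (fun y : E3 => ((t, y) : ℝ × E3)) (closure B) (timeInterval t0 ×ˢ closure B) :=
    fun y hy => ⟨ht, hy⟩
  exact ContDiffOn.comp (g := fun p : ℝ × E3 => f p.1 p.2) hf h1 h2

/-- Used to freeze the loads at one time while the test fields keep moving. -/
theorem const (hf : IsClass B t0 n f) (ht : t ∈ timeInterval t0) :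
    IsClass B t0 n (fun _ x => f t x) :=
  (hf.slice ht).comp contDiff_snd.contDiffOn fun _ hp => hp.2

theorem continuousOn_time (hf : IsClass B t0 n f) (hx : x ∈ closure B) :
    ContinuousOn (fun s => f s x) (timeInterval t0) := by
  have h1 : ContinuousOn (fun s : ℝ => ((s, x) : ℝ × E3)) (timeInterval t0) := by fun_prop
  exact (ContDiffOn.continuousOn hf).comp h1 fun s hs => ⟨hs, hx⟩

theorem hasFDerivWithinAt (hf : IsClass B t0 1 f) (ht : t ∈ timeInterval t0) (hx : x ∈ closure B) :
    HasFDerivWithinAt (fun p : ℝ × E3 => f p.1 p.2)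
      (fderivWithin ℝ (fun p : ℝ × E3 => f p.1 p.2) (timeInterval t0 ×ˢ closure B) (t, x))
      (timeInterval t0 ×ˢ closure B) (t, x) :=
  (ContDiffOn.differentiableOn hf one_ne_zero (t, x) ⟨ht, hx⟩).hasFDerivWithinAt

/-- Expressing the partial derivative through the joint derivative on `I × closure B` is what lets
it inherit joint regularity in time and place; `dt_eq` does the same for the time derivative. -/
theorem dx_eq (hf : IsClass B t0 1 f) (hU : UniqueDiffOn ℝ (closure B)) (ht : t ∈ timeInterval t0)
    (hx : x ∈ closure B) (j : Fin 3) :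
    dx B f j t x = fderivWithin ℝ (fun p : ℝ × E3 => f p.1 p.2) (timeInterval t0 ×ˢ closure B) (t, x)
      (0, EuclideanSpace.single j 1) := by
  have h1 : HasFDerivWithinAt (fun y : E3 => ((t, y) : ℝ × E3))
      ((0 : E3 →L[ℝ] ℝ).prod (ContinuousLinearMap.id ℝ E3)) (closure B) x :=
    (hasFDerivWithinAt_const t x _).prodMk (hasFDerivWithinAt_id x _)
  have h2 := (hf.hasFDerivWithinAt ht hx).comp x h1 fun y hy => ⟨ht, hy⟩
  have h3 : HasFDerivWithinAt (f t) _ (closure B) x := h2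
  unfold dx
  rw [h3.fderivWithin (hU x hx)]
  simp

theorem hasDerivWithinAt_aux (hf : IsClass B t0 1 f) (ht : t ∈ timeInterval t0)
    (hx : x ∈ closure B) : HasDerivWithinAt (fun s => f s x)
      (fderivWithin ℝ (fun p : ℝ × E3 => f p.1 p.2) (timeInterval t0 ×ˢ closure B) (t, x) (1, 0))
      (timeInterval t0) t := by
  have h1 : HasDerivWithinAt (fun s : ℝ => ((s, x) : ℝ × E3)) (1, 0) (timeInterval t0) t :=
    (hasDerivWithinAt_id t _).prodMk (hasDerivWithinAt_const t _ x)
  have h2 : MapsTo (fun s : ℝ => ((s, x) : ℝ × E3)) (timeInterval t0) (timeInterval t0 ×ˢ closure B) :=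
    fun s hs => ⟨hs, hx⟩
  exact (hf.hasFDerivWithinAt ht hx).comp_hasDerivWithinAt t h1 h2

theorem dt_eq (hf : IsClass B t0 1 f) (h0 : 0 < t0) (ht : t ∈ timeInterval t0)
    (hx : x ∈ closure B) :
    dt t0 f t x = fderivWithin ℝ (fun p : ℝ × E3 => f p.1 p.2) (timeInterval t0 ×ˢ closure B) (t, x)
      (1, 0) :=
  (hf.hasDerivWithinAt_aux ht hx).derivWithin (uniqueDiffOn_timeInterval h0 t ht)

theorem hasDerivWithinAt (hf : IsClass B t0 1 f) (ht : t ∈ timeInterval t0)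
    (hx : x ∈ closure B) : HasDerivWithinAt (fun s => f s x) (dt t0 f t x) (timeInterval t0) t :=
  (hf.hasDerivWithinAt_aux ht hx).differentiableWithinAt.hasDerivWithinAt

theorem hasDerivAt (hf : IsClass B t0 1 f) (ht : t ∈ timeInterval t0) (hpos : 0 < t)
    (hx : x ∈ closure B) : HasDerivAt (fun s => f s x) (dt t0 f t x) t :=
  (hf.hasDerivWithinAt ht hx).hasDerivAt (timeInterval_mem_nhds ht hpos)

theorem dx (hf : IsClass B t0 n f) (h0 : 0 < t0) (hU : UniqueDiffOn ℝ (closure B))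
    (hmn : m + 1 ≤ n) (j : Fin 3) : IsClass B t0 m (Thermopiezo.dx B f j) := by
  have hUS := (uniqueDiffOn_timeInterval h0).prod hU
  have h1 : ContDiffOn ℝ m (fun p => fderivWithin ℝ (fun p : ℝ × E3 => f p.1 p.2)
      (timeInterval t0 ×ˢ closure B) p (0, EuclideanSpace.single j 1))
      (timeInterval t0 ×ˢ closure B) :=
    (ContDiffOn.fderivWithin hf hUS hmn).clm_apply contDiffOn_const
  exact h1.congr fun p hp => dx_eq (hf.of_le (le_add_self.trans hmn)) hU hp.1 hp.2 j

theorem dt (hf : IsClass B t0 n f) (h0 : 0 < t0) (hU : UniqueDiffOn ℝ (closure B))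
    (hmn : m + 1 ≤ n) : IsClass B t0 m (Thermopiezo.dt t0 f) := by
  have hUS := (uniqueDiffOn_timeInterval h0).prod hU
  have h1 : ContDiffOn ℝ m (fun p => fderivWithin ℝ (fun p : ℝ × E3 => f p.1 p.2)
      (timeInterval t0 ×ˢ closure B) p (1, 0)) (timeInterval t0 ×ˢ closure B) :=
    (ContDiffOn.fderivWithin hf hUS hmn).clm_apply contDiffOn_const
  exact h1.congr fun p hp => dt_eq (hf.of_le (le_add_self.trans hmn)) h0 hp.1 hp.2

end IsClass

theorem EqField.dx_sub {B : Set E3} {t0 : EReal} {f g h : Field} (hU : UniqueDiffOn ℝ (closure B))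
    (hf : IsClass B t0 1 f) (hg : IsClass B t0 1 g)
    (heq : EqField B t0 h (fun t x => f t x - g t x)) (j : Fin 3) :
    EqField B t0 (dx B h j) (fun t x => dx B f j t x - dx B g j t x) := by
  intro t ht x hx
  have h1 : pd B (h t) j x = pd B (fun y => f t y - g t y) j x :=
    pd_congr (fun y hy => heq t ht y hy) hx j
  exact h1.trans (pd_sub hU (hf.slice ht) (hg.slice ht) hx j)

theorem EqField.dt_sub {B : Set E3} {t0 : EReal} {f g h : Field} (h0 : 0 < t0)
    (hf : IsClass B t0 1 f) (hg : IsClass B t0 1 g)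
    (heq : EqField B t0 h (fun t x => f t x - g t x)) :
    EqField B t0 (dt t0 h) (fun t x => dt t0 f t x - dt t0 g t x) := by
  intro t ht x hx
  have h1 : HasDerivWithinAt (fun s => h s x) (dt t0 f t x - dt t0 g t x) (timeInterval t0) t :=
    ((hf.hasDerivWithinAt ht hx).sub (hg.hasDerivWithinAt ht hx)).congr
      (fun s hs => heq s hs x hx) (heq t ht x hx)
  exact h1.derivWithin (uniqueDiffOn_timeInterval h0 t ht)

/-! ### Integrals depending on time -/

section time_integrals

variable {B : Set E3} {t0 : EReal} {f f' : Field} {t : ℝ}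

theorem IsClass.integrableOn (hb : Bornology.IsBounded B) (hf : IsClass B t0 0 f)
    (ht : t ∈ timeInterval t0) : IntegrableOn (f t) B :=
  ContinuousOn.integrableOn_of_closure hb (hf.slice ht).continuousOn

theorem IsClass.exists_bound (hb : Bornology.IsBounded B) (hf : IsClass B t0 0 f) {b : ℝ}
    (hsub : Icc 0 b ⊆ timeInterval t0) : ∃ C, ∀ s ∈ Icc 0 b, ∀ x ∈ closure B, ‖f s x‖ ≤ C := by
  obtain ⟨C, hC⟩ := (isCompact_Icc.prod hb.isCompact_closure).exists_bound_of_continuousOn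
    ((ContDiffOn.continuousOn hf).mono (prod_mono hsub subset_rfl))
  exact ⟨C, fun s hs x hx => hC (s, x) ⟨hs, hx⟩⟩

theorem integrableOn_const_of_bounded (hb : Bornology.IsBounded B) (C : ℝ) :
    IntegrableOn (fun _ : E3 => C) B :=
  ContinuousOn.integrableOn_of_closure hb continuousOn_const

theorem IsClass.continuousOn_integral (hB : IsOpen B) (hb : Bornology.IsBounded B)
    (hf : IsClass B t0 0 f) : ContinuousOn (fun t => ∫ x in B, f t x) (timeInterval t0) := by
  intro t ht
  obtain ⟨b, hbt, hsub⟩ := exists_gt_Icc_subset ht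
  obtain ⟨C, hC⟩ := hf.exists_bound hb hsub
  refine continuousWithinAt_of_dominated (bound := fun _ => C) ?_ ?_
    (integrableOn_const_of_bounded hb C) ?_
  · filter_upwards [self_mem_nhdsWithin] with s hs
    exact (hf.integrableOn hb hs).aestronglyMeasurable
  · filter_upwards [self_mem_nhdsWithin, mem_nhdsWithin_of_mem_nhds (Iio_mem_nhds hbt)] with s hs hsb
    exact (ae_restrict_iff' hB.measurableSet).2 (Eventually.of_forall fun x hx =>
      hC s ⟨hs.1, le_of_lt hsb⟩ x (subset_closure hx))
  · exact (ae_restrict_iff' hB.measurableSet).2 (Eventually.of_forall fun x hx =>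
      hf.continuousOn_time (subset_closure hx) t ht)

theorem IsClass.hasDerivAt_integral (hB : IsOpen B) (hb : Bornology.IsBounded B)
    (hf : IsClass B t0 0 f) (hf' : IsClass B t0 0 f')
    (hd : ∀ s ∈ timeInterval t0, 0 < s → ∀ x ∈ B, HasDerivAt (fun r => f r x) (f' s x) s)
    (ht : t ∈ timeInterval t0) (hpos : 0 < t) :
    HasDerivAt (fun t => ∫ x in B, f t x) (∫ x in B, f' t x) t := by
  -- Times up to some `b > t` still lie in `I`, and compactness of `[0, b] × closure B` supplies the
  -- constant dominating the derivative.
  obtain ⟨b, hbt, hsub⟩ := exists_gt_Icc_subset ht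
  obtain ⟨C, hC⟩ := hf'.exists_bound hb hsub
  refine (hasDerivAt_integral_of_dominated_loc_of_deriv_le (bound := fun _ => C)
    (s := Ioo 0 b) (Ioo_mem_nhds hpos hbt) ?_ (hf.integrableOn hb ht)
    (hf'.integrableOn hb ht).aestronglyMeasurable ?_ (integrableOn_const_of_bounded hb C) ?_).2
  · filter_upwards [Ioo_mem_nhds hpos hbt] with s hs
    exact (hf.integrableOn hb (hsub ⟨hs.1.le, hs.2.le⟩)).aestronglyMeasurable
  · exact (ae_restrict_iff' hB.measurableSet).2 (Eventually.of_forall fun x hx s hs =>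
      hC s ⟨hs.1.le, hs.2.le⟩ x (subset_closure hx))
  · exact (ae_restrict_iff' hB.measurableSet).2 (Eventually.of_forall fun x hx s hs =>
      hd s (hsub ⟨hs.1.le, hs.2.le⟩) hs.1 x hx)

/-- If the integrals of a field vanish at all times, so do those of its time derivative. -/
theorem IsClass.integral_deriv_eq_zero (hB : IsOpen B) (hb : Bornology.IsBounded B)
    (hf : IsClass B t0 0 f) (hf' : IsClass B t0 0 f')
    (hd : ∀ s ∈ timeInterval t0, 0 < s → ∀ x ∈ B, HasDerivAt (fun r => f r x) (f' s x) s)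
    (h0 : ∀ s ∈ timeInterval t0, ∫ x in B, f s x = 0)
    (ht : t ∈ timeInterval t0) (hpos : 0 < t) : ∫ x in B, f' t x = 0 := by
  have h1 := hf.hasDerivAt_integral hB hb hf' hd ht hpos
  have h2 : HasDerivAt (fun t => ∫ x in B, f t x) 0 t := by
    refine (hasDerivAt_const t (0:ℝ)).congr_of_eventuallyEq ?_
    filter_upwards [timeInterval_mem_nhds ht hpos] with s hs using h0 s hs
  exact h1.unique h2

end time_integrals

/-- A continuous function on `I` with nonpositive derivative is at most its initial value. -/
theorem le_initial_of_deriv_nonpos {t0 : EReal} (h0 : 0 < t0) {E E' : ℝ → ℝ}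
    (hc : ContinuousOn E (timeInterval t0))
    (hd : ∀ t ∈ timeInterval t0, 0 < t → HasDerivAt E (E' t) t)
    (hn : ∀ t ∈ timeInterval t0, 0 < t → E' t ≤ 0) :
    ∀ t ∈ timeInterval t0, E t ≤ E 0 := by
  have hanti : AntitoneOn E (timeInterval t0) := by
    refine antitoneOn_of_deriv_nonpos (convex_timeInterval t0) hc (fun t ht => ?_) fun t ht => ?_
    · obtain ⟨h1, h2⟩ := interior_timeInterval ht
      exact (hd t h1 h2).differentiableAt.differentiableWithinAt
    · obtain ⟨h1, h2⟩ := interior_timeInterval ht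
      rw [(hd t h1 h2).deriv]
      exact hn t h1 h2
  exact fun t ht => hanti (zero_mem_timeInterval h0) ht ht.1

/-- A nonnegative continuous function with nonpositive integral vanishes. -/
theorem eq_zero_of_integral_nonpos {B : Set E3} (hB : IsOpen B) (hb : Bornology.IsBounded B)
    {f : E3 → ℝ} (hf : ContinuousOn f (closure B)) (hn : ∀ x ∈ B, 0 ≤ f x)
    (h : ∫ x in B, f x ≤ 0) : ∀ x ∈ B, f x = 0 := by
  have hi := ContinuousOn.integrableOn_of_closure hb hf
  have hae : 0 ≤ᵐ[volume.restrict B] f :=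
    (ae_restrict_iff' hB.measurableSet).2 (Eventually.of_forall hn)
  have h0 : ∫ x in B, f x = 0 := le_antisymm h (integral_nonneg_of_ae hae)
  have h1 := (integral_eq_zero_iff_of_nonneg_ae hae hi).1 h0
  exact Measure.eqOn_open_of_ae_eq h1 hB (hf.mono subset_closure) continuousOn_const

end Thermopiezo
end

noncomputable section
namespace Thermopiezo
open Set Filter Topology Metric MeasureTheory
open scoped ContDiff

/-! ### Regularity and linearity of the constitutive fields -/

/-- The regularity of a classical solution. -/
structure State.IsRegular (B : Set E3) (t0 : EReal) (U : State) : Prop where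
  u : ∀ i, IsClass B t0 4 (U.u i)
  theta : IsClass B t0 3 U.theta
  phi : IsClass B t0 4 U.phi

theorem IsSolution.isRegular {B : Set E3} {t0 : EReal} {m : Material} {S : BoundaryParts B}
    {Γ : ExternalData} {U : State} (h : IsSolution B t0 m S Γ U) : U.IsRegular B t0 :=
  ⟨h.smooth_u, h.smooth_theta, h.smooth_phi⟩

namespace State.IsRegular

variable {B : Set E3} {t0 : EReal} {U : State} (hU : U.IsRegular B t0) (h0 : 0 < t0)
  (hB : UniqueDiffOn ℝ (closure B)) (m : Material)

include hU h0 hB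

theorem strain (i j : Fin 3) : IsClass B t0 3 (strain B U i j) := by
  have h1 : ContDiffOn ℝ 3 (fun p : ℝ × E3 => Thermopiezo.dx B (U.u i) j p.1 p.2) _ :=
    (hU.u i).dx h0 hB (by norm_num) j
  have h2 : ContDiffOn ℝ 3 (fun p : ℝ × E3 => Thermopiezo.dx B (U.u j) i p.1 p.2) _ :=
    (hU.u j).dx h0 hB (by norm_num) i
  unfold IsClass Thermopiezo.strain
  fun_prop

theorem kappa (i j k : Fin 3) : IsClass B t0 2 (kappa B U i j k) :=
  ((hU.u k).dx (m := 3) h0 hB (by norm_num) i).dx h0 hB (by norm_num) j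

theorem elField (i : Fin 3) : IsClass B t0 3 (elField B U i) := by
  have h1 : ContDiffOn ℝ 3 (fun p : ℝ × E3 => Thermopiezo.dx B U.phi i p.1 p.2) _ :=
    hU.phi.dx h0 hB (by norm_num) i
  exact h1.neg

theorem elGrad (i j : Fin 3) : IsClass B t0 2 (elGrad B U i j) :=
  (hU.elField h0 hB i).dx h0 hB (by norm_num) j

theorem dt_theta : IsClass B t0 2 (dt t0 U.theta) := hU.theta.dt h0 hB (by norm_num)

theorem thermal : IsClass B t0 2 (thermal t0 m U) := by
  have h1 : ContDiffOn ℝ 2 (fun p : ℝ × E3 => U.theta p.1 p.2) (timeInterval t0 ×ˢ closure B) :=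
    hU.theta.of_le (by norm_num)
  have h2 : ContDiffOn ℝ 2 (fun p : ℝ × E3 => dt t0 U.theta p.1 p.2) _ := hU.dt_theta h0 hB
  unfold IsClass Thermopiezo.thermal
  fun_prop

theorem tau (i j : Fin 3) : IsClass B t0 2 (tau B t0 m U i j) := by
  have h1 : ∀ i j, ContDiffOn ℝ 2 (fun p : ℝ × E3 => Thermopiezo.strain B U i j p.1 p.2)
      (timeInterval t0 ×ˢ closure B) := fun i j => (hU.strain h0 hB i j).of_le (by norm_num)
  have h2 : ContDiffOn ℝ 2 (fun p : ℝ × E3 => Thermopiezo.thermal t0 m U p.1 p.2)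
      (timeInterval t0 ×ˢ closure B) := hU.thermal h0 hB m
  have h3 : ∀ i j, ContDiffOn ℝ 2 (fun p : ℝ × E3 => Thermopiezo.elGrad B U i j p.1 p.2)
      (timeInterval t0 ×ˢ closure B) := hU.elGrad h0 hB
  unfold IsClass Thermopiezo.tau
  simp only [Fin.sum_univ_three]
  fun_prop

theorem hyper (i j k : Fin 3) : IsClass B t0 2 (hyper B m U i j k) := by
  have h1 : ∀ i j k, ContDiffOn ℝ 2 (fun p : ℝ × E3 => Thermopiezo.kappa B U i j k p.1 p.2)
      (timeInterval t0 ×ˢ closure B) := hU.kappa h0 hB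
  have h2 : ∀ i, ContDiffOn ℝ 2 (fun p : ℝ × E3 => Thermopiezo.elField B U i p.1 p.2)
      (timeInterval t0 ×ˢ closure B) := fun i => (hU.elField h0 hB i).of_le (by norm_num)
  unfold IsClass Thermopiezo.hyper
  simp only [Fin.sum_univ_three]
  fun_prop

theorem sigma (i : Fin 3) : IsClass B t0 2 (sigma B m U i) := by
  have h1 : ∀ i j k, ContDiffOn ℝ 2 (fun p : ℝ × E3 => Thermopiezo.kappa B U i j k p.1 p.2)
      (timeInterval t0 ×ˢ closure B) := hU.kappa h0 hB
  have h2 : ∀ i, ContDiffOn ℝ 2 (fun p : ℝ × E3 => Thermopiezo.elField B U i p.1 p.2)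
      (timeInterval t0 ×ˢ closure B) := fun i => (hU.elField h0 hB i).of_le (by norm_num)
  unfold IsClass Thermopiezo.sigma
  simp only [Fin.sum_univ_three]
  fun_prop

theorem entropy : IsClass B t0 2 (entropy B t0 m U) := by
  have h1 : ∀ i j, ContDiffOn ℝ 2 (fun p : ℝ × E3 => Thermopiezo.strain B U i j p.1 p.2)
      (timeInterval t0 ×ˢ closure B) := fun i j => (hU.strain h0 hB i j).of_le (by norm_num)
  have h2 : ContDiffOn ℝ 2 (fun p : ℝ × E3 => Thermopiezo.thermal t0 m U p.1 p.2)
      (timeInterval t0 ×ˢ closure B) := hU.thermal h0 hB m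
  have h3 : ∀ i j, ContDiffOn ℝ 2 (fun p : ℝ × E3 => Thermopiezo.elGrad B U i j p.1 p.2)
      (timeInterval t0 ×ˢ closure B) := hU.elGrad h0 hB
  have h4 : ContDiffOn ℝ 2 (fun p : ℝ × E3 => dt t0 U.theta p.1 p.2)
      (timeInterval t0 ×ˢ closure B) := hU.dt_theta h0 hB
  unfold IsClass Thermopiezo.entropy
  simp only [Fin.sum_univ_three]
  fun_prop

theorem quad (i j : Fin 3) : IsClass B t0 2 (quad B t0 m U i j) := by
  have h1 : ∀ i j, ContDiffOn ℝ 2 (fun p : ℝ × E3 => Thermopiezo.strain B U i j p.1 p.2)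
      (timeInterval t0 ×ˢ closure B) := fun i j => (hU.strain h0 hB i j).of_le (by norm_num)
  have h2 : ContDiffOn ℝ 2 (fun p : ℝ × E3 => Thermopiezo.thermal t0 m U p.1 p.2)
      (timeInterval t0 ×ˢ closure B) := hU.thermal h0 hB m
  have h3 : ∀ i j, ContDiffOn ℝ 2 (fun p : ℝ × E3 => Thermopiezo.elGrad B U i j p.1 p.2)
      (timeInterval t0 ×ˢ closure B) := hU.elGrad h0 hB
  unfold IsClass Thermopiezo.quad
  simp only [Fin.sum_univ_three]
  fun_prop

theorem heatFlux (i : Fin 3) : IsClass B t0 2 (heatFlux B m U i) := by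
  have h1 : ContDiffOn ℝ 2 (fun p : ℝ × E3 => Thermopiezo.dx B U.theta i p.1 p.2)
      (timeInterval t0 ×ˢ closure B) := hU.theta.dx h0 hB (by norm_num) i
  unfold IsClass Thermopiezo.heatFlux
  fun_prop

end State.IsRegular

/-! ### The difference of two solutions -/

/-- The difference of two states. -/
def State.sub (U U' : State) : State where
  u i t x := U.u i t x - U'.u i t x
  theta t x := U.theta t x - U'.theta t x
  phi t x := U.phi t x - U'.phi t x

/-- The material with vanishing `α^(4)` and the same `γ`. -/
def Material.centered (m : Material) : Material :=
  { m with alpha4 := 0, a55 := m.a55 - m.alpha4 * m.b55 }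

theorem Material.centered_gamma (m : Material) : m.centered.gamma = m.gamma := by
  simp only [Material.gamma, Material.centered]; ring

/-- Vanishing external data. -/
def ExternalData.zero : ExternalData where
  f _ _ _ := 0
  g _ _ := 0
  r _ _ := 0
  u0 _ _ := 0
  v0 _ _ := 0
  theta0 _ := 0
  eta0 _ := 0
  uHat _ _ _ := 0
  dHat _ _ _ := 0
  thetaHat _ _ := 0
  phiHat _ _ := 0
  xiHat _ _ := 0
  PHat _ _ _ := 0
  RHat _ _ _ := 0
  qHat _ _ := 0
  LambdaHat _ _ := 0
  HHat _ _ := 0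

/-- Surface gradients are additive only for functions differentiable along the boundary. Replacing
the normal by its `C¹` extension turns them into combinations of ordinary partial derivatives, which
are linear. -/
theorem IsDefiningFunction.traction_sub {B : Set E3} {G : E3 → ℝ} (hG : IsDefiningFunction B G)
    {s s₁ s₂ : Fin 3 → E3 → ℝ} {M M₁ M₂ : Fin 3 → Fin 3 → E3 → ℝ}
    (hs : ∀ j, ∀ x ∈ closure B, s j x = s₁ j x - s₂ j x)
    (hM : ∀ j k, ∀ x ∈ closure B, M j k x = M₁ j k x - M₂ j k x)
    (h₁ : ∀ j k, ContDiffOn ℝ 1 (M₁ j k) (closure B))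
    (h₂ : ∀ j k, ContDiffOn ℝ 1 (M₂ j k) (closure B)) {x : E3} (hxf : x ∈ frontier B) :
    traction B s M x = traction B s₁ M₁ x - traction B s₂ M₂ x := by
  have hU := hG.uniqueDiffOn_closure
  have hx := frontier_subset_closure hxf
  obtain ⟨N, hN, hNn, -, -⟩ := hG.exists_normal_extension
  have hMc : ∀ j k, ContDiffOn ℝ 1 (M j k) (closure B) := fun j k =>
    ((h₁ j k).sub (h₂ j k)).congr fun y hy => hM j k y hy
  have hc : ∀ {K : Fin 3 → Fin 3 → E3 → ℝ}, (∀ j k, ContDiffOn ℝ 1 (K j k) (closure B)) → ∀ j,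
      ContDiffOn ℝ 1 (fun y => ∑ k, K k j y * N k y) (closure B) := fun hK j =>
    ContDiffOn.sum fun k _ => (hK k j).mul (hN k)
  have hsc : ∀ {K : Fin 3 → Fin 3 → E3 → ℝ}, (∀ j k, ContDiffOn ℝ 1 (K j k) (closure B)) →
      ∀ j i, surfGrad B (fun y => ∑ k, K k j y * normal B y k) i x = _ := fun hK j i =>
    hG.surfGrad_eq_pd hxf (hc hK j) (fun y hy => by simp only [hNn y hy]) i
  have hpc : ∀ j i, pd B (fun y => ∑ k, M k j y * N k y) i x
      = pd B (fun y => ∑ k, M₁ k j y * N k y) i x - pd B (fun y => ∑ k, M₂ k j y * N k y) i x := by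
    intro j i
    rw [← pd_sub hU (hc h₁ j) (hc h₂ j) hx]
    refine pd_congr (fun y hy => ?_) hx i
    simp only [hM _ _ y hy, Fin.sum_univ_three]
    ring
  have hpM : ∀ j k i, pd B (M j k) i x = pd B (M₁ j k) i x - pd B (M₂ j k) i x := fun j k i => by
    rw [← pd_sub hU (h₁ j k) (h₂ j k) hx]
    exact pd_congr (fun y hy => hM j k y hy) hx i
  unfold traction
  simp only [hsc hMc, hsc h₁, hsc h₂]
  simp only [hpc]
  simp only [hpM, hs _ x hx, hM _ _ x hx, Fin.sum_univ_three]
  ring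

section linearity

variable {B : Set E3} {t0 : EReal} {m : Material} {U U' : State} (hU : U.IsRegular B t0)
  (hU' : U'.IsRegular B t0) (h0 : 0 < t0) (hB : UniqueDiffOn ℝ (closure B))

include hU hU'

theorem State.IsRegular.sub : (U.sub U').IsRegular B t0 :=
  ⟨fun i => ContDiffOn.sub (hU.u i) (hU'.u i), ContDiffOn.sub hU.theta hU'.theta,
    ContDiffOn.sub hU.phi hU'.phi⟩

include hB

theorem dx_u_sub (i j : Fin 3) : EqField B t0 (dx B ((U.sub U').u i) j)
    (fun t x => dx B (U.u i) j t x - dx B (U'.u i) j t x) :=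
  EqField.dx_sub hB ((hU.u i).of_le (by norm_num)) ((hU'.u i).of_le (by norm_num))
    (fun _ _ _ _ => rfl) j

theorem dx_theta_sub (j : Fin 3) : EqField B t0 (dx B (U.sub U').theta j)
    (fun t x => dx B U.theta j t x - dx B U'.theta j t x) :=
  EqField.dx_sub hB (hU.theta.of_le (by norm_num)) (hU'.theta.of_le (by norm_num))
    (fun _ _ _ _ => rfl) j

theorem dx_phi_sub (j : Fin 3) : EqField B t0 (dx B (U.sub U').phi j)
    (fun t x => dx B U.phi j t x - dx B U'.phi j t x) :=
  EqField.dx_sub hB (hU.phi.of_le (by norm_num)) (hU'.phi.of_le (by norm_num))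
    (fun _ _ _ _ => rfl) j

theorem strain_sub (i j : Fin 3) : EqField B t0 (strain B (U.sub U') i j)
    (fun t x => strain B U i j t x - strain B U' i j t x) := by
  intro t ht x hx
  simp only [strain, dx_u_sub hU hU' hB _ _ t ht x hx]
  ring

theorem elField_sub (i : Fin 3) : EqField B t0 (elField B (U.sub U') i)
    (fun t x => elField B U i t x - elField B U' i t x) := by
  intro t ht x hx
  simp only [elField, dx_phi_sub hU hU' hB _ t ht x hx]
  ring

include h0

theorem kappa_sub (i j k : Fin 3) : EqField B t0 (kappa B (U.sub U') i j k)
    (fun t x => kappa B U i j k t x - kappa B U' i j k t x) :=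
  EqField.dx_sub hB ((hU.u k).dx h0 hB (by norm_num) i) ((hU'.u k).dx h0 hB (by norm_num) i)
    (dx_u_sub hU hU' hB k i) j

theorem elGrad_sub (i j : Fin 3) : EqField B t0 (elGrad B (U.sub U') i j)
    (fun t x => elGrad B U i j t x - elGrad B U' i j t x) :=
  EqField.dx_sub hB ((hU.elField h0 hB i).of_le (by norm_num))
    ((hU'.elField h0 hB i).of_le (by norm_num)) (elField_sub hU hU' hB i) j

omit hB in
theorem dt_theta_sub : EqField B t0 (dt t0 (U.sub U').theta)
    (fun t x => dt t0 U.theta t x - dt t0 U'.theta t x) :=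
  EqField.dt_sub h0 (hU.theta.of_le (by norm_num)) (hU'.theta.of_le (by norm_num))
    (fun _ _ _ _ => rfl)

omit hB in
theorem dt_u_sub (i : Fin 3) : EqField B t0 (dt t0 ((U.sub U').u i))
    (fun t x => dt t0 (U.u i) t x - dt t0 (U'.u i) t x) :=
  EqField.dt_sub h0 ((hU.u i).of_le (by norm_num)) ((hU'.u i).of_le (by norm_num))
    (fun _ _ _ _ => rfl)

theorem dt_dt_u_sub (i : Fin 3) : EqField B t0 (dt t0 (dt t0 ((U.sub U').u i)))
    (fun t x => dt t0 (dt t0 (U.u i)) t x - dt t0 (dt t0 (U'.u i)) t x) :=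
  EqField.dt_sub h0 ((hU.u i).dt h0 hB (by norm_num)) ((hU'.u i).dt h0 hB (by norm_num))
    (dt_u_sub hU hU' h0 i)

omit hB in
theorem thermal_sub (m : Material) : EqField B t0 (thermal t0 m (U.sub U'))
    (fun t x => thermal t0 m U t x - thermal t0 m U' t x) := by
  intro t ht x hx
  simp only [thermal, dt_theta_sub hU hU' h0 t ht x hx]
  simp only [State.sub]
  ring

theorem tau_sub (m : Material) (i j : Fin 3) : EqField B t0 (tau B t0 m (U.sub U') i j)
    (fun t x => tau B t0 m U i j t x - tau B t0 m U' i j t x) := by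
  intro t ht x hx
  simp only [tau, strain_sub hU hU' hB _ _ t ht x hx, elGrad_sub hU hU' h0 hB _ _ t ht x hx,
    thermal_sub hU hU' h0 m t ht x hx, Fin.sum_univ_three]
  ring

theorem hyper_sub (m : Material) (i j k : Fin 3) : EqField B t0 (hyper B m (U.sub U') i j k)
    (fun t x => hyper B m U i j k t x - hyper B m U' i j k t x) := by
  intro t ht x hx
  simp only [hyper, kappa_sub hU hU' h0 hB _ _ _ t ht x hx, elField_sub hU hU' hB _ t ht x hx,
    Fin.sum_univ_three]
  ring

theorem sigma_sub (m : Material) (i : Fin 3) : EqField B t0 (sigma B m (U.sub U') i)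
    (fun t x => sigma B m U i t x - sigma B m U' i t x) := by
  intro t ht x hx
  simp only [sigma, kappa_sub hU hU' h0 hB _ _ _ t ht x hx, elField_sub hU hU' hB _ t ht x hx,
    Fin.sum_univ_three]
  ring

/-- The entropy is affine with constant part proportional to `α^(4)`, which the difference loses.
`centered` therefore drops it and corrects `a^(55)`, because `γ` contains `α^(4) b^(55)` and has to
stay the same. -/
theorem entropy_sub (m : Material) : EqField B t0 (entropy B t0 m.centered (U.sub U'))
    (fun t x => entropy B t0 m U t x - entropy B t0 m U' t x) := by
  intro t ht x hx
  simp only [entropy, m.centered_gamma, strain_sub hU hU' hB _ _ t ht x hx,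
    elGrad_sub hU hU' h0 hB _ _ t ht x hx, thermal_sub hU hU' h0 m.centered t ht x hx,
    dt_theta_sub hU hU' h0 t ht x hx, Fin.sum_univ_three]
  simp only [Material.centered, thermal]
  ring

theorem quad_sub (m : Material) (i j : Fin 3) : EqField B t0 (quad B t0 m (U.sub U') i j)
    (fun t x => quad B t0 m U i j t x - quad B t0 m U' i j t x) := by
  intro t ht x hx
  simp only [quad, strain_sub hU hU' hB _ _ t ht x hx, elGrad_sub hU hU' h0 hB _ _ t ht x hx,
    thermal_sub hU hU' h0 m t ht x hx, Fin.sum_univ_three]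
  ring

omit h0 in
theorem heatFlux_sub (m : Material) (i : Fin 3) : EqField B t0 (heatFlux B m (U.sub U') i)
    (fun t x => heatFlux B m U i t x - heatFlux B m U' i t x) := by
  intro t ht x hx
  simp only [heatFlux, dx_theta_sub hU hU' hB _ t ht x hx]
  ring

end linearity

/-- The difference of two solutions solves the problem with vanishing data. -/
theorem IsSolution.sub {B : Set E3} {G : E3 → ℝ} (hG : IsDefiningFunction B G) {t0 : EReal}
    (h0 : 0 < t0) {m : Material} {S : BoundaryParts B} {Γ : ExternalData} {U U' : State}
    (hS : IsSolution B t0 m S Γ U) (hS' : IsSolution B t0 m S Γ U') :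
    IsSolution B t0 m.centered S ExternalData.zero (U.sub U') := by
  have hB := hG.uniqueDiffOn_closure
  have hU := hS.isRegular
  have hU' := hS'.isRegular
  have hW := hU.sub hU'
  have hzero := zero_mem_timeInterval h0
  -- Stresses, electric fields and heat flux involve neither `α^(4)` nor `a^(55)`, so these
  -- identities for `m` also serve for `m.centered` by unfolding. Only the entropy tells the two
  -- materials apart.
  have htau := tau_sub hU hU' h0 hB m
  have hhyper := hyper_sub hU hU' h0 hB m
  have hsigma := sigma_sub hU hU' h0 hB m
  have hquad := quad_sub hU hU' h0 hB m
  have hflux := heatFlux_sub hU hU' hB m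
  have hent := entropy_sub hU hU' h0 hB m
  have c1 : ∀ {n : WithTop ℕ∞} {f : Field}, IsClass B t0 n f → 1 ≤ n → IsClass B t0 1 f :=
    fun h hn => h.of_le hn
  have dtau : ∀ i j k, _ := fun i j k => EqField.dx_sub hB
    (c1 (hU.tau h0 hB m i j) (by norm_num)) (c1 (hU'.tau h0 hB m i j) (by norm_num)) (htau i j) k
  have dhyper : ∀ i j k l, _ := fun i j k l => EqField.dx_sub hB
    (c1 (hU.hyper h0 hB m i j k) (by norm_num)) (c1 (hU'.hyper h0 hB m i j k) (by norm_num))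
    (hhyper i j k) l
  have ddhyper : ∀ i j k l l', _ := fun i j k l l' => EqField.dx_sub hB
    ((hU.hyper h0 hB m i j k).dx (m := 1) h0 hB (by norm_num) l)
    ((hU'.hyper h0 hB m i j k).dx (m := 1) h0 hB (by norm_num) l) (dhyper i j k l) l'
  have dsigma : ∀ i k, _ := fun i k => EqField.dx_sub hB
    (c1 (hU.sigma h0 hB m i) (by norm_num)) (c1 (hU'.sigma h0 hB m i) (by norm_num)) (hsigma i) k
  have dquad : ∀ i j k, _ := fun i j k => EqField.dx_sub hB
    (c1 (hU.quad h0 hB m i j) (by norm_num)) (c1 (hU'.quad h0 hB m i j) (by norm_num)) (hquad i j) k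
  have ddquad : ∀ i j k l, _ := fun i j k l => EqField.dx_sub hB
    ((hU.quad h0 hB m i j).dx (m := 1) h0 hB (by norm_num) k)
    ((hU'.quad h0 hB m i j).dx (m := 1) h0 hB (by norm_num) k) (dquad i j k) l
  have dflux : ∀ i k, _ := fun i k => EqField.dx_sub hB
    (c1 (hU.heatFlux h0 hB m i) (by norm_num)) (c1 (hU'.heatFlux h0 hB m i) (by norm_num))
    (hflux i) k
  have dent := EqField.dt_sub h0
    (c1 (hU.entropy h0 hB m) (by norm_num)) (c1 (hU'.entropy h0 hB m) (by norm_num)) hent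
  have hf : ∀ x ∈ frontier B, x ∈ closure B := fun x hx => frontier_subset_closure hx
  have s1 : ∀ {x}, x ∈ S.S1 → x ∈ closure B := fun h => hf _ (S.split1.1 h)
  have sig : ∀ {S' Sig : Set E3}, IsSplit B S' Sig → ∀ {x}, x ∈ Sig → x ∈ frontier B :=
    fun h x hx => h.2.1 ▸ Or.inr hx
  constructor
  · exact hW.u
  · exact hW.theta
  · exact hW.phi
  · intro t ht x hxB i
    have hx := subset_closure hxB
    have e1 : ∀ j k l, dx B (tau B t0 m.centered (U.sub U') j k) l t x = _ :=
      fun j k l => dtau j k l t ht x hx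
    have e2 : ∀ k j i l l', dx B (dx B (hyper B m.centered (U.sub U') k j i) l) l' t x = _ :=
      fun k j i l l' => ddhyper k j i l l' t ht x hx
    have e3 := dt_dt_u_sub hU hU' h0 hB i t ht x hx
    have a1 := hS.motion t ht x hxB i
    have a2 := hS'.motion t ht x hxB i
    rw [e3]
    simp only [e1, e2, ExternalData.zero, Fin.sum_univ_three, Material.centered] at *
    linear_combination a1 - a2
  · intro t ht x hxB
    have hx := subset_closure hxB
    have e1 : ∀ k l, dx B (sigma B m.centered (U.sub U') k) l t x = _ :=
      fun k l => dsigma k l t ht x hx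
    have e2 : ∀ k j l l', dx B (dx B (quad B t0 m.centered (U.sub U') k j) l) l' t x = _ :=
      fun k j l l' => ddquad k j l l' t ht x hx
    have a1 := hS.electric t ht x hxB
    have a2 := hS'.electric t ht x hxB
    simp only [e1, e2, ExternalData.zero, Fin.sum_univ_three] at *
    linear_combination a1 - a2
  · intro t ht x hxB
    have hx := subset_closure hxB
    have e1 : ∀ k l, dx B (heatFlux B m.centered (U.sub U') k) l t x = _ :=
      fun k l => dflux k l t ht x hx
    have a1 := hS.energy t ht x hxB
    have a2 := hS'.energy t ht x hxB
    rw [dent t ht x hx]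
    simp only [e1, ExternalData.zero, Fin.sum_univ_three, Material.centered] at *
    linear_combination a1 - a2
  · intro x hx i
    simp only [State.sub, ExternalData.zero, hS.init_u x hx i, hS'.init_u x hx i, sub_self]
  · intro x hx i
    rw [dt_u_sub hU hU' h0 i 0 hzero x hx]
    simp only [ExternalData.zero, hS.init_v x hx i, hS'.init_v x hx i, sub_self]
  · intro x hx
    simp only [State.sub, ExternalData.zero, hS.init_theta x hx, hS'.init_theta x hx, sub_self]
  · intro x hx
    rw [hent 0 hzero x hx]
    simp only [ExternalData.zero, hS.init_eta x hx, hS'.init_eta x hx, sub_self]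
  · intro t ht x hx i
    simp only [State.sub, ExternalData.zero, hS.bdry_u t ht x hx i, hS'.bdry_u t ht x hx i, sub_self]
  · intro t ht x hx i
    have hxf := sig S.split1 hx
    have e : tractionP B t0 m.centered (U.sub U') i t x
        = tractionP B t0 m U i t x - tractionP B t0 m U' i t x :=
      hG.traction_sub (s := fun j => tau B t0 m (U.sub U') j i t)
        (M := fun k j => hyper B m (U.sub U') k j i t)
        (fun j y hy => htau j i t ht y hy) (fun j k y hy => hhyper j k i t ht y hy)
        (fun j k => (c1 (hU.hyper h0 hB m j k i) (by norm_num)).slice ht)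
        (fun j k => (c1 (hU'.hyper h0 hB m j k i) (by norm_num)).slice ht) hxf
    rw [e, hS.bdry_P t ht x hx i, hS'.bdry_P t ht x hx i, sub_self]
    rfl
  · intro t ht x hx i
    have hxc := hf x (S.split2.1 hx)
    have a1 := hS.bdry_du t ht x hx i
    have a2 := hS'.bdry_du t ht x hx i
    unfold dn at *
    simp only [dx_u_sub hU hU' hB _ _ t ht x hxc, Fin.sum_univ_three, ExternalData.zero] at *
    linear_combination a1 - a2
  · intro t ht x hx i
    have hxc := hf x (sig S.split2 hx)
    have a1 := hS.bdry_R t ht x hx i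
    have a2 := hS'.bdry_R t ht x hx i
    have e1 : ∀ j k l, hyper B m.centered (U.sub U') j k l t x = _ :=
      fun j k l => hhyper j k l t ht x hxc
    unfold hypertractionR at *
    simp only [e1, Fin.sum_univ_three, ExternalData.zero] at *
    linear_combination a1 - a2
  · intro t ht x hx
    simp only [State.sub, ExternalData.zero, hS.bdry_theta t ht x hx, hS'.bdry_theta t ht x hx,
      sub_self]
  · intro t ht x hx
    have hxc := hf x (sig S.split3 hx)
    have a1 := hS.bdry_q t ht x hx
    have a2 := hS'.bdry_q t ht x hx
    have e1 : ∀ j, heatFlux B m.centered (U.sub U') j t x = _ := fun j => hflux j t ht x hxc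
    simp only [e1, Fin.sum_univ_three, ExternalData.zero] at *
    linear_combination a1 - a2
  · intro t ht x hx
    simp only [State.sub, ExternalData.zero, hS.bdry_phi t ht x hx, hS'.bdry_phi t ht x hx,
      sub_self]
  · intro t ht x hx
    have hxf := sig S.split4 hx
    have e : chargeLambda B t0 m.centered (U.sub U') t x
        = chargeLambda B t0 m U t x - chargeLambda B t0 m U' t x :=
      hG.traction_sub (s := fun j => sigma B m (U.sub U') j t)
        (M := fun k j => quad B t0 m (U.sub U') k j t)
        (fun j y hy => hsigma j t ht y hy) (fun j k y hy => hquad j k t ht y hy)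
        (fun j k => (c1 (hU.quad h0 hB m j k) (by norm_num)).slice ht)
        (fun j k => (c1 (hU'.quad h0 hB m j k) (by norm_num)).slice ht) hxf
    rw [e, hS.bdry_Lambda t ht x hx, hS'.bdry_Lambda t ht x hx, sub_self]
    rfl
  · intro t ht x hx
    have hxc := hf x (S.split5.1 hx)
    have a1 := hS.bdry_dphi t ht x hx
    have a2 := hS'.bdry_dphi t ht x hx
    unfold dn at *
    simp only [dx_phi_sub hU hU' hB _ t ht x hxc, Fin.sum_univ_three, ExternalData.zero] at *
    linear_combination a1 - a2
  · intro t ht x hx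
    have hxc := hf x (sig S.split5 hx)
    have a1 := hS.bdry_H t ht x hx
    have a2 := hS'.bdry_H t ht x hx
    have e1 : ∀ j k, quad B t0 m.centered (U.sub U') j k t x = _ :=
      fun j k => hquad j k t ht x hxc
    unfold chargeH at *
    simp only [e1, Fin.sum_univ_three, ExternalData.zero] at *
    linear_combination a1 - a2

end Thermopiezo
end

noncomputable section
namespace Thermopiezo

/-! ### Quadratic forms of the isotropic material -/

/-- Stored energy of the strain. -/
def strainEnergy (m : Material) (e : Fin 3 → Fin 3 → ℝ) : ℝ :=
  m.lam / 2 * ((∑ k, e k k) * ∑ k, e k k) + m.mu * ∑ i, ∑ j, e i j * e i j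

/-- Stored energy of the strain gradient. -/
def gradEnergy (m : Material) (κ : Fin 3 → Fin 3 → Fin 3 → ℝ) : ℝ :=
  2 * m.gamma1 * (∑ i, (∑ h, κ h h i) * ∑ h, κ i h h)
    + 2 * m.gamma2 * (∑ i, (∑ h, κ i h h) * ∑ h, κ i h h)
    + m.gamma3 / 2 * (∑ i, (∑ h, κ h h i) * ∑ h, κ h h i)
    + m.gamma4 * (∑ i, ∑ j, ∑ k, κ i j k * κ i j k)
    + 2 * m.gamma5 * (∑ i, ∑ j, ∑ k, κ i j k * κ k j i)

/-- The electric, thermal and coupling part of the enthalpy. -/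
def couplingEnergy (m : Material) (e : Fin 3 → Fin 3 → ℝ) (κ : Fin 3 → Fin 3 → Fin 3 → ℝ)
    (E : Fin 3 → ℝ) (V : Fin 3 → Fin 3 → ℝ) (th : ℝ) : ℝ :=
  m.alpha33 / 2 * (∑ i, E i * E i) + m.lamTilde / 2 * ((∑ k, V k k) * ∑ k, V k k)
    + m.muTilde * (∑ i, ∑ j, V i j * V i j) + m.a44 / 2 * (th * th)
    + m.alpha47 * (th * ∑ k, V k k) + m.alpha14 * (th * ∑ k, e k k)
    + m.lamStar * ((∑ k, e k k) * ∑ k, V k k) + 2 * m.muStar * (∑ i, ∑ j, e i j * V i j)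
    + m.alpha0 * (∑ i, (∑ k, κ k k i) * E i) + 2 * m.beta0 * (∑ i, (∑ k, κ i k k) * E i)

/-- Splitting off the trace leaves `3λ + 2μ` on its square and `μ` on the deviatoric rest. -/
theorem strainEnergy_nonneg {m : Material} (hmu : 0 ≤ m.mu) (hlam : 0 ≤ 3 * m.lam + 2 * m.mu)
    (e : Fin 3 → Fin 3 → ℝ) : 0 ≤ strainEnergy m e := by
  have h : strainEnergy m e = (3 * m.lam + 2 * m.mu) / 6 * (e 0 0 + e 1 1 + e 2 2) ^ 2
      + m.mu / 3 * ((e 0 0 - e 1 1) ^ 2 + (e 1 1 - e 2 2) ^ 2 + (e 0 0 - e 2 2) ^ 2)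
      + m.mu * (e 0 1 ^ 2 + e 0 2 ^ 2 + e 1 0 ^ 2 + e 1 2 ^ 2 + e 2 0 ^ 2 + e 2 1 ^ 2) := by
    simp only [strainEnergy, Fin.sum_univ_three]; ring
  rw [h]
  positivity

/-! ### Strain gradient energy -/

section gradEnergy

variable {x y z p : ℝ}

/-- Positivity of the form on the traces of the strain gradient. -/
theorem trace_form_nonneg (hx : 0 ≤ x) (hy : 0 ≤ y) (hp : 0 ≤ p)
    (h6 : (2 * z - p) ^ 2 ≤ x * (2 * y + p)) (h7 : 2 * z ^ 2 ≤ x * y)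
    (h9 : 0 ≤ p * ((5 * x - p) * (5 * y - 2 * p) - 2 * (5 * z - p) ^ 2)) (a b : ℝ) :
    0 ≤ (5 * x - p) / 10 * a ^ 2 + 2 * (5 * z - p) / 5 * (a * b) + (5 * y - 2 * p) / 5 * b ^ 2 := by
  -- Up to positive factors these are the diagonal entries and the determinant of the form in `(a,
  -- b)`. For `p = 0` they are read off directly, the determinant condition being `h7`. For `p > 0`
  -- the determinant condition is `h9`, and a negative semidefinite form has to be excluded.
  have key : 0 ≤ 5 * x - p ∧ 0 ≤ 5 * y - 2 * p ∧
      2 * (5 * z - p) ^ 2 ≤ (5 * x - p) * (5 * y - 2 * p) := by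
    rcases hp.eq_or_lt with rfl | hp
    · exact ⟨by linarith, by linarith, by nlinarith⟩
    have hdet : 2 * (5 * z - p) ^ 2 ≤ (5 * x - p) * (5 * y - 2 * p) := by
      have := nonneg_of_mul_nonneg_right h9 hp
      linarith
    have hprod : 0 ≤ (5 * x - p) * (5 * y - 2 * p) := le_trans (by positivity) hdet
    have hzbound : 5 * x ≤ p → 5 * y ≤ 2 * p → z ≤ p / 5 := by
      intro h1 h2
      have h3 : x * y ≤ (p / 5) * (2 * p / 5) :=
        mul_le_mul (by linarith) (by linarith) hy (by positivity)
      have h4 : z ^ 2 ≤ (p / 5) ^ 2 := by nlinarith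
      exact (abs_le_of_sq_le_sq' h4 (by positivity)).2
    -- If both diagonal entries are nonpositive, `h7` bounds `z` by `p/5`, so `(2z - p)² ≥ 9p²/25`.
    -- The right side of `h6` is at most `(p/5)(9p/5)`, the same number, so equality holds
    -- throughout and both entries are zero.
    have hno : 5 * x ≤ p → 5 * y ≤ 2 * p → 5 * x = p ∧ 5 * y = 2 * p := by
      intro h1 h2
      have h3 := hzbound h1 h2
      have h4 : (3 * p / 5) ^ 2 ≤ (2 * z - p) ^ 2 := by nlinarith
      have h5 : x * (2 * y + p) ≤ x * (9 * p / 5) := mul_le_mul_of_nonneg_left (by linarith) hx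
      have h6' : 5 * x = p := by
        have : (9 * p / 5) * (p / 5) ≤ (9 * p / 5) * x := by nlinarith
        have := le_of_mul_le_mul_left this (by positivity)
        linarith
      refine ⟨h6', ?_⟩
      have hx' : x = p / 5 := by linarith
      rw [hx'] at h6
      have : (p / 5) * (9 * p / 5) ≤ (p / 5) * (2 * y + p) := by nlinarith
      have := le_of_mul_le_mul_left this (by positivity)
      linarith
    refine ⟨?_, ?_, hdet⟩
    · by_contra! hn
      have h2 : 5 * y - 2 * p ≤ 0 := by
        by_contra! h
        exact absurd hprod (not_le.2 (mul_neg_of_neg_of_pos hn h))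
      have := (hno (by linarith) (by linarith)).1
      linarith
    · by_contra! hn
      have h2 : 5 * x - p ≤ 0 := by
        by_contra! h
        exact absurd hprod (not_le.2 (mul_neg_of_pos_of_neg h hn))
      have := (hno (by linarith) (by linarith)).2
      linarith
  obtain ⟨hX, hY, hXY⟩ := key
  rcases hX.eq_or_lt with h0 | hX
  · have hz : 5 * z - p = 0 := by
      rw [← h0] at hXY
      have : (5 * z - p) ^ 2 = 0 := le_antisymm (by linarith) (sq_nonneg _)
      exact pow_eq_zero_iff (by norm_num) |>.1 this
    rw [← h0, hz]
    have : 0 ≤ (5 * y - 2 * p) / 5 * b ^ 2 := mul_nonneg (by linarith) (sq_nonneg b)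
    linarith
  · have h1 : 0 ≤ (5 * x - p) * ((5 * x - p) / 10 * a ^ 2 + 2 * (5 * z - p) / 5 * (a * b)
        + (5 * y - 2 * p) / 5 * b ^ 2) := by
      have h2 : (5 * x - p) * ((5 * x - p) / 10 * a ^ 2 + 2 * (5 * z - p) / 5 * (a * b)
        + (5 * y - 2 * p) / 5 * b ^ 2) = (1 / 10) * ((5 * x - p) * a + 2 * (5 * z - p) * b) ^ 2
        + (1 / 5) * ((5 * x - p) * (5 * y - 2 * p) - 2 * (5 * z - p) ^ 2) * b ^ 2 := by ring
      rw [h2]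
      have h3 : 0 ≤ ((5 * x - p) * (5 * y - 2 * p) - 2 * (5 * z - p) ^ 2) := by linarith
      positivity
    exact nonneg_of_mul_nonneg_right h1 hX

/-- Decomposition of the strain gradient energy into its irreducible parts. -/
theorem gradEnergy_eq (m : Material) {κ : Fin 3 → Fin 3 → Fin 3 → ℝ}
    (hκ : ∀ i j k, κ i j k = κ j i k) :
    gradEnergy m κ =
      (m.gamma4 + 2 * m.gamma5) * (∑ i, ∑ j, ∑ k, ((κ i j k + κ j k i + κ k i j) / 3
        - (1 / 15) * (kron i j * ((∑ h, κ h h k) + 2 * ∑ h, κ k h h)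
          + kron i k * ((∑ h, κ h h j) + 2 * ∑ h, κ j h h)
          + kron j k * ((∑ h, κ h h i) + 2 * ∑ h, κ i h h))) ^ 2)
      + (m.gamma4 - m.gamma5) * (∑ i, ∑ j, ∑ k, ((2 * κ i j k - κ j k i - κ k i j) / 3
        - (1 / 6) * (2 * kron i j * ((∑ h, κ h h k) - ∑ h, κ k h h)
          - kron i k * ((∑ h, κ h h j) - ∑ h, κ j h h)
          - kron j k * ((∑ h, κ h h i) - ∑ h, κ i h h))) ^ 2)
      + ∑ i, ((5 * (m.gamma3 + m.gamma4) - (m.gamma4 + 2 * m.gamma5)) / 10 * (∑ h, κ h h i) ^ 2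
        + 2 * (5 * (m.gamma1 + m.gamma5) - (m.gamma4 + 2 * m.gamma5)) / 5
          * ((∑ h, κ h h i) * ∑ h, κ i h h)
        + (5 * (2 * m.gamma2 + m.gamma4 + m.gamma5) - 2 * (m.gamma4 + 2 * m.gamma5)) / 5
          * (∑ h, κ i h h) ^ 2) := by
  -- Under rotations the 18 components of `κ` split as 7 + 5 + 3 + 3: totally symmetric traceless,
  -- mixed traceless, and the two trace vectors. Only the two vectors can couple. Once the symmetry
  -- in the first two indices is used up, the claim is a polynomial identity.
  simp only [gradEnergy, Fin.sum_univ_three, hκ 1 0, hκ 2 0, hκ 2 1]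
  simp [kron]
  ring

/-- The two traceless parts carry the coefficients `γ_4 + 2γ_5` and `γ_4 - γ_5`. The trace vectors
give, for each component, the form of `trace_form_nonneg` with `x = γ_3 + γ_4`, `y = 2γ_2 + γ_4 +
γ_5`, `z = γ_1 + γ_5`, `p = γ_4 + 2γ_5`. -/
theorem gradEnergy_nonneg {m : Material}
    (h1 : 0 ≤ m.gamma3 + m.gamma4) (h2 : 0 ≤ m.gamma4 - m.gamma5)
    (h3 : 0 ≤ m.gamma4 + 2 * m.gamma5) (h4 : 0 ≤ 2 * m.gamma2 + m.gamma4 + m.gamma5)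
    (h6 : (2 * m.gamma1 - m.gamma4) ^ 2
      ≤ (m.gamma3 + m.gamma4) * (4 * m.gamma2 + 3 * m.gamma4 + 4 * m.gamma5))
    (h7 : 2 * (m.gamma1 + m.gamma5) ^ 2
      ≤ (m.gamma3 + m.gamma4) * (2 * m.gamma2 + m.gamma4 + m.gamma5))
    (h9 : 0 ≤ (m.gamma4 + 2 * m.gamma5)
      * ((5 * m.gamma3 + 4 * m.gamma4 - 2 * m.gamma5) * (10 * m.gamma2 + 3 * m.gamma4 + m.gamma5)
        - 2 * (5 * m.gamma1 - m.gamma4 + 3 * m.gamma5) ^ 2))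
    {κ : Fin 3 → Fin 3 → Fin 3 → ℝ} (hκ : ∀ i j k, κ i j k = κ j i k) :
    0 ≤ gradEnergy m κ := by
  rw [gradEnergy_eq m hκ]
  refine add_nonneg (add_nonneg (mul_nonneg h3 ?_) (mul_nonneg h2 ?_)) ?_
  · exact Finset.sum_nonneg fun i _ => Finset.sum_nonneg fun j _ => Finset.sum_nonneg
      fun k _ => sq_nonneg _
  · exact Finset.sum_nonneg fun i _ => Finset.sum_nonneg fun j _ => Finset.sum_nonneg
      fun k _ => sq_nonneg _
  · refine Finset.sum_nonneg fun i _ => trace_form_nonneg h1 h4 h3 ?_ h7 ?_ _ _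
    · refine le_of_eq_of_le ?_ (h6.trans_eq ?_) <;> ring
    · refine h9.trans_eq ?_
      ring

end gradEnergy

/-- The sum of squares bounds the square of the trace. -/
theorem trace_sq_le (V : Fin 3 → Fin 3 → ℝ) :
    (∑ k, V k k) * (∑ k, V k k) ≤ 3 * ∑ i, ∑ j, V i j * V i j := by
  simp only [Fin.sum_univ_three]
  nlinarith [sq_nonneg (V 0 0 - V 1 1), sq_nonneg (V 1 1 - V 2 2), sq_nonneg (V 0 0 - V 2 2),
    sq_nonneg (V 0 1), sq_nonneg (V 0 2), sq_nonneg (V 1 0), sq_nonneg (V 1 2), sq_nonneg (V 2 0),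
    sq_nonneg (V 2 1)]

theorem sum_mul_self_nonneg (E : Fin 3 → ℝ) : 0 ≤ ∑ i, E i * E i :=
  Finset.sum_nonneg fun i _ => mul_self_nonneg (E i)

theorem eq_zero_of_sum_mul_self {E : Fin 3 → ℝ} (h : ∑ i, E i * E i = 0) (i : Fin 3) : E i = 0 :=
  mul_self_eq_zero.1 ((Finset.sum_eq_zero_iff_of_nonneg fun i _ => mul_self_nonneg (E i)).1 h i
    (Finset.mem_univ i))

/-! ### Definiteness of the thermoelectric forms -/

section thermoelectric

variable {m : Material} {A : ℝ} (hmuT : m.muTilde < 0) (h33 : m.alpha33 < 0) (hA : A < 0)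
  (h47 : 3 * m.alpha47 ^ 2 < (3 * m.lamTilde + 2 * m.muTilde) * A)

include hmuT h33 hA h47

/-- The thermoelectric form is positive definite. -/
theorem thermoelectric_nonneg (E : Fin 3 → ℝ) (V : Fin 3 → Fin 3 → ℝ) (th : ℝ) :
    0 ≤ -m.alpha33 * (∑ i, E i * E i) - m.lamTilde * ((∑ k, V k k) * ∑ k, V k k)
      - 2 * m.muTilde * (∑ i, ∑ j, V i j * V i j) - 2 * m.alpha47 * (th * ∑ k, V k k)
      - A * (th * th) ∧
    (-m.alpha33 * (∑ i, E i * E i) - m.lamTilde * ((∑ k, V k k) * ∑ k, V k k)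
      - 2 * m.muTilde * (∑ i, ∑ j, V i j * V i j) - 2 * m.alpha47 * (th * ∑ k, V k k)
      - A * (th * th) ≤ 0 → (∀ i, E i = 0) ∧ th = 0) := by
  have hE := sum_mul_self_nonneg E
  have hV := trace_sq_le V
  have hE2 := eq_zero_of_sum_mul_self (E := E)
  set q := ∑ i, E i * E i
  set v := ∑ k, V k k
  set w := ∑ i, ∑ j, V i j * V i j
  have h1 : 0 ≤ -m.alpha33 * q := mul_nonneg (by linarith) hE
  -- The deviatoric part of `V`; what remains is a binary form in `ϑ` and the trace `v`.
  have h2 : 0 ≤ -(2 * m.muTilde / 3) * (3 * w - v * v) := mul_nonneg (by linarith) (by linarith)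
  set d := (3 * m.lamTilde + 2 * m.muTilde) * A - 3 * m.alpha47 ^ 2 with hd
  have hd0 : 0 < d := by linarith
  -- Completing the square after multiplication by `-A > 0`; the remainder is the discriminant `d >
  -- 0` times `v²/3`.
  have h3 : -A * (-(3 * m.lamTilde + 2 * m.muTilde) / 3 * (v * v) - 2 * m.alpha47 * (th * v)
      - A * (th * th)) = (A * th + m.alpha47 * v) ^ 2 + d / 3 * (v * v) := by rw [hd]; ring
  have h4 : 0 ≤ (A * th + m.alpha47 * v) ^ 2 + d / 3 * (v * v) :=
    add_nonneg (sq_nonneg _) (mul_nonneg (by linarith) (mul_self_nonneg v))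
  have h5 : 0 ≤ -(3 * m.lamTilde + 2 * m.muTilde) / 3 * (v * v) - 2 * m.alpha47 * (th * v)
      - A * (th * th) := nonneg_of_mul_nonneg_right (by rw [h3]; exact h4) (by linarith : 0 < -A)
  refine ⟨by linarith, fun hle => ?_⟩
  have h6 : -m.alpha33 * q = 0 := by linarith
  have h7 : -(3 * m.lamTilde + 2 * m.muTilde) / 3 * (v * v) - 2 * m.alpha47 * (th * v)
      - A * (th * th) = 0 := by linarith
  rw [h7, mul_zero] at h3
  have h8 : 0 ≤ d / 3 * (v * v) := mul_nonneg (by linarith) (mul_self_nonneg v)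
  have h9 : (A * th + m.alpha47 * v) ^ 2 = 0 := by nlinarith [sq_nonneg (A * th + m.alpha47 * v)]
  have h10 : v * v = 0 := by
    have : d / 3 * (v * v) = 0 := by linarith
    exact (mul_eq_zero.1 this).resolve_left (by linarith)
  have hv : v = 0 := mul_self_eq_zero.1 h10
  have h11 := pow_eq_zero_iff (two_ne_zero) |>.1 h9
  rw [hv, mul_zero, add_zero] at h11
  exact ⟨hE2 ((mul_eq_zero.1 h6).resolve_left (by linarith)),
    (mul_eq_zero.1 h11).resolve_left hA.ne⟩

/-- The initial electric field vanishes together with the initial thermal variable. -/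
theorem initial_form_nonneg (E : Fin 3 → ℝ) (V : Fin 3 → Fin 3 → ℝ) (th : ℝ)
    (hth : A * th + m.alpha47 * (∑ k, V k k) = 0) :
    0 ≤ -m.alpha33 * (∑ i, E i * E i) - m.lamTilde * ((∑ k, V k k) * ∑ k, V k k)
      - 2 * m.muTilde * (∑ i, ∑ j, V i j * V i j) - m.alpha47 * (th * ∑ k, V k k) ∧
    (-m.alpha33 * (∑ i, E i * E i) - m.lamTilde * ((∑ k, V k k) * ∑ k, V k k)
      - 2 * m.muTilde * (∑ i, ∑ j, V i j * V i j) - m.alpha47 * (th * ∑ k, V k k) ≤ 0 →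
      (∀ i, E i = 0) ∧ (∑ i, ∑ j, V i j * V i j = 0) ∧ (∑ k, V k k = 0) ∧ th = 0) := by
  have hE := sum_mul_self_nonneg E
  have hV := trace_sq_le V
  have hE2 := eq_zero_of_sum_mul_self (E := E)
  set q := ∑ i, E i * E i
  set v := ∑ k, V k k
  set w := ∑ i, ∑ j, V i j * V i j
  have h1 : 0 ≤ -m.alpha33 * q := mul_nonneg (by linarith) hE
  have h2 : 0 ≤ -(2 * m.muTilde / 3) * (3 * w - v * v) := mul_nonneg (by linarith) (by linarith)
  set d := (3 * m.lamTilde + 2 * m.muTilde) * A - 3 * m.alpha47 ^ 2 with hd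
  have hd0 : 0 < d := by linarith
  -- The constraint replaces `A ϑ` by `-α^(47) v`, which leaves a multiple of `v²` with the same
  -- discriminant `d`. That the cross term enters only once here is compensated by the missing `ϑ²`
  -- term.
  have h3 : -A * (-(3 * m.lamTilde + 2 * m.muTilde) / 3 * (v * v) - m.alpha47 * (th * v))
      = d / 3 * (v * v) := by
    rw [hd]; linear_combination m.alpha47 * v * hth
  have h4 : 0 ≤ d / 3 * (v * v) := mul_nonneg (by linarith) (mul_self_nonneg v)
  have h5 : 0 ≤ -(3 * m.lamTilde + 2 * m.muTilde) / 3 * (v * v) - m.alpha47 * (th * v) :=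
    nonneg_of_mul_nonneg_right (by rw [h3]; exact h4) (by linarith : 0 < -A)
  refine ⟨by linarith, fun hle => ?_⟩
  have h6 : -m.alpha33 * q = 0 := by linarith
  have h7 : -(3 * m.lamTilde + 2 * m.muTilde) / 3 * (v * v) - m.alpha47 * (th * v) = 0 := by linarith
  have h8 : -(2 * m.muTilde / 3) * (3 * w - v * v) = 0 := by linarith
  rw [h7, mul_zero] at h3
  have hvv : v * v = 0 := (mul_eq_zero.1 h3.symm).resolve_left (by linarith)
  have hv : v = 0 := mul_self_eq_zero.1 hvv
  have hw := (mul_eq_zero.1 h8).resolve_left (by linarith)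
  rw [hv, mul_zero, add_zero] at hth
  exact ⟨hE2 ((mul_eq_zero.1 h6).resolve_left (by linarith)), by rw [hvv] at hw; linarith, hv,
    (mul_eq_zero.1 hth).resolve_left hA.ne⟩

end thermoelectric

/-! ### Time derivatives of the energies -/

section derivatives

variable {m : Material} {t : ℝ} {e V : ℝ → Fin 3 → Fin 3 → ℝ} {e' V' : Fin 3 → Fin 3 → ℝ}
  {κ : ℝ → Fin 3 → Fin 3 → Fin 3 → ℝ} {κ' : Fin 3 → Fin 3 → Fin 3 → ℝ}
  {E : ℝ → Fin 3 → ℝ} {E' : Fin 3 → ℝ} {th : ℝ → ℝ} {th' : ℝ}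

/-- The purely elastic part of `τ` is the gradient of this potential, so the stress power is an
exact time derivative. The next two lemmas do the same for the elastic hyperstress and for all
remaining terms. -/
theorem hasDerivAt_strainEnergy (he : ∀ i j, HasDerivAt (fun s => e s i j) (e' i j) t) :
    HasDerivAt (fun s => strainEnergy m (e s))
      (∑ i, ∑ j, (m.lam * (∑ k, e t k k) * kron i j + 2 * m.mu * e t i j) * e' i j) t := by
  have h1 : HasDerivAt (fun s => ∑ k, e s k k) (∑ k, e' k k) t :=
    HasDerivAt.fun_sum fun k _ => he k k
  have h2 : HasDerivAt (fun s => ∑ i, ∑ j, e s i j * e s i j)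
      (∑ i, ∑ j, (e' i j * e t i j + e t i j * e' i j)) t :=
    HasDerivAt.fun_sum fun i _ => HasDerivAt.fun_sum fun j _ => (he i j).mul (he i j)
  refine (((h1.mul h1).const_mul (m.lam / 2)).add (h2.const_mul m.mu)).congr_deriv ?_
  simp only [Fin.sum_univ_three]
  simp [kron]
  ring

theorem hasDerivAt_gradEnergy (hκ : ∀ i j k, HasDerivAt (fun s => κ s i j k) (κ' i j k) t)
    (hs : ∀ i j k, κ t i j k = κ t j i k) (hs' : ∀ i j k, κ' i j k = κ' j i k) :
    HasDerivAt (fun s => gradEnergy m (κ s))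
      (∑ i, ∑ j, ∑ k, (m.gamma1 * ((∑ h, κ t h h i) * kron j k + 2 * (∑ h, κ t k h h) * kron i j
          + (∑ h, κ t h h j) * kron i k)
        + 2 * m.gamma2 * ((∑ h, κ t i h h) * kron j k + (∑ h, κ t j h h) * kron i k)
        + m.gamma3 * (∑ h, κ t h h k) * kron i j
        + 2 * m.gamma4 * κ t i j k
        + 2 * m.gamma5 * (κ t k j i + κ t k i j)) * κ' i j k) t := by
  have h1 : ∀ i, HasDerivAt (fun s => ∑ h, κ s h h i) (∑ h, κ' h h i) t := fun i =>
    HasDerivAt.fun_sum fun h _ => hκ h h i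
  have h2 : ∀ i, HasDerivAt (fun s => ∑ h, κ s i h h) (∑ h, κ' i h h) t := fun i =>
    HasDerivAt.fun_sum fun h _ => hκ i h h
  have d1 : HasDerivAt (fun s => ∑ i, (∑ h, κ s h h i) * ∑ h, κ s i h h) _ t :=
    HasDerivAt.fun_sum fun i _ => (h1 i).mul (h2 i)
  have d2 : HasDerivAt (fun s => ∑ i, (∑ h, κ s i h h) * ∑ h, κ s i h h) _ t :=
    HasDerivAt.fun_sum fun i _ => (h2 i).mul (h2 i)
  have d3 : HasDerivAt (fun s => ∑ i, (∑ h, κ s h h i) * ∑ h, κ s h h i) _ t :=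
    HasDerivAt.fun_sum fun i _ => (h1 i).mul (h1 i)
  have d4 : HasDerivAt (fun s => ∑ i, ∑ j, ∑ k, κ s i j k * κ s i j k) _ t :=
    HasDerivAt.fun_sum fun i _ => HasDerivAt.fun_sum fun j _ => HasDerivAt.fun_sum fun k _ =>
      (hκ i j k).mul (hκ i j k)
  have d5 : HasDerivAt (fun s => ∑ i, ∑ j, ∑ k, κ s i j k * κ s k j i) _ t :=
    HasDerivAt.fun_sum fun i _ => HasDerivAt.fun_sum fun j _ => HasDerivAt.fun_sum fun k _ =>
      (hκ i j k).mul (hκ k j i)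
  refine (((((d1.const_mul (2 * m.gamma1)).add (d2.const_mul (2 * m.gamma2))).add
    (d3.const_mul (m.gamma3 / 2))).add (d4.const_mul m.gamma4)).add
    (d5.const_mul (2 * m.gamma5))).congr_deriv ?_
  simp only [Fin.sum_univ_three, hs 1 0, hs 2 0, hs 2 1, hs' 1 0, hs' 2 0, hs' 2 1]
  simp [kron]
  ring

/-- The five groups are the partial derivatives of one potential: the coupling parts of `τ` and of
the hyperstress, then `-σ`, `-Q`, and `-ρη` without its `θ̇` and constant terms. That a single
potential produces all of them expresses the reciprocity of the couplings. -/
theorem hasDerivAt_couplingEnergy (he : ∀ i j, HasDerivAt (fun s => e s i j) (e' i j) t)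
    (hκ : ∀ i j k, HasDerivAt (fun s => κ s i j k) (κ' i j k) t)
    (hs' : ∀ i j k, κ' i j k = κ' j i k)
    (hE : ∀ i, HasDerivAt (fun s => E s i) (E' i) t)
    (hV : ∀ i j, HasDerivAt (fun s => V s i j) (V' i j) t) (hth : HasDerivAt th th' t) :
    HasDerivAt (fun s => couplingEnergy m (e s) (κ s) (E s) (V s) (th s))
      ((∑ i, ∑ j, (m.alpha14 * kron i j * th t + m.lamStar * (∑ k, V t k k) * kron i j
          + 2 * m.muStar * V t i j) * e' i j)
        + (∑ i, ∑ j, ∑ k, (m.alpha0 * kron i j * E t k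
          + m.beta0 * (kron i k * E t j + kron j k * E t i)) * κ' i j k)
        + (∑ i, (m.alpha0 * (∑ k, κ t k k i) + 2 * m.beta0 * (∑ k, κ t i k k)
          + m.alpha33 * E t i) * E' i)
        + (∑ i, ∑ j, (m.lamStar * (∑ k, e t k k) * kron i j + 2 * m.muStar * e t i j
          + m.alpha47 * kron i j * th t + m.lamTilde * (∑ k, V t k k) * kron i j
          + 2 * m.muTilde * V t i j) * V' i j)
        + (m.alpha14 * (∑ k, e t k k) + m.a44 * th t + m.alpha47 * (∑ k, V t k k)) * th') t := by
  have h1 : HasDerivAt (fun s => ∑ k, e s k k) (∑ k, e' k k) t :=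
    HasDerivAt.fun_sum fun k _ => he k k
  have h2 : HasDerivAt (fun s => ∑ k, V s k k) (∑ k, V' k k) t :=
    HasDerivAt.fun_sum fun k _ => hV k k
  have d1 : HasDerivAt (fun s => ∑ i, E s i * E s i) _ t :=
    HasDerivAt.fun_sum fun i _ => (hE i).mul (hE i)
  have d2 : HasDerivAt (fun s => ∑ i, ∑ j, V s i j * V s i j) _ t :=
    HasDerivAt.fun_sum fun i _ => HasDerivAt.fun_sum fun j _ => (hV i j).mul (hV i j)
  have d3 : HasDerivAt (fun s => ∑ i, ∑ j, e s i j * V s i j) _ t :=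
    HasDerivAt.fun_sum fun i _ => HasDerivAt.fun_sum fun j _ => (he i j).mul (hV i j)
  have d4 : HasDerivAt (fun s => ∑ i, (∑ k, κ s k k i) * E s i) _ t :=
    HasDerivAt.fun_sum fun i _ => (HasDerivAt.fun_sum fun k _ => hκ k k i).mul (hE i)
  have d5 : HasDerivAt (fun s => ∑ i, (∑ k, κ s i k k) * E s i) _ t :=
    HasDerivAt.fun_sum fun i _ => (HasDerivAt.fun_sum fun k _ => hκ i k k).mul (hE i)
  refine ((((((((((d1.const_mul (m.alpha33 / 2)).add ((h2.mul h2).const_mul (m.lamTilde / 2))).add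
    (d2.const_mul m.muTilde)).add ((hth.mul hth).const_mul (m.a44 / 2))).add
    ((hth.mul h2).const_mul m.alpha47)).add ((hth.mul h1).const_mul m.alpha14)).add
    ((h1.mul h2).const_mul m.lamStar)).add (d3.const_mul (2 * m.muStar))).add
    (d4.const_mul m.alpha0)).add (d5.const_mul (2 * m.beta0))).congr_deriv ?_
  simp only [Fin.sum_univ_three, hs' 1 0, hs' 2 0, hs' 2 1]
  simp [kron]
  ring

end derivatives

end Thermopiezo
end

noncomputable section
namespace Thermopiezo
open Set Filter Topology Metric MeasureTheory
open scoped ContDiff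

/-! ### Weak forms of the field equations -/

theorem pd_pd_comm {B : Set E3} (hB : IsOpen B) {F : E3 → ℝ} (hF : ContDiffOn ℝ 2 F (closure B))
    {x : E3} (hx : x ∈ B) (i j : Fin 3) : pd B (pd B F i) j x = pd B (pd B F j) i x := by
  have hF2 : ContDiffAt ℝ 2 F x := (hF.mono subset_closure).contDiffAt (hB.mem_nhds hx)
  have hd : DifferentiableAt ℝ (fderiv ℝ F) x :=
    (hF2.fderiv_right (m := 1) (by norm_num)).differentiableAt (by norm_num)
  have h1 : ∀ k l, pd B (pd B F k) l x
      = fderiv ℝ (fderiv ℝ F) x (EuclideanSpace.single l 1) (EuclideanSpace.single k 1) := by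
    intro k l
    have he : pd B F k =ᶠ[𝓝 x] fun y => fderiv ℝ F y (EuclideanSpace.single k 1) := by
      filter_upwards [hB.mem_nhds hx] with y hy using pd_eq_fderiv hB F k hy
    rw [pd_eq_fderiv hB _ l hx, he.fderiv_eq, fderiv_clm_apply hd (differentiableAt_const _)]
    simp
  rw [h1, h1]
  exact (hF2.isSymmSndFDerivAt (by simp)).eq _ _

theorem pd_neg {B : Set E3} (hU : UniqueDiffOn ℝ (closure B)) {F : E3 → ℝ} {x : E3}
    (hx : x ∈ closure B) (j : Fin 3) : pd B (fun y => -F y) j x = -pd B F j x := by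
  unfold pd
  rw [fderivWithin_fun_neg (hU x hx)]
  rfl

/-- The parts cover the boundary only after closing `S`, so the vanishing of `f` on `S` is extended
to its closure by continuity. -/
theorem IsSplit.mul_eq_zero {B S Sig : Set E3} (h : IsSplit B S Sig) {f g : E3 → ℝ}
    (hf : ContinuousOn f (closure B)) (hfS : ∀ x ∈ S, f x = 0) (hg : ∀ x ∈ Sig, g x = 0) :
    ∀ x ∈ frontier B, g x * f x = 0 := by
  intro x hx
  have hx' := hx
  rw [← h.2.1] at hx'
  rcases hx' with hxS | hxS
  · have hc : ContinuousWithinAt f S x :=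
      (hf x (frontier_subset_closure hx)).mono (h.1.trans frontier_subset_closure)
    have h1 := hc.mem_closure_image hxS
    have h2 : f '' S ⊆ {0} := by
      rintro _ ⟨y, hy, rfl⟩
      exact hfS y hy
    have h3 : f x ∈ closure ({0} : Set ℝ) := closure_mono h2 h1
    rw [closure_singleton] at h3
    rw [show f x = 0 from h3, mul_zero]
  · rw [hg x hxS, zero_mul]

section weak_forms

variable {B : Set E3} {G : E3 → ℝ} (hG : IsDefiningFunction B G) (hb : Bornology.IsBounded B)
  {t0 : EReal} (h0 : 0 < t0) {m : Material} {S : BoundaryParts B} {U : State}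
  (hS : IsSolution B t0 m S ExternalData.zero U) {t s : ℝ} {x : E3}

include hG in
theorem normal_deriv_mul_eq_zero {S Sig : Set E3} (h : IsSplit B S Sig) {v g : E3 → ℝ}
    (hv : ContDiffOn ℝ 1 v (closure B))
    (hvS : ∀ x ∈ S, ∑ i, normal B x i * pd B v i x = 0) (hg : ∀ x ∈ Sig, g x = 0) :
    ∀ x ∈ frontier B, g x * ∑ i, normal B x i * pd B v i x = 0 := by
  obtain ⟨N, hN, hNn, -, -⟩ := hG.exists_normal_extension
  have h1 := h.mul_eq_zero (f := fun x => ∑ i, N i x * pd B v i x) (g := g)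
    (continuousOn_finsetSum _ fun i _ => (hN i).continuousOn.mul (hG.continuousOn_pd hv i))
    (fun x hx => by simpa only [hNn x (h.1 hx)] using hvS x hx) hg
  intro x hx
  simpa only [hNn x hx] using h1 x hx

include hG

theorem State.IsRegular.kappa_symm (hU : U.IsRegular B t0) (ht : t ∈ timeInterval t0) (hx : x ∈ B)
    (i j k : Fin 3) : Thermopiezo.kappa B U i j k t x = Thermopiezo.kappa B U j i k t x :=
  pd_pd_comm hG.isOpen (((hU.u k).of_le (by norm_num)).slice ht) hx i j

theorem elGrad_eq_neg (hx : x ∈ closure B) (i j : Fin 3) :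
    elGrad B U i j t x = -pd B (pd B (U.phi t) i) j x :=
  pd_neg hG.uniqueDiffOn_closure hx j

theorem State.IsRegular.elGrad_symm (hU : U.IsRegular B t0) (ht : t ∈ timeInterval t0) (hx : x ∈ B)
    (i j : Fin 3) : Thermopiezo.elGrad B U i j t x = Thermopiezo.elGrad B U j i t x := by
  rw [elGrad_eq_neg hG (subset_closure hx), elGrad_eq_neg hG (subset_closure hx),
    pd_pd_comm hG.isOpen ((hU.phi.of_le (by norm_num)).slice ht) hx]

theorem State.IsRegular.tau_symm (hU : U.IsRegular B t0) (ht : t ∈ timeInterval t0) (hx : x ∈ B)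
    (i j : Fin 3) : Thermopiezo.tau B t0 m U i j t x = Thermopiezo.tau B t0 m U j i t x := by
  have h1 : Thermopiezo.strain B U i j t x = Thermopiezo.strain B U j i t x := by
    unfold Thermopiezo.strain; ring
  have h2 : kron i j = kron j i := by unfold kron; simp only [eq_comm]
  unfold Thermopiezo.tau
  rw [h1, h2, hU.elGrad_symm hG ht hx i j]

theorem State.IsRegular.dt_kappa_symm (hU : U.IsRegular B t0) (ht : t ∈ timeInterval t0)
    (hx : x ∈ B) (i j k : Fin 3) :
    dt t0 (Thermopiezo.kappa B U i j k) t x = dt t0 (Thermopiezo.kappa B U j i k) t x :=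
  derivWithin_congr (fun _ hs => hU.kappa_symm hG hs hx i j k) (hU.kappa_symm hG ht hx i j k)

include hb h0 hS

/-- The loads are taken at time `t` and the test field is the displacement at another time `s`. It
satisfies the homogeneous conditions on `S_1` and `S_2` at every `s`, so differentiation in `s`
later produces the power balance without boundary conditions for the velocity and without
interchanging space and time derivatives. -/
theorem motion_weak (ht : t ∈ timeInterval t0) (hs : s ∈ timeInterval t0) :
    ∫ x in B, ((∑ i, m.rho * dt t0 (dt t0 (U.u i)) t x * U.u i s x)
      + (∑ i, ∑ j, tau B t0 m U i j t x * strain B U i j s x)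
      + ∑ i, ∑ j, ∑ k, hyper B m U i j k t x * kappa B U i j k s x) = 0 := by
  have hB := hG.uniqueDiffOn_closure
  have hU := hS.isRegular
  have hi : ∀ i, ∫ x in B, (m.rho * dt t0 (dt t0 (U.u i)) t x * U.u i s x
      + (∑ j, tau B t0 m U j i t x * dx B (U.u i) j s x)
      + ∑ j, ∑ k, hyper B m U j k i t x * kappa B U k j i s x) = 0 := by
    intro i
    have hv : ContDiffOn ℝ 2 (U.u i s) (closure B) := ((hU.u i).of_le (by norm_num)).slice hs
    have h1 := hG.virtual_work hb (s := fun j => tau B t0 m U j i t)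
      (M := fun j k => hyper B m U j k i t) (v := U.u i s)
      (fun j => ((hU.tau h0 hB m j i).of_le (by norm_num)).slice ht)
      (fun j k => (hU.hyper h0 hB m j k i).slice ht) hv
      (S.split1.mul_eq_zero hv.continuousOn (fun x hx => hS.bdry_u s hs x hx i)
        fun x hx => hS.bdry_P t ht x hx i)
      (normal_deriv_mul_eq_zero hG S.split2 (hv.of_le (by norm_num))
        (fun x hx => hS.bdry_du s hs x hx i) fun x hx => hS.bdry_R t ht x hx i)
    rw [← h1]
    refine setIntegral_congr_fun hG.isOpen.measurableSet fun x hx => ?_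
    have h2 : (∑ j, pd B (tau B t0 m U j i t) j x)
        - (∑ j, ∑ k, pd B (pd B (hyper B m U k j i t) k) j x) + m.rho * 0
        = m.rho * dt t0 (dt t0 (U.u i)) t x := hS.motion t ht x hx i
    rw [mul_zero, add_zero] at h2
    show _ = _ * _ + _ + _
    rw [h2]
    rfl
  have hint : ∀ i, IntegrableOn (fun x => m.rho * dt t0 (dt t0 (U.u i)) t x * U.u i s x
      + (∑ j, tau B t0 m U j i t x * dx B (U.u i) j s x)
      + ∑ j, ∑ k, hyper B m U j k i t x * kappa B U k j i s x) B := by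
    intro i
    have c1 : ContinuousOn (dt t0 (dt t0 (U.u i)) t) (closure B) :=
      ((((hU.u i).dt (m := 3) h0 hB (by norm_num)).dt (m := 2) h0 hB (by norm_num)).slice
        ht).continuousOn
    have c2 := ((hU.u i).slice hs).continuousOn
    have c3 : ∀ j, ContinuousOn (tau B t0 m U j i t) (closure B) := fun j =>
      ((hU.tau h0 hB m j i).slice ht).continuousOn
    have c4 : ∀ j, ContinuousOn (dx B (U.u i) j s) (closure B) := fun j =>
      (((hU.u i).dx (m := 3) h0 hB (by norm_num) j).slice hs).continuousOn
    have c5 : ∀ j k, ContinuousOn (hyper B m U j k i t) (closure B) := fun j k =>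
      ((hU.hyper h0 hB m j k i).slice ht).continuousOn
    have c6 : ∀ j k, ContinuousOn (kappa B U k j i s) (closure B) := fun j k =>
      ((hU.kappa h0 hB k j i).slice hs).continuousOn
    refine ContinuousOn.integrableOn_of_closure hb ?_
    fun_prop
  have hsum := integral_finsetSum Finset.univ fun i _ => hint i
  rw [Finset.sum_congr rfl fun i _ => hi i, Finset.sum_const_zero] at hsum
  rw [← hsum]
  refine setIntegral_congr_fun hG.isOpen.measurableSet fun x hx => ?_
  -- Symmetry of `τ` lets the displacement gradient be replaced by the strain; symmetry of second
  -- derivatives matches the index order of `κ`.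
  have e1 := fun i j => hU.tau_symm (m := m) hG ht hx i j
  have e2 := fun i j k => hU.kappa_symm hG hs hx i j k
  simp only [strain, Fin.sum_univ_three, e1 1 0, e1 2 0, e1 2 1, e2 1 0, e2 2 0, e2 2 1]
  ring

/-- Virtual work with test field `φ(s)`, up to a global sign from `E = -∇φ`. The case `s = t` says
that the total electric work is zero; the derivative in `s` gives the electric power balance. -/
theorem electric_weak (ht : t ∈ timeInterval t0) (hs : s ∈ timeInterval t0) :
    ∫ x in B, ((∑ j, sigma B m U j t x * elField B U j s x)
      + ∑ j, ∑ k, quad B t0 m U j k t x * elGrad B U j k s x) = 0 := by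
  have hB := hG.uniqueDiffOn_closure
  have hU := hS.isRegular
  have hv : ContDiffOn ℝ 2 (U.phi s) (closure B) := (hU.phi.of_le (by norm_num)).slice hs
  have h1 := hG.virtual_work hb (s := fun j => sigma B m U j t)
    (M := fun j k => quad B t0 m U j k t) (v := U.phi s)
    (fun j => ((hU.sigma h0 hB m j).of_le (by norm_num)).slice ht)
    (fun j k => (hU.quad h0 hB m j k).slice ht) hv
    (S.split4.mul_eq_zero hv.continuousOn (fun x hx => hS.bdry_phi s hs x hx)
      fun x hx => hS.bdry_Lambda t ht x hx)
    (normal_deriv_mul_eq_zero hG S.split5 (hv.of_le (by norm_num))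
      (fun x hx => hS.bdry_dphi s hs x hx) fun x hx => hS.bdry_H t ht x hx)
  rw [← neg_eq_zero, ← integral_neg, ← h1]
  refine setIntegral_congr_fun hG.isOpen.measurableSet fun x hx => ?_
  have h2 : (∑ j, pd B (sigma B m U j t) j x)
      - (∑ j, ∑ k, pd B (pd B (quad B t0 m U k j t) k) j x) = 0 := hS.electric t ht x hx
  show _ = _ * _ + _ + _
  rw [h2]
  have e1 := fun i j => hU.elGrad_symm hG hs hx i j
  have e2 := fun i j => elGrad_eq_neg hG (U := U) (t := s) (subset_closure hx) i j
  have e3 : ∀ j, pd B (U.phi s) j x = -elField B U j s x := fun j => (neg_neg _).symm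
  have e4 : ∀ i j, pd B (pd B (U.phi s) i) j x = -elGrad B U i j s x := fun i j => by
    rw [e2, neg_neg]
  simp only [e3, e4, Fin.sum_univ_three, e1 1 0, e1 2 0, e1 2 1]
  ring

theorem heat_weak (ht : t ∈ timeInterval t0) (hs : s ∈ timeInterval t0) :
    ∫ x in B, (-(m.rho * m.T0 * dt t0 (entropy B t0 m U) t x) * U.theta s x
      + ∑ j, heatFlux B m U j t x * dx B U.theta j s x) = 0 := by
  have hB := hG.uniqueDiffOn_closure
  have hU := hS.isRegular
  have hv : ContDiffOn ℝ 1 (U.theta s) (closure B) := (hU.theta.of_le (by norm_num)).slice hs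
  have hq : ∀ j, ContDiffOn ℝ 1 (heatFlux B m U j t) (closure B) := fun j =>
    ((hU.heatFlux h0 hB m j).of_le (by norm_num)).slice ht
  have h1 := hG.integral_div_eq_zero hb (F := fun j x => heatFlux B m U j t x * U.theta s x)
    -- The heat equation is of first gradient type, so no surface correction is needed.
    (A := fun _ _ _ => 0) (fun j => (hq j).mul hv) (fun _ _ => contDiffOn_const)
    (fun _ _ _ => by simp) ?_
  · rw [← h1]
    refine setIntegral_congr_fun hG.isOpen.measurableSet fun x hx => ?_
    have h2 : m.rho * m.T0 * dt t0 (entropy B t0 m U) t x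
        + (∑ j, pd B (heatFlux B m U j t) j x) - m.rho * 0 = 0 := hS.energy t ht x hx
    show _ = ∑ j, pd B (fun x => heatFlux B m U j t x * U.theta s x) j x
    simp only [pd_mul hB (hq _) hv (subset_closure hx)]
    have e3 : ∀ j, dx B U.theta j s x = pd B (U.theta s) j x := fun j => rfl
    simp only [e3, Fin.sum_univ_three] at h2 ⊢
    linear_combination (-U.theta s x) * h2
  · intro x hx
    have h2 := S.split3.mul_eq_zero hv.continuousOn (fun x hx => hS.bdry_theta s hs x hx)
      (g := fun x => ∑ j, heatFlux B m U j t x * normal B x j) (fun x hx => hS.bdry_q t ht x hx) x hx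
    have e0 : ∀ k, pd B (fun _ => (0:ℝ)) k x = 0 := fun k => by unfold pd; simp
    simp only [e0, Fin.sum_univ_three] at h2 ⊢
    linear_combination h2

/-- Power balance of the motion. -/
theorem motion_power (ht : t ∈ timeInterval t0) (hpos : 0 < t) :
    ∫ x in B, ((∑ i, m.rho * dt t0 (dt t0 (U.u i)) t x * dt t0 (U.u i) t x)
      + (∑ i, ∑ j, tau B t0 m U i j t x * dt t0 (strain B U i j) t x)
      + ∑ i, ∑ j, ∑ k, hyper B m U i j k t x * dt t0 (kappa B U i j k) t x) = 0 := by
  have hB := hG.uniqueDiffOn_closure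
  have hU := hS.isRegular
  have c1 : ∀ i, ContDiffOn ℝ 0 (fun p : ℝ × E3 => dt t0 (dt t0 (U.u i)) t p.2)
      (timeInterval t0 ×ˢ closure B) := fun i =>
    (((hU.u i).dt (m := 3) h0 hB (by norm_num)).dt (m := 0) h0 hB (by norm_num)).const ht
  have c2 : ∀ i, ContDiffOn ℝ 0 (fun p : ℝ × E3 => U.u i p.1 p.2)
      (timeInterval t0 ×ˢ closure B) := fun i => (hU.u i).of_le (by norm_num)
  have c3 : ∀ i j, ContDiffOn ℝ 0 (fun p : ℝ × E3 => tau B t0 m U i j t p.2)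
      (timeInterval t0 ×ˢ closure B) := fun i j =>
    ((hU.tau h0 hB m i j).const ht).of_le (by norm_num)
  have c4 : ∀ i j, ContDiffOn ℝ 0 (fun p : ℝ × E3 => strain B U i j p.1 p.2)
      (timeInterval t0 ×ˢ closure B) := fun i j => (hU.strain h0 hB i j).of_le (by norm_num)
  have c5 : ∀ i j k, ContDiffOn ℝ 0 (fun p : ℝ × E3 => hyper B m U i j k t p.2)
      (timeInterval t0 ×ˢ closure B) := fun i j k =>
    ((hU.hyper h0 hB m i j k).const ht).of_le (by norm_num)
  have c6 : ∀ i j k, ContDiffOn ℝ 0 (fun p : ℝ × E3 => kappa B U i j k p.1 p.2)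
      (timeInterval t0 ×ˢ closure B) := fun i j k => (hU.kappa h0 hB i j k).of_le (by norm_num)
  have c2' : ∀ i, ContDiffOn ℝ 0 (fun p : ℝ × E3 => dt t0 (U.u i) p.1 p.2)
      (timeInterval t0 ×ˢ closure B) := fun i => (hU.u i).dt h0 hB (by norm_num)
  have c4' : ∀ i j, ContDiffOn ℝ 0 (fun p : ℝ × E3 => dt t0 (strain B U i j) p.1 p.2)
      (timeInterval t0 ×ˢ closure B) := fun i j => (hU.strain h0 hB i j).dt h0 hB (by norm_num)
  have c6' : ∀ i j k, ContDiffOn ℝ 0 (fun p : ℝ × E3 => dt t0 (kappa B U i j k) p.1 p.2)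
      (timeInterval t0 ×ˢ closure B) := fun i j k => (hU.kappa h0 hB i j k).dt h0 hB (by norm_num)
  -- The weak form vanishes for all `s` with `t` frozen in the loads; differentiate it in `s` and
  -- evaluate at `s = t`. The two balances below are obtained in the same way.
  refine IsClass.integral_deriv_eq_zero hG.isOpen hb
    (f := fun s x => (∑ i, m.rho * dt t0 (dt t0 (U.u i)) t x * U.u i s x)
      + (∑ i, ∑ j, tau B t0 m U i j t x * strain B U i j s x)
      + ∑ i, ∑ j, ∑ k, hyper B m U i j k t x * kappa B U i j k s x)
    (f' := fun s x => (∑ i, m.rho * dt t0 (dt t0 (U.u i)) t x * dt t0 (U.u i) s x)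
      + (∑ i, ∑ j, tau B t0 m U i j t x * dt t0 (strain B U i j) s x)
      + ∑ i, ∑ j, ∑ k, hyper B m U i j k t x * dt t0 (kappa B U i j k) s x)
    ?_ ?_ (fun s hs hsp x hx => ?_) (fun s hs => motion_weak hG hb h0 hS ht hs) ht hpos
  · unfold IsClass; fun_prop
  · unfold IsClass; fun_prop
  · have hx := subset_closure hx
    refine (HasDerivAt.fun_add (HasDerivAt.fun_sum fun i _ => ?_) (HasDerivAt.fun_sum fun i _ =>
      HasDerivAt.fun_sum fun j _ => ?_)).fun_add (HasDerivAt.fun_sum fun i _ =>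
      HasDerivAt.fun_sum fun j _ => HasDerivAt.fun_sum fun k _ => ?_)
    · exact (((hU.u i).of_le (by norm_num)).hasDerivAt hs hsp hx).const_mul _
    · exact (((hU.strain h0 hB i j).of_le (by norm_num)).hasDerivAt hs hsp hx).const_mul _
    · exact (((hU.kappa h0 hB i j k).of_le (by norm_num)).hasDerivAt hs hsp hx).const_mul _

/-- Balance of electric power. -/
theorem electric_power (ht : t ∈ timeInterval t0) (hpos : 0 < t) :
    ∫ x in B, ((∑ j, sigma B m U j t x * dt t0 (elField B U j) t x)
      + ∑ j, ∑ k, quad B t0 m U j k t x * dt t0 (elGrad B U j k) t x) = 0 := by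
  have hB := hG.uniqueDiffOn_closure
  have hU := hS.isRegular
  have c1 : ∀ i, ContDiffOn ℝ 0 (fun p : ℝ × E3 => sigma B m U i t p.2)
      (timeInterval t0 ×ˢ closure B) := fun i =>
    ((hU.sigma h0 hB m i).const ht).of_le (by norm_num)
  have c2 : ∀ i j, ContDiffOn ℝ 0 (fun p : ℝ × E3 => quad B t0 m U i j t p.2)
      (timeInterval t0 ×ˢ closure B) := fun i j =>
    ((hU.quad h0 hB m i j).const ht).of_le (by norm_num)
  have c3 : ∀ i, ContDiffOn ℝ 0 (fun p : ℝ × E3 => elField B U i p.1 p.2)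
      (timeInterval t0 ×ˢ closure B) := fun i => (hU.elField h0 hB i).of_le (by norm_num)
  have c4 : ∀ i j, ContDiffOn ℝ 0 (fun p : ℝ × E3 => elGrad B U i j p.1 p.2)
      (timeInterval t0 ×ˢ closure B) := fun i j => (hU.elGrad h0 hB i j).of_le (by norm_num)
  have c3' : ∀ i, ContDiffOn ℝ 0 (fun p : ℝ × E3 => dt t0 (elField B U i) p.1 p.2)
      (timeInterval t0 ×ˢ closure B) := fun i => (hU.elField h0 hB i).dt h0 hB (by norm_num)
  have c4' : ∀ i j, ContDiffOn ℝ 0 (fun p : ℝ × E3 => dt t0 (elGrad B U i j) p.1 p.2)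
      (timeInterval t0 ×ˢ closure B) := fun i j => (hU.elGrad h0 hB i j).dt h0 hB (by norm_num)
  refine IsClass.integral_deriv_eq_zero hG.isOpen hb
    (f := fun s x => (∑ j, sigma B m U j t x * elField B U j s x)
      + ∑ j, ∑ k, quad B t0 m U j k t x * elGrad B U j k s x)
    (f' := fun s x => (∑ j, sigma B m U j t x * dt t0 (elField B U j) s x)
      + ∑ j, ∑ k, quad B t0 m U j k t x * dt t0 (elGrad B U j k) s x)
    ?_ ?_ (fun s hs hsp x hx => ?_) (fun s hs => electric_weak hG hb h0 hS ht hs) ht hpos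
  · unfold IsClass; fun_prop
  · unfold IsClass; fun_prop
  · have hx := subset_closure hx
    refine HasDerivAt.fun_add (HasDerivAt.fun_sum fun i _ => ?_) (HasDerivAt.fun_sum fun i _ =>
      HasDerivAt.fun_sum fun j _ => ?_)
    · exact (((hU.elField h0 hB i).of_le (by norm_num)).hasDerivAt hs hsp hx).const_mul _
    · exact (((hU.elGrad h0 hB i j).of_le (by norm_num)).hasDerivAt hs hsp hx).const_mul _

/-- The heat equation tested with the temperature rate. -/
theorem heat_power (ht : t ∈ timeInterval t0) (hpos : 0 < t) :
    ∫ x in B, (-(m.rho * m.T0 * dt t0 (entropy B t0 m U) t x) * dt t0 U.theta t x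
      + ∑ j, heatFlux B m U j t x * dt t0 (dx B U.theta j) t x) = 0 := by
  have hB := hG.uniqueDiffOn_closure
  have hU := hS.isRegular
  have c1 : ContDiffOn ℝ 0 (fun p : ℝ × E3 => dt t0 (entropy B t0 m U) t p.2)
      (timeInterval t0 ×ˢ closure B) :=
    ((hU.entropy h0 hB m).dt (m := 0) h0 hB (by norm_num)).const ht
  have c2 : ∀ i, ContDiffOn ℝ 0 (fun p : ℝ × E3 => heatFlux B m U i t p.2)
      (timeInterval t0 ×ˢ closure B) := fun i =>
    ((hU.heatFlux h0 hB m i).const ht).of_le (by norm_num)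
  have c3 : ContDiffOn ℝ 0 (fun p : ℝ × E3 => U.theta p.1 p.2)
      (timeInterval t0 ×ˢ closure B) := hU.theta.of_le (by norm_num)
  have c3' : ContDiffOn ℝ 0 (fun p : ℝ × E3 => dt t0 U.theta p.1 p.2)
      (timeInterval t0 ×ˢ closure B) := hU.theta.dt h0 hB (by norm_num)
  have d4 : ∀ j, IsClass B t0 2 (dx B U.theta j) := fun j => hU.theta.dx h0 hB (by norm_num) j
  have c4 : ∀ j, ContDiffOn ℝ 0 (fun p : ℝ × E3 => dx B U.theta j p.1 p.2)
      (timeInterval t0 ×ˢ closure B) := fun j => (d4 j).of_le (by norm_num)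
  have c4' : ∀ j, ContDiffOn ℝ 0 (fun p : ℝ × E3 => dt t0 (dx B U.theta j) p.1 p.2)
      (timeInterval t0 ×ˢ closure B) := fun j => (d4 j).dt h0 hB (by norm_num)
  refine IsClass.integral_deriv_eq_zero hG.isOpen hb
    (f := fun s x => -(m.rho * m.T0 * dt t0 (entropy B t0 m U) t x) * U.theta s x
      + ∑ j, heatFlux B m U j t x * dx B U.theta j s x)
    (f' := fun s x => -(m.rho * m.T0 * dt t0 (entropy B t0 m U) t x) * dt t0 U.theta s x
      + ∑ j, heatFlux B m U j t x * dt t0 (dx B U.theta j) s x)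
    ?_ ?_ (fun s hs hsp x hx => ?_) (fun s hs => heat_weak hG hb h0 hS ht hs) ht hpos
  · unfold IsClass; fun_prop
  · unfold IsClass; fun_prop
  · have hx := subset_closure hx
    refine HasDerivAt.fun_add ?_ (HasDerivAt.fun_sum fun j _ => ?_)
    · exact ((hU.theta.of_le (by norm_num)).hasDerivAt hs hsp hx).const_mul _
    · exact (((d4 j).of_le (by norm_num)).hasDerivAt hs hsp hx).const_mul _

end weak_forms

end Thermopiezo
end

noncomputable section
namespace Thermopiezo
open Set Filter Topology Metric MeasureTheory
open scoped ContDiff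

/-! ### The energy -/

/-- The density whose integral is the total energy: kinetic energy, enthalpy and thermal terms. -/
def energyDensity (B : Set E3) (t0 : EReal) (m : Material) (U : State) : Field := fun t x =>
  m.rho / 2 * (∑ i, dt t0 (U.u i) t x * dt t0 (U.u i) t x)
    + strainEnergy m (fun i j => strain B U i j t x)
    + gradEnergy m (fun i j k => kappa B U i j k t x)
    + couplingEnergy m (fun i j => strain B U i j t x) (fun i j k => kappa B U i j k t x)
        (fun i => elField B U i t x) (fun i j => elGrad B U i j t x) (thermal t0 m U t x)
    + m.gamma / 2 * (dt t0 U.theta t x * dt t0 U.theta t x)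
    + m.alpha66 / 2 * (∑ j, dx B U.theta j t x * dx B U.theta j t x)
    + m.rho * (entropy B t0 m U t x * thermal t0 m U t x)

/-- The time derivative of the energy density. -/
def energyRate (B : Set E3) (t0 : EReal) (m : Material) (U : State) : Field := fun t x =>
  ((∑ i, m.rho * dt t0 (dt t0 (U.u i)) t x * dt t0 (U.u i) t x)
      + (∑ i, ∑ j, tau B t0 m U i j t x * dt t0 (strain B U i j) t x)
      + ∑ i, ∑ j, ∑ k, hyper B m U i j k t x * dt t0 (kappa B U i j k) t x)
    - ((∑ j, sigma B m U j t x * dt t0 (elField B U j) t x)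
      + ∑ j, ∑ k, quad B t0 m U j k t x * dt t0 (elGrad B U j k) t x)
    + m.rho * dt t0 (entropy B t0 m U) t x * thermal t0 m U t x
    - m.gamma / m.beta * (dt t0 U.theta t x * dt t0 U.theta t x)
    + m.alpha66 * (∑ j, dx B U.theta j t x * dt t0 (dx B U.theta j) t x)

section energy

variable {B : Set E3} {G : E3 → ℝ} (hG : IsDefiningFunction B G) (hb : Bornology.IsBounded B)
  {t0 : EReal} (h0 : 0 < t0) {m : Material} {S : BoundaryParts B} {U : State} {t : ℝ} {x : E3}

include hG h0

theorem isClass_energyDensity (hU : U.IsRegular B t0) :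
    IsClass B t0 0 (energyDensity B t0 m U) := by
  have hB := hG.uniqueDiffOn_closure
  have c1 : ∀ i, ContDiffOn ℝ 0 (fun p : ℝ × E3 => dt t0 (U.u i) p.1 p.2)
      (timeInterval t0 ×ˢ closure B) := fun i => (hU.u i).dt h0 hB (by norm_num)
  have c2 : ∀ i j, ContDiffOn ℝ 0 (fun p : ℝ × E3 => strain B U i j p.1 p.2)
      (timeInterval t0 ×ˢ closure B) := fun i j => (hU.strain h0 hB i j).of_le (by norm_num)
  have c3 : ∀ i j k, ContDiffOn ℝ 0 (fun p : ℝ × E3 => kappa B U i j k p.1 p.2)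
      (timeInterval t0 ×ˢ closure B) := fun i j k => (hU.kappa h0 hB i j k).of_le (by norm_num)
  have c4 : ∀ i, ContDiffOn ℝ 0 (fun p : ℝ × E3 => elField B U i p.1 p.2)
      (timeInterval t0 ×ˢ closure B) := fun i => (hU.elField h0 hB i).of_le (by norm_num)
  have c5 : ∀ i j, ContDiffOn ℝ 0 (fun p : ℝ × E3 => elGrad B U i j p.1 p.2)
      (timeInterval t0 ×ˢ closure B) := fun i j => (hU.elGrad h0 hB i j).of_le (by norm_num)
  have c6 : ContDiffOn ℝ 0 (fun p : ℝ × E3 => thermal t0 m U p.1 p.2)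
      (timeInterval t0 ×ˢ closure B) := (hU.thermal h0 hB m).of_le (by norm_num)
  have c7 : ContDiffOn ℝ 0 (fun p : ℝ × E3 => dt t0 U.theta p.1 p.2)
      (timeInterval t0 ×ˢ closure B) := (hU.dt_theta h0 hB).of_le (by norm_num)
  have c8 : ∀ j, ContDiffOn ℝ 0 (fun p : ℝ × E3 => dx B U.theta j p.1 p.2)
      (timeInterval t0 ×ˢ closure B) := fun j => hU.theta.dx h0 hB (by norm_num) j
  have c9 : ContDiffOn ℝ 0 (fun p : ℝ × E3 => entropy B t0 m U p.1 p.2)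
      (timeInterval t0 ×ˢ closure B) := (hU.entropy h0 hB m).of_le (by norm_num)
  unfold IsClass energyDensity strainEnergy gradEnergy couplingEnergy
  fun_prop

/-- The three power balances as fields. -/
theorem isClass_powers (hU : U.IsRegular B t0) :
    IsClass B t0 0 (fun t x => (∑ i, m.rho * dt t0 (dt t0 (U.u i)) t x * dt t0 (U.u i) t x)
      + (∑ i, ∑ j, tau B t0 m U i j t x * dt t0 (strain B U i j) t x)
      + ∑ i, ∑ j, ∑ k, hyper B m U i j k t x * dt t0 (kappa B U i j k) t x) ∧
    IsClass B t0 0 (fun t x => (∑ j, sigma B m U j t x * dt t0 (elField B U j) t x)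
      + ∑ j, ∑ k, quad B t0 m U j k t x * dt t0 (elGrad B U j k) t x) ∧
    IsClass B t0 0 (fun t x => -(m.rho * m.T0 * dt t0 (entropy B t0 m U) t x) * U.theta t x
      + ∑ j, heatFlux B m U j t x * dx B U.theta j t x) ∧
    IsClass B t0 0 (fun t x => -(m.rho * m.T0 * dt t0 (entropy B t0 m U) t x) * dt t0 U.theta t x
      + ∑ j, heatFlux B m U j t x * dt t0 (dx B U.theta j) t x) ∧
    IsClass B t0 0 (fun t x => m.gamma / m.beta * (dt t0 U.theta t x * dt t0 U.theta t x)
      + m.alpha66 / m.beta * ∑ j, dx B U.theta j t x * dx B U.theta j t x) := by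
  have hB := hG.uniqueDiffOn_closure
  have d1 : ∀ i, IsClass B t0 3 (dt t0 (U.u i)) := fun i => (hU.u i).dt h0 hB (by norm_num)
  have d2 : ∀ j, IsClass B t0 2 (dx B U.theta j) := fun j => hU.theta.dx h0 hB (by norm_num) j
  have c1 : ∀ i, ContDiffOn ℝ 0 (fun p : ℝ × E3 => dt t0 (U.u i) p.1 p.2)
      (timeInterval t0 ×ˢ closure B) := fun i => (d1 i).of_le (by norm_num)
  have c1' : ∀ i, ContDiffOn ℝ 0 (fun p : ℝ × E3 => dt t0 (dt t0 (U.u i)) p.1 p.2)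
      (timeInterval t0 ×ˢ closure B) := fun i => (d1 i).dt h0 hB (by norm_num)
  have c2 : ∀ i j, ContDiffOn ℝ 0 (fun p : ℝ × E3 => dt t0 (strain B U i j) p.1 p.2)
      (timeInterval t0 ×ˢ closure B) := fun i j => (hU.strain h0 hB i j).dt h0 hB (by norm_num)
  have c3 : ∀ i j k, ContDiffOn ℝ 0 (fun p : ℝ × E3 => dt t0 (kappa B U i j k) p.1 p.2)
      (timeInterval t0 ×ˢ closure B) := fun i j k => (hU.kappa h0 hB i j k).dt h0 hB (by norm_num)
  have c4 : ∀ i, ContDiffOn ℝ 0 (fun p : ℝ × E3 => dt t0 (elField B U i) p.1 p.2)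
      (timeInterval t0 ×ˢ closure B) := fun i => (hU.elField h0 hB i).dt h0 hB (by norm_num)
  have c5 : ∀ i j, ContDiffOn ℝ 0 (fun p : ℝ × E3 => dt t0 (elGrad B U i j) p.1 p.2)
      (timeInterval t0 ×ˢ closure B) := fun i j => (hU.elGrad h0 hB i j).dt h0 hB (by norm_num)
  have c6 : ∀ i j, ContDiffOn ℝ 0 (fun p : ℝ × E3 => tau B t0 m U i j p.1 p.2)
      (timeInterval t0 ×ˢ closure B) := fun i j => (hU.tau h0 hB m i j).of_le (by norm_num)
  have c7 : ContDiffOn ℝ 0 (fun p : ℝ × E3 => dt t0 U.theta p.1 p.2)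
      (timeInterval t0 ×ˢ closure B) := (hU.dt_theta h0 hB).of_le (by norm_num)
  have c8 : ∀ j, ContDiffOn ℝ 0 (fun p : ℝ × E3 => dx B U.theta j p.1 p.2)
      (timeInterval t0 ×ˢ closure B) := fun j => (d2 j).of_le (by norm_num)
  have c8' : ∀ j, ContDiffOn ℝ 0 (fun p : ℝ × E3 => dt t0 (dx B U.theta j) p.1 p.2)
      (timeInterval t0 ×ˢ closure B) := fun j => (d2 j).dt h0 hB (by norm_num)
  have c9 : ContDiffOn ℝ 0 (fun p : ℝ × E3 => dt t0 (entropy B t0 m U) p.1 p.2)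
      (timeInterval t0 ×ˢ closure B) := (hU.entropy h0 hB m).dt h0 hB (by norm_num)
  have c10 : ∀ i j k, ContDiffOn ℝ 0 (fun p : ℝ × E3 => hyper B m U i j k p.1 p.2)
      (timeInterval t0 ×ˢ closure B) := fun i j k => (hU.hyper h0 hB m i j k).of_le (by norm_num)
  have c11 : ∀ i, ContDiffOn ℝ 0 (fun p : ℝ × E3 => sigma B m U i p.1 p.2)
      (timeInterval t0 ×ˢ closure B) := fun i => (hU.sigma h0 hB m i).of_le (by norm_num)
  have c12 : ∀ i j, ContDiffOn ℝ 0 (fun p : ℝ × E3 => quad B t0 m U i j p.1 p.2)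
      (timeInterval t0 ×ˢ closure B) := fun i j => (hU.quad h0 hB m i j).of_le (by norm_num)
  have c13 : ∀ i, ContDiffOn ℝ 0 (fun p : ℝ × E3 => heatFlux B m U i p.1 p.2)
      (timeInterval t0 ×ˢ closure B) := fun i => (hU.heatFlux h0 hB m i).of_le (by norm_num)
  have c14 : ContDiffOn ℝ 0 (fun p : ℝ × E3 => U.theta p.1 p.2)
      (timeInterval t0 ×ˢ closure B) := hU.theta.of_le (by norm_num)
  unfold IsClass
  refine ⟨?_, ?_, ?_, ?_, ?_⟩ <;> fun_prop

omit hG h0 in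
/-- The energy rate in terms of the power balances and the dissipation. -/
theorem energyRate_eq (hT0 : 0 < m.T0) (hbeta : 0 < m.beta) : energyRate B t0 m U t x =
    ((∑ i, m.rho * dt t0 (dt t0 (U.u i)) t x * dt t0 (U.u i) t x)
      + (∑ i, ∑ j, tau B t0 m U i j t x * dt t0 (strain B U i j) t x)
      + ∑ i, ∑ j, ∑ k, hyper B m U i j k t x * dt t0 (kappa B U i j k) t x)
    - ((∑ j, sigma B m U j t x * dt t0 (elField B U j) t x)
      + ∑ j, ∑ k, quad B t0 m U j k t x * dt t0 (elGrad B U j k) t x)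
    - 1 / m.T0 * (-(m.rho * m.T0 * dt t0 (entropy B t0 m U) t x) * U.theta t x
      + ∑ j, heatFlux B m U j t x * dx B U.theta j t x)
    - m.beta / m.T0 * (-(m.rho * m.T0 * dt t0 (entropy B t0 m U) t x) * dt t0 U.theta t x
      + ∑ j, heatFlux B m U j t x * dt t0 (dx B U.theta j) t x)
    - (m.gamma / m.beta * (dt t0 U.theta t x * dt t0 U.theta t x)
      + m.alpha66 / m.beta * ∑ j, dx B U.theta j t x * dx B U.theta j t x) := by
  unfold energyRate
  generalize ((∑ i, m.rho * dt t0 (dt t0 (U.u i)) t x * dt t0 (U.u i) t x)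
      + (∑ i, ∑ j, tau B t0 m U i j t x * dt t0 (strain B U i j) t x)
      + ∑ i, ∑ j, ∑ k, hyper B m U i j k t x * dt t0 (kappa B U i j k) t x) = P
  generalize ((∑ j, sigma B m U j t x * dt t0 (elField B U j) t x)
      + ∑ j, ∑ k, quad B t0 m U j k t x * dt t0 (elGrad B U j k) t x) = Q
  -- The weights `1/T_0` and `β/T_0` combine the tests with `θ` and `θ̇` into the test with `ϑ`. By
  -- Fourier's law, the flux terms give the rate of `α^(66) |∇θ|²/2` plus the conductive
  -- dissipation.
  simp only [heatFlux, thermal, Fin.sum_univ_three]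
  generalize dt t0 (entropy B t0 m U) t x = a
  field_simp
  ring

theorem isClass_energyRate (hU : U.IsRegular B t0) (hT0 : 0 < m.T0) (hbeta : 0 < m.beta) :
    IsClass B t0 0 (energyRate B t0 m U) := by
  obtain ⟨d1, d2, d3, d4, d5⟩ := isClass_powers hG h0 (m := m) hU
  refine IsClass.congr ?_ (fun t _ x _ => energyRate_eq hT0 hbeta)
  unfold IsClass at *
  exact (((d1.sub d2).sub (contDiffOn_const.mul d3)).sub (contDiffOn_const.mul d4)).sub d5

/-- In the derivative of `ρ η ϑ` the term `ρ η ϑ̇` cancels the thermal part of the potential, except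
for `-(γ/β) θ̇ ϑ̇`. Since `ϑ̇ = θ̇ + β θ̈`, the derivative of `γ θ̇²/2` absorbs its second half and
leaves the dissipation `-(γ/β) θ̇²`. -/
theorem hasDerivAt_energyDensity (hU : U.IsRegular B t0) (hbeta : 0 < m.beta) (hrho : 0 < m.rho)
    (hα : m.alpha4 = 0) (ht : t ∈ timeInterval t0) (hpos : 0 < t) (hx : x ∈ B) :
    HasDerivAt (fun s => energyDensity B t0 m U s x) (energyRate B t0 m U t x) t := by
  have hB := hG.uniqueDiffOn_closure
  have hxc := subset_closure hx
  have d1 : ∀ i, HasDerivAt (fun s => dt t0 (U.u i) s x) (dt t0 (dt t0 (U.u i)) t x) t := fun i =>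
    ((hU.u i).dt (m := 1) h0 hB (by norm_num)).hasDerivAt ht hpos hxc
  have d2 : ∀ i j, HasDerivAt (fun s => strain B U i j s x) (dt t0 (strain B U i j) t x) t :=
    fun i j => ((hU.strain h0 hB i j).of_le (by norm_num)).hasDerivAt ht hpos hxc
  have d3 : ∀ i j k, HasDerivAt (fun s => kappa B U i j k s x) (dt t0 (kappa B U i j k) t x) t :=
    fun i j k => ((hU.kappa h0 hB i j k).of_le (by norm_num)).hasDerivAt ht hpos hxc
  have d4 : ∀ i, HasDerivAt (fun s => elField B U i s x) (dt t0 (elField B U i) t x) t :=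
    fun i => ((hU.elField h0 hB i).of_le (by norm_num)).hasDerivAt ht hpos hxc
  have d5 : ∀ i j, HasDerivAt (fun s => elGrad B U i j s x) (dt t0 (elGrad B U i j) t x) t :=
    fun i j => ((hU.elGrad h0 hB i j).of_le (by norm_num)).hasDerivAt ht hpos hxc
  have d6 : HasDerivAt (fun s => U.theta s x) (dt t0 U.theta t x) t :=
    (hU.theta.of_le (by norm_num)).hasDerivAt ht hpos hxc
  have d7 : HasDerivAt (fun s => dt t0 U.theta s x) (dt t0 (dt t0 U.theta) t x) t :=
    ((hU.dt_theta h0 hB).of_le (by norm_num)).hasDerivAt ht hpos hxc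
  have d8 : HasDerivAt (fun s => thermal t0 m U s x)
      (dt t0 U.theta t x + m.beta * dt t0 (dt t0 U.theta) t x) t := d6.add (d7.const_mul m.beta)
  have d9 : ∀ j, HasDerivAt (fun s => dx B U.theta j s x) (dt t0 (dx B U.theta j) t x) t := fun j =>
    (hU.theta.dx (m := 1) h0 hB (by norm_num) j).hasDerivAt ht hpos hxc
  have d10 : HasDerivAt (fun s => entropy B t0 m U s x) (dt t0 (entropy B t0 m U) t x) t :=
    ((hU.entropy h0 hB m).of_le (by norm_num)).hasDerivAt ht hpos hxc
  have hs := fun i j k => hU.kappa_symm hG ht hx i j k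
  have hs' := fun i j k => hU.dt_kappa_symm hG ht hx i j k
  have e1 : HasDerivAt (fun s => ∑ i, dt t0 (U.u i) s x * dt t0 (U.u i) s x) _ t :=
    HasDerivAt.fun_sum fun i _ => (d1 i).mul (d1 i)
  have e2 := hasDerivAt_strainEnergy (m := m) d2
  have e3 := hasDerivAt_gradEnergy (m := m) d3 hs hs'
  have e4 := hasDerivAt_couplingEnergy (m := m) d2 d3 hs' d4 d5 d8
  have e5 : HasDerivAt (fun s => ∑ j, dx B U.theta j s x * dx B U.theta j s x) _ t :=
    HasDerivAt.fun_sum fun i _ => (d9 i).mul (d9 i)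
  refine (((((((e1.const_mul (m.rho / 2)).add e2).add e3).add e4).add
    ((d7.mul d7).const_mul (m.gamma / 2))).add (e5.const_mul (m.alpha66 / 2))).add
    ((d10.mul d8).const_mul m.rho)).congr_deriv ?_
  have htau : ∑ i, ∑ j, tau B t0 m U i j t x * dt t0 (strain B U i j) t x
      = (∑ i, ∑ j, (m.lam * (∑ k, strain B U k k t x) * kron i j + 2 * m.mu * strain B U i j t x)
          * dt t0 (strain B U i j) t x)
        + ∑ i, ∑ j, (m.alpha14 * kron i j * thermal t0 m U t x
          + m.lamStar * (∑ k, elGrad B U k k t x) * kron i j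
          + 2 * m.muStar * elGrad B U i j t x) * dt t0 (strain B U i j) t x := by
    simp only [← Finset.sum_add_distrib]
    refine Finset.sum_congr rfl fun i _ => Finset.sum_congr rfl fun j _ => ?_
    unfold tau; ring
  have hhyper : ∑ i, ∑ j, ∑ k, hyper B m U i j k t x * dt t0 (kappa B U i j k) t x
      = (∑ i, ∑ j, ∑ k, (m.gamma1 * ((∑ h, kappa B U h h i t x) * kron j k
            + 2 * (∑ h, kappa B U k h h t x) * kron i j + (∑ h, kappa B U h h j t x) * kron i k)
          + 2 * m.gamma2 * ((∑ h, kappa B U i h h t x) * kron j k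
            + (∑ h, kappa B U j h h t x) * kron i k)
          + m.gamma3 * (∑ h, kappa B U h h k t x) * kron i j
          + 2 * m.gamma4 * kappa B U i j k t x
          + 2 * m.gamma5 * (kappa B U k j i t x + kappa B U k i j t x))
          * dt t0 (kappa B U i j k) t x)
        + ∑ i, ∑ j, ∑ k, (m.alpha0 * kron i j * elField B U k t x
          + m.beta0 * (kron i k * elField B U j t x + kron j k * elField B U i t x))
          * dt t0 (kappa B U i j k) t x := by
    simp only [← Finset.sum_add_distrib]
    refine Finset.sum_congr rfl fun i _ => Finset.sum_congr rfl fun j _ =>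
      Finset.sum_congr rfl fun k _ => ?_
    unfold hyper; ring
  have hsigma : ∑ j, sigma B m U j t x * dt t0 (elField B U j) t x
      = -∑ i, (m.alpha0 * (∑ k, kappa B U k k i t x) + 2 * m.beta0 * (∑ k, kappa B U i k k t x)
          + m.alpha33 * elField B U i t x) * dt t0 (elField B U i) t x := by
    rw [← Finset.sum_neg_distrib]
    refine Finset.sum_congr rfl fun i _ => ?_
    unfold sigma; ring
  have hquad : ∑ j, ∑ k, quad B t0 m U j k t x * dt t0 (elGrad B U j k) t x
      = -∑ i, ∑ j, (m.lamStar * (∑ k, strain B U k k t x) * kron i j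
          + 2 * m.muStar * strain B U i j t x + m.alpha47 * kron i j * thermal t0 m U t x
          + m.lamTilde * (∑ k, elGrad B U k k t x) * kron i j
          + 2 * m.muTilde * elGrad B U i j t x) * dt t0 (elGrad B U i j) t x := by
    simp only [← Finset.sum_neg_distrib]
    refine Finset.sum_congr rfl fun i _ => Finset.sum_congr rfl fun j _ => ?_
    unfold quad; ring
  have hent : m.rho * entropy B t0 m U t x = -(m.alpha14 * (∑ k, strain B U k k t x)
      + m.a44 * thermal t0 m U t x + m.alpha47 * (∑ k, elGrad B U k k t x))
      - m.gamma / m.beta * dt t0 U.theta t x := by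
    unfold entropy
    rw [hα]
    field_simp
    ring
  have hu : ∑ i, m.rho * dt t0 (dt t0 (U.u i)) t x * dt t0 (U.u i) t x
      = m.rho / 2 * ∑ i, (dt t0 (dt t0 (U.u i)) t x * dt t0 (U.u i) t x
        + dt t0 (U.u i) t x * dt t0 (dt t0 (U.u i)) t x) := by
    rw [Finset.mul_sum]
    exact Finset.sum_congr rfl fun i _ => by ring
  have hq : m.alpha66 * (∑ j, dx B U.theta j t x * dt t0 (dx B U.theta j) t x)
      = m.alpha66 / 2 * ∑ j, (dt t0 (dx B U.theta j) t x * dx B U.theta j t x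
        + dx B U.theta j t x * dt t0 (dx B U.theta j) t x) := by
    rw [Finset.mul_sum, Finset.mul_sum]
    exact Finset.sum_congr rfl fun i _ => by ring
  have hgb : m.gamma / m.beta * m.beta = m.gamma := div_mul_cancel₀ _ hbeta.ne'
  unfold energyRate
  rw [htau, hhyper, hsigma, hquad, hu, hq]
  linear_combination (dt t0 U.theta t x + m.beta * dt t0 (dt t0 U.theta) t x) * hent
    - dt t0 U.theta t x * dt t0 (dt t0 U.theta) t x * hgb

omit hG h0 in
/-- The energy density, up to electric power, is a sum of nonnegative forms. -/
theorem energyDensity_eq (hbeta : 0 < m.beta) (hrho : 0 < m.rho) (hα : m.alpha4 = 0) :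
    energyDensity B t0 m U t x + ((∑ j, sigma B m U j t x * elField B U j t x)
      + ∑ j, ∑ k, quad B t0 m U j k t x * elGrad B U j k t x)
    = m.rho / 2 * (∑ i, dt t0 (U.u i) t x * dt t0 (U.u i) t x)
      + strainEnergy m (fun i j => strain B U i j t x)
      + gradEnergy m (fun i j k => kappa B U i j k t x)
      + 1 / 2 * (-m.alpha33 * (∑ i, elField B U i t x * elField B U i t x)
        - m.lamTilde * ((∑ k, elGrad B U k k t x) * ∑ k, elGrad B U k k t x)
        - 2 * m.muTilde * (∑ i, ∑ j, elGrad B U i j t x * elGrad B U i j t x)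
        - 2 * m.alpha47 * (thermal t0 m U t x * ∑ k, elGrad B U k k t x)
        - (m.a44 + m.gamma / m.beta ^ 2) * (thermal t0 m U t x * thermal t0 m U t x))
      + m.gamma / m.beta ^ 2 / 2 * (U.theta t x * U.theta t x)
      + m.alpha66 / 2 * (∑ j, dx B U.theta j t x * dx B U.theta j t x) := by
  have hent : m.rho * entropy B t0 m U t x = -(m.alpha14 * (∑ k, strain B U k k t x)
      + m.a44 * thermal t0 m U t x + m.alpha47 * (∑ k, elGrad B U k k t x))
      - m.gamma / m.beta * dt t0 U.theta t x := by
    unfold entropy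
    rw [hα]
    field_simp
    ring
  -- Substituting `β θ̇ = ϑ - θ` diagonalizes this form in `θ` and `ϑ`. The coefficient `a^(44) +
  -- γ/β²` of the hypotheses arises here.
  have hth : m.gamma / 2 * (dt t0 U.theta t x * dt t0 U.theta t x)
      - m.gamma / m.beta * dt t0 U.theta t x * thermal t0 m U t x
      = -(m.gamma / m.beta ^ 2) / 2 * (thermal t0 m U t x * thermal t0 m U t x)
        + m.gamma / m.beta ^ 2 / 2 * (U.theta t x * U.theta t x) := by
    unfold thermal
    field_simp
    ring
  -- The electric work contains each mechanical-electric coupling of the potential with the opposite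
  -- sign, and the purely electric terms with twice the opposite weight. Adding it cancels the
  -- former and reverses the sign of the latter.
  have hsq : (∑ j, sigma B m U j t x * elField B U j t x)
      + (∑ j, ∑ k, quad B t0 m U j k t x * elGrad B U j k t x)
      = -(m.alpha0 * (∑ i, (∑ k, kappa B U k k i t x) * elField B U i t x)
        + 2 * m.beta0 * (∑ i, (∑ k, kappa B U i k k t x) * elField B U i t x)
        + m.alpha33 * (∑ i, elField B U i t x * elField B U i t x)
        + m.lamStar * ((∑ k, strain B U k k t x) * ∑ k, elGrad B U k k t x)
        + 2 * m.muStar * (∑ i, ∑ j, strain B U i j t x * elGrad B U i j t x)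
        + m.alpha47 * (thermal t0 m U t x * ∑ k, elGrad B U k k t x)
        + m.lamTilde * ((∑ k, elGrad B U k k t x) * ∑ k, elGrad B U k k t x)
        + 2 * m.muTilde * (∑ i, ∑ j, elGrad B U i j t x * elGrad B U i j t x)) := by
    simp only [sigma, quad, Fin.sum_univ_three]
    simp [kron]
    ring
  rw [hsq]
  unfold energyDensity couplingEnergy
  linear_combination thermal t0 m U t x * hent + hth

end energy

end Thermopiezo
end

noncomputable section
namespace Thermopiezo
open Set Filter Topology Metric MeasureTheory
open scoped ContDiff

/-! ### Solutions with vanishing data -/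

/-- The work of the electric field. -/
def electricWork (B : Set E3) (t0 : EReal) (m : Material) (U : State) : Field := fun t x =>
  (∑ j, sigma B m U j t x * elField B U j t x)
    + ∑ j, ∑ k, quad B t0 m U j k t x * elGrad B U j k t x

theorem eq_zero_of_pd_eq_zero {B : Set E3} (hB : IsOpen B) (hc : IsPreconnected B) {f : E3 → ℝ}
    (hf : ContDiffOn ℝ 1 f (closure B)) (hd : ∀ j, ∀ x ∈ B, pd B f j x = 0) {y : E3}
    (hy : y ∈ closure B) (hfy : f y = 0) : ∀ x ∈ closure B, f x = 0 := by
  obtain ⟨a, ha⟩ := hB.exists_is_const_of_fderiv_eq_zero hc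
    ((hf.differentiableOn one_ne_zero).mono subset_closure) (fun x hx => by
      refine ContinuousLinearMap.coe_injective
        ((EuclideanSpace.basisFun (Fin 3) ℝ).toBasis.ext fun j => ?_)
      simpa [pd_eq_fderiv hB f j hx] using hd j x hx)
  have h1 : EqOn f (fun _ => a) (closure B) :=
    EqOn.of_subset_closure ha hf.continuousOn continuousOn_const subset_closure subset_rfl
  intro x hx
  rw [h1 hx, ← hfy, h1 hy]

theorem eq_zero_on_closure {B : Set E3} {f : E3 → ℝ} (hf : ContinuousOn f (closure B))
    (h : ∀ x ∈ B, f x = 0) : ∀ x ∈ closure B, f x = 0 :=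
  EqOn.of_subset_closure (g := fun _ => 0) h hf continuousOn_const subset_closure subset_rfl

/-- A field with vanishing initial value whose square does not increase vanishes. -/
theorem eq_zero_of_mul_dt_nonpos {B : Set E3} {t0 : EReal} (h0 : 0 < t0) {f : Field}
    (hf : IsClass B t0 1 f) {x : E3} (hx : x ∈ closure B) (hi : f 0 x = 0)
    (h : ∀ t ∈ timeInterval t0, f t x * dt t0 f t x ≤ 0) : ∀ t ∈ timeInterval t0, f t x = 0 := by
  have hc := hf.continuousOn_time hx
  intro t ht
  have h1 : f t x * f t x ≤ f 0 x * f 0 x := le_initial_of_deriv_nonpos h0 (hc.mul hc)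
    (fun t ht hpos => (hf.hasDerivAt ht hpos hx).mul (hf.hasDerivAt ht hpos hx))
    (fun t ht _ => by linarith [h t ht]) t ht
  rw [hi, mul_zero] at h1
  exact mul_self_eq_zero.1 (le_antisymm h1 (mul_self_nonneg _))

theorem integral_linear_combination {B : Set E3} {f₁ f₂ f₃ f₄ f₅ : E3 → ℝ} {a b : ℝ}
    (h₁ : IntegrableOn f₁ B) (h₂ : IntegrableOn f₂ B) (h₃ : IntegrableOn f₃ B)
    (h₄ : IntegrableOn f₄ B) (h₅ : IntegrableOn f₅ B) :
    ∫ x in B, (f₁ x - f₂ x - a * f₃ x - b * f₄ x - f₅ x)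
      = (∫ x in B, f₁ x) - (∫ x in B, f₂ x) - a * (∫ x in B, f₃ x) - b * (∫ x in B, f₄ x)
        - ∫ x in B, f₅ x := by
  have h₁₂ : IntegrableOn (fun x => f₁ x - f₂ x) B := h₁.sub h₂
  have h₁₃ : IntegrableOn (fun x => f₁ x - f₂ x - a * f₃ x) B := h₁₂.sub (h₃.const_mul a)
  have h₁₄ : IntegrableOn (fun x => f₁ x - f₂ x - a * f₃ x - b * f₄ x) B :=
    h₁₃.sub (h₄.const_mul b)
  rw [integral_sub h₁₄ h₅, integral_sub h₁₃ (h₄.const_mul b), integral_sub h₁₂ (h₃.const_mul a),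
    integral_sub h₁ h₂, integral_const_mul, integral_const_mul]

section uniqueness

variable {B : Set E3} {G : E3 → ℝ} (hG : IsDefiningFunction B G) (hb : Bornology.IsBounded B)
  {t0 : EReal} (h0 : 0 < t0) {m : Material} {S : BoundaryParts B} {U : State}
  (hS : IsSolution B t0 m S ExternalData.zero U) {t : ℝ} {x : E3}

include hG h0

theorem isClass_electricWork (hU : U.IsRegular B t0) : IsClass B t0 0 (electricWork B t0 m U) := by
  have hB := hG.uniqueDiffOn_closure
  have c4 : ∀ i, ContDiffOn ℝ 0 (fun p : ℝ × E3 => elField B U i p.1 p.2)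
      (timeInterval t0 ×ˢ closure B) := fun i => (hU.elField h0 hB i).of_le (by norm_num)
  have c5 : ∀ i j, ContDiffOn ℝ 0 (fun p : ℝ × E3 => elGrad B U i j p.1 p.2)
      (timeInterval t0 ×ˢ closure B) := fun i j => (hU.elGrad h0 hB i j).of_le (by norm_num)
  have c11 : ∀ i, ContDiffOn ℝ 0 (fun p : ℝ × E3 => sigma B m U i p.1 p.2)
      (timeInterval t0 ×ˢ closure B) := fun i => (hU.sigma h0 hB m i).of_le (by norm_num)
  have c12 : ∀ i j, ContDiffOn ℝ 0 (fun p : ℝ × E3 => quad B t0 m U i j p.1 p.2)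
      (timeInterval t0 ×ˢ closure B) := fun i j => (hU.quad h0 hB m i j).of_le (by norm_num)
  unfold IsClass electricWork
  fun_prop

include hb hS

/-- The electric work integrates to zero by `electric_weak` at equal times, so it may be added to
make the density a sum of nonnegative forms. -/
theorem integral_energyDensity_add_electricWork (ht : t ∈ timeInterval t0) :
    ∫ x in B, (energyDensity B t0 m U t x + electricWork B t0 m U t x)
      = ∫ x in B, energyDensity B t0 m U t x := by
  have hU := hS.isRegular
  rw [integral_add ((isClass_energyDensity hG h0 hU).integrableOn hb ht)
    ((isClass_electricWork hG h0 hU).integrableOn hb ht)]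
  have := electric_weak hG hb h0 hS ht ht
  unfold electricWork
  rw [this, add_zero]

/-- All power balances integrate to zero, so only the thermal dissipation survives. -/
theorem integral_energyRate_nonpos (hT0 : 0 < m.T0) (hbeta : 0 < m.beta) (hgamma : 0 ≤ m.gamma)
    (h66 : 0 ≤ m.alpha66) (ht : t ∈ timeInterval t0) (hpos : 0 < t) :
    ∫ x in B, energyRate B t0 m U t x ≤ 0 := by
  have hU := hS.isRegular
  obtain ⟨c1, c2, c3, c4, c5⟩ := isClass_powers hG h0 (m := m) hU
  simp only [energyRate_eq hT0 hbeta]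
  rw [integral_linear_combination (c1.integrableOn hb ht) (c2.integrableOn hb ht)
    (c3.integrableOn hb ht) (c4.integrableOn hb ht) (c5.integrableOn hb ht),
    motion_power hG hb h0 hS ht hpos, electric_power hG hb h0 hS ht hpos,
    heat_weak hG hb h0 hS ht ht, heat_power hG hb h0 hS ht hpos]
  have h5 : 0 ≤ ∫ x in B, (m.gamma / m.beta * (dt t0 U.theta t x * dt t0 U.theta t x)
      + m.alpha66 / m.beta * ∑ j, dx B U.theta j t x * dx B U.theta j t x) :=
    integral_nonneg fun x => add_nonneg
      (mul_nonneg (div_nonneg hgamma hbeta.le) (mul_self_nonneg _))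
      (mul_nonneg (div_nonneg h66 hbeta.le) (sum_mul_self_nonneg _))
  simpa using h5

theorem integral_energyDensity_le (hT0 : 0 < m.T0) (hbeta : 0 < m.beta) (hrho : 0 < m.rho)
    (hgamma : 0 ≤ m.gamma) (h66 : 0 ≤ m.alpha66) (hα : m.alpha4 = 0)
    (ht : t ∈ timeInterval t0) :
    ∫ x in B, energyDensity B t0 m U t x ≤ ∫ x in B, energyDensity B t0 m U 0 x := by
  have hU := hS.isRegular
  have c := isClass_energyDensity hG h0 (m := m) hU
  exact le_initial_of_deriv_nonpos h0 (c.continuousOn_integral hG.isOpen hb)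
    (fun t ht hpos => c.hasDerivAt_integral hG.isOpen hb (isClass_energyRate hG h0 hU hT0 hbeta)
      (fun s hs hspos x hx => hasDerivAt_energyDensity hG h0 hU hbeta hrho hα hs hspos hx) ht hpos)
    (fun t ht hpos => integral_energyRate_nonpos hG hb h0 hS hT0 hbeta hgamma h66 ht hpos) t ht

/-- The initial energy vanishes. -/
theorem integral_energyDensity_zero (hbeta : 0 < m.beta) (hrho : 0 < m.rho) (hα : m.alpha4 = 0)
    (hmuT : m.muTilde < 0) (h33 : m.alpha33 < 0) (h44 : m.a44 + m.gamma / m.beta ^ 2 < 0)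
    (h47 : 3 * m.alpha47 ^ 2
      < (3 * m.lamTilde + 2 * m.muTilde) * (m.a44 + m.gamma / m.beta ^ 2)) :
    ∫ x in B, energyDensity B t0 m U 0 x = 0 := by
  have hU := hS.isRegular
  have ht := zero_mem_timeInterval h0
  have hu : ∀ k j, ∀ x ∈ closure B, dx B (U.u k) j 0 x = 0 := fun k j x hx =>
    (pd_congr (H := fun _ => 0) (fun y hy => hS.init_u y hy k) hx j).trans (by simp [pd])
  have hκ : ∀ i j k, ∀ x ∈ closure B, kappa B U i j k 0 x = 0 := fun i j k x hx =>
    (pd_congr (H := fun _ => 0) (fun y hy => hu k i y hy) hx j).trans (by simp [pd])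
  have he : ∀ i j, ∀ x ∈ closure B, strain B U i j 0 x = 0 := fun i j x hx => by
    simp [strain, hu _ _ x hx]
  have hth : ∀ x ∈ closure B, U.theta 0 x = 0 := hS.init_theta
  have hgth : ∀ j, ∀ x ∈ closure B, dx B U.theta j 0 x = 0 := fun j x hx =>
    (pd_congr (H := fun _ => 0) hth hx j).trans (by simp [pd])
  have hv : ∀ i, ∀ x ∈ closure B, dt t0 (U.u i) 0 x = 0 := fun i x hx => hS.init_v x hx i
  -- With `u = 0` and `θ = 0` one has `ϑ = β θ̇`, and the condition `η = 0` becomes a linear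
  -- relation between `ϑ` and `V_kk`. It makes up for the missing initial value of `θ̇`.
  have hη : ∀ x ∈ closure B, (m.a44 + m.gamma / m.beta ^ 2) * thermal t0 m U 0 x
      + m.alpha47 * (∑ k, elGrad B U k k 0 x) = 0 := by
    intro x hx
    have h1 : entropy B t0 m U 0 x = 0 := hS.init_eta x hx
    have h2 : m.rho * entropy B t0 m U 0 x = 0 := by rw [h1, mul_zero]
    simp only [entropy, he _ _ x hx, hα, Finset.sum_const_zero, thermal, hth x hx] at h2
    simp only [thermal, hth x hx]
    field_simp at h2 ⊢
    linear_combination -m.beta * h2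
  have hw : ∀ x ∈ closure B, electricWork B t0 m U 0 x
      = -m.alpha33 * (∑ i, elField B U i 0 x * elField B U i 0 x)
        - m.lamTilde * ((∑ k, elGrad B U k k 0 x) * ∑ k, elGrad B U k k 0 x)
        - 2 * m.muTilde * (∑ i, ∑ j, elGrad B U i j 0 x * elGrad B U i j 0 x)
        - m.alpha47 * (thermal t0 m U 0 x * ∑ k, elGrad B U k k 0 x) := by
    intro x hx
    simp only [electricWork, sigma, quad, Fin.sum_univ_three, hκ _ _ _ x hx, he _ _ x hx]
    simp [kron]
    ring
  have hform := fun x hx => initial_form_nonneg hmuT h33 h44 h47 (fun i => elField B U i 0 x)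
    (fun i j => elGrad B U i j 0 x) (thermal t0 m U 0 x) (hη x hx)
  -- At time zero the electric work is pointwise nonnegative under this relation and has zero
  -- integral, so it vanishes identically; definiteness then kills `E`, `V` and `ϑ`.
  have hw0 := eq_zero_of_integral_nonpos hG.isOpen hb
    ((isClass_electricWork hG h0 (m := m) hU).slice ht).continuousOn
    (fun x hx => by
      rw [hw x (subset_closure hx)]
      exact (hform x (subset_closure hx)).1)
    (electric_weak hG hb h0 hS ht ht).le
  rw [← integral_energyDensity_add_electricWork hG hb h0 hS ht,
    setIntegral_congr_fun (g := fun _ => (0:ℝ)) hG.isOpen.measurableSet fun x hx => ?_]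
  · simp
  have hxc := subset_closure hx
  obtain ⟨hE, hV, htr, htheta⟩ := (hform x hxc).2 (by rw [← hw x hxc]; exact (hw0 x hx).le)
  have h1 := energyDensity_eq (B := B) (t0 := t0) (U := U) (t := 0) (x := x) hbeta hrho hα
  refine h1.trans ?_
  simp only [hv _ x hxc, he _ _ x hxc, hκ _ _ _ x hxc, hE, hV, htr, htheta, hth x hxc,
    hgth _ x hxc]
  simp [strainEnergy, gradEnergy]

/-- With vanishing data, velocity, electric field and thermal variable vanish at all times. -/
theorem rate_fields_eq_zero (hrho : 0 < m.rho) (hT0 : 0 < m.T0) (hbeta : 0 < m.beta)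
    (hα : m.alpha4 = 0) (hgamma : 0 ≤ m.gamma) (h66 : 0 ≤ m.alpha66)
    (hmu : 0 ≤ m.mu) (hlam : 0 ≤ 3 * m.lam + 2 * m.mu)
    (h1 : 0 ≤ m.gamma3 + m.gamma4) (h2 : 0 ≤ m.gamma4 - m.gamma5)
    (h3 : 0 ≤ m.gamma4 + 2 * m.gamma5) (h4 : 0 ≤ 2 * m.gamma2 + m.gamma4 + m.gamma5)
    (h6 : (2 * m.gamma1 - m.gamma4) ^ 2
      ≤ (m.gamma3 + m.gamma4) * (4 * m.gamma2 + 3 * m.gamma4 + 4 * m.gamma5))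
    (h7 : 2 * (m.gamma1 + m.gamma5) ^ 2
      ≤ (m.gamma3 + m.gamma4) * (2 * m.gamma2 + m.gamma4 + m.gamma5))
    (h9 : 0 ≤ (m.gamma4 + 2 * m.gamma5)
      * ((5 * m.gamma3 + 4 * m.gamma4 - 2 * m.gamma5) * (10 * m.gamma2 + 3 * m.gamma4 + m.gamma5)
        - 2 * (5 * m.gamma1 - m.gamma4 + 3 * m.gamma5) ^ 2))
    (hmuT : m.muTilde < 0) (h33 : m.alpha33 < 0) (h44 : m.a44 + m.gamma / m.beta ^ 2 < 0)
    (h47 : 3 * m.alpha47 ^ 2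
      < (3 * m.lamTilde + 2 * m.muTilde) * (m.a44 + m.gamma / m.beta ^ 2))
    (ht : t ∈ timeInterval t0) (hx : x ∈ B) :
    (∀ i, dt t0 (U.u i) t x = 0) ∧ (∀ i, elField B U i t x = 0) ∧ thermal t0 m U t x = 0 := by
  have hU := hS.isRegular
  have key : ∀ y ∈ B, 0 ≤ m.rho / 2 * (∑ i, dt t0 (U.u i) t y * dt t0 (U.u i) t y) ∧
      0 ≤ strainEnergy m (fun i j => strain B U i j t y) ∧
      0 ≤ gradEnergy m (fun i j k => kappa B U i j k t y) ∧
      0 ≤ m.gamma / m.beta ^ 2 / 2 * (U.theta t y * U.theta t y) ∧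
      0 ≤ m.alpha66 / 2 * (∑ j, dx B U.theta j t y * dx B U.theta j t y) := fun y hy =>
    ⟨mul_nonneg (by linarith) (sum_mul_self_nonneg _), strainEnergy_nonneg hmu hlam _,
      gradEnergy_nonneg h1 h2 h3 h4 h6 h7 h9 fun i j k => hU.kappa_symm hG ht hy i j k,
      mul_nonneg (by positivity) (mul_self_nonneg _),
      mul_nonneg (by linarith) (sum_mul_self_nonneg _)⟩
  have hform := fun y => thermoelectric_nonneg hmuT h33 h44 h47 (fun i => elField B U i t y)
    (fun i j => elGrad B U i j t y) (thermal t0 m U t y)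
  have heq : ∀ y, energyDensity B t0 m U t y + electricWork B t0 m U t y = _ := fun y =>
    energyDensity_eq (B := B) (t0 := t0) (U := U) (t := t) (x := y) hbeta hrho hα
  -- The integral is the energy, which started at zero and does not increase. Being the integral of
  -- a nonnegative continuous function, it forces that function to vanish in `B`.
  have hle : ∫ y in B, (energyDensity B t0 m U t y + electricWork B t0 m U t y) ≤ 0 := by
    rw [integral_energyDensity_add_electricWork hG hb h0 hS ht,
      ← integral_energyDensity_zero hG hb h0 hS hbeta hrho hα hmuT h33 h44 h47]
    exact integral_energyDensity_le hG hb h0 hS hT0 hbeta hrho hgamma h66 hα ht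
  have hzero : energyDensity B t0 m U t x + electricWork B t0 m U t x = 0 :=
    eq_zero_of_integral_nonpos hG.isOpen hb
    (f := fun y => energyDensity B t0 m U t y + electricWork B t0 m U t y)
    (((isClass_energyDensity hG h0 (m := m) hU).slice ht).continuousOn.add
      ((isClass_electricWork hG h0 (m := m) hU).slice ht).continuousOn)
    (fun y hy => by
      obtain ⟨k1, k2, k3, k4, k5⟩ := key y hy
      have := (hform y).1
      rw [heq y]
      linarith) hle x hx
  rw [heq x] at hzero
  obtain ⟨k1, k2, k3, k4, k5⟩ := key x hx
  have k6 := (hform x).1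
  obtain ⟨hE, hth⟩ := (hform x).2 (by linarith)
  have hv : m.rho / 2 * (∑ i, dt t0 (U.u i) t x * dt t0 (U.u i) t x) = 0 := by linarith
  exact ⟨eq_zero_of_sum_mul_self ((mul_eq_zero.1 hv).resolve_left (by linarith)), hE, hth⟩

omit hb in
/-- Vanishing velocity, electric field and thermal variable force a solution with vanishing data
to vanish. -/
theorem IsSolution.eq_zero_of_rate_fields (hc : IsPreconnected B) (hS4 : S.S4.Nonempty)
    (hbeta : 0 < m.beta)
    (h : ∀ t ∈ timeInterval t0, ∀ x ∈ B, (∀ i, dt t0 (U.u i) t x = 0) ∧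
      (∀ i, elField B U i t x = 0) ∧ thermal t0 m U t x = 0) :
    ∀ t ∈ timeInterval t0, ∀ x ∈ closure B,
      (∀ i, U.u i t x = 0) ∧ U.theta t x = 0 ∧ U.phi t x = 0 := by
  have hB := hG.uniqueDiffOn_closure
  have hU := hS.isRegular
  intro t ht x hx
  refine ⟨fun i => ?_, ?_, ?_⟩
  · refine eq_zero_of_mul_dt_nonpos h0 ((hU.u i).of_le (by norm_num)) hx
      (hS.init_u x hx i) (fun s hs => ?_) t ht
    have hv : IsClass B t0 0 (dt t0 (U.u i)) := (hU.u i).dt h0 hB (by norm_num)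
    rw [eq_zero_on_closure (hv.slice hs).continuousOn (fun y hy => (h s hs y hy).1 i) x hx,
      mul_zero]
  · refine eq_zero_of_mul_dt_nonpos h0 (hU.theta.of_le (by norm_num)) hx
      (hS.init_theta x hx) (fun s hs => ?_) t ht
    have h1 : U.theta s x + m.beta * dt t0 U.theta s x = 0 :=
      eq_zero_on_closure ((hU.thermal h0 hB m).slice hs).continuousOn
        (fun y hy => (h s hs y hy).2.2) x hx
    -- Since `θ = -β θ̇`, the product `θ θ̇` equals `-β θ̇²`, so `θ²` does not increase from its
    -- initial value zero.
    have h2 : U.theta s x * dt t0 U.theta s x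
        = -(m.beta * (dt t0 U.theta s x * dt t0 U.theta s x)) := by
      linear_combination dt t0 U.theta s x * h1
    rw [h2]
    exact neg_nonpos.2 (mul_nonneg hbeta.le (mul_self_nonneg _))
  · obtain ⟨y, hy⟩ := hS4
    -- The vanishing of `E` leaves a constant, and a point of `S_4` fixes it; connectedness of `B`
    -- makes one point enough.
    exact eq_zero_of_pd_eq_zero hG.isOpen hc ((hU.phi.of_le (by norm_num)).slice ht)
      (fun j z hz => neg_eq_zero.1 ((h t ht z hz).2.1 j))
      (frontier_subset_closure (S.split4.1 hy)) (hS.bdry_phi t ht y hy) x hx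

end uniqueness

end Thermopiezo
end

/-! ### The uniqueness theorem -/

theorem theorem2 (B : Set Thermopiezo.E3) (hBopen : IsOpen B) (hBconn : IsConnected B)
    (hBbdd : Bornology.IsBounded B) (hBsmooth : Thermopiezo.HasC2Boundary B)
    (t0 : EReal) (ht0 : 0 < t0)
    (m : Thermopiezo.Material)
    (hrho : 0 < m.rho) (hT0 : 0 < m.T0) (hbeta : 0 < m.beta)
    (hgamma : 0 ≤ m.gamma) (h66 : 0 ≤ m.alpha66)
    -- positive semi-definiteness conditions in the strains
    (hmu : 0 ≤ m.mu) (hlam : 0 ≤ 3 * m.lam + 2 * m.mu)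
    -- positive semi-definiteness conditions in the strain gradients
    (h1 : 0 ≤ m.gamma3 + m.gamma4) (h2 : 0 ≤ m.gamma4 - m.gamma5)
    (h3 : 0 ≤ m.gamma4 + 2 * m.gamma5) (h4 : 0 ≤ 2 * m.gamma2 + m.gamma4 + m.gamma5)
    (h5 : 0 ≤ 4 * (m.gamma1 + m.gamma2 + m.gamma5) + (m.gamma3 + 2 * m.gamma4))
    (h6 : (2 * m.gamma1 - m.gamma4) ^ 2
      ≤ (m.gamma3 + m.gamma4) * (4 * m.gamma2 + 3 * m.gamma4 + 4 * m.gamma5))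
    (h7 : 2 * (m.gamma1 + m.gamma5) ^ 2
      ≤ (m.gamma3 + m.gamma4) * (2 * m.gamma2 + m.gamma4 + m.gamma5))
    (h8 : 2 * (m.gamma1 - m.gamma4 - m.gamma5) ^ 2
      ≤ (2 * m.gamma2 + m.gamma4 + m.gamma5) * (m.gamma3 + 4 * m.gamma4 + 6 * m.gamma5))
    (h9 : 0 ≤ (m.gamma4 + 2 * m.gamma5)
      * ((5 * m.gamma3 + 4 * m.gamma4 - 2 * m.gamma5) * (10 * m.gamma2 + 3 * m.gamma4 + m.gamma5)
        - 2 * (5 * m.gamma1 - m.gamma4 + 3 * m.gamma5) ^ 2))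
    -- positive definiteness conditions of the thermoelectric form
    (hmuT : m.muTilde < 0) (hlamT : 3 * m.lamTilde + 2 * m.muTilde < 0)
    (h33 : m.alpha33 < 0) (h44 : m.a44 + m.gamma / m.beta ^ 2 < 0)
    (h47 : 3 * m.alpha47 ^ 2
      < (3 * m.lamTilde + 2 * m.muTilde) * (m.a44 + m.gamma / m.beta ^ 2))
    (S : Thermopiezo.BoundaryParts B) (hS4 : S.S4.Nonempty)
    (Γ : Thermopiezo.ExternalData) (U U' : Thermopiezo.State)
    (hU : Thermopiezo.IsSolution B t0 m S Γ U) (hU' : Thermopiezo.IsSolution B t0 m S Γ U') :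
    ∀ t ∈ Thermopiezo.timeInterval t0, ∀ x ∈ closure B,
      (∀ i, U.u i t x = U'.u i t x) ∧ U.theta t x = U'.theta t x ∧ U.phi t x = U'.phi t x := by

  obtain ⟨G, hG⟩ := Thermopiezo.HasC2Boundary.exists_isDefiningFunction hBopen hBsmooth
  have hW := hU.sub hG ht0 hU'
  -- The difference solves the problem for `m.centered`. Its other constants in the hypotheses agree
  -- with those of `m` by definition, but `γ` agrees only after a computation.
  rw [← m.centered_gamma] at hgamma h44 h47
  have hrate := fun t (ht : t ∈ Thermopiezo.timeInterval t0) x (hx : x ∈ B) =>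
    Thermopiezo.rate_fields_eq_zero hG hBbdd ht0 hW hrho hT0 hbeta rfl hgamma h66 hmu hlam h1 h2 h3
      h4 h6 h7 h9 hmuT h33 h44 h47 ht hx
  intro t ht x hx
  obtain ⟨hu, hθ, hφ⟩ := hW.eq_zero_of_rate_fields hG ht0 hBconn.isPreconnected hS4 hbeta hrate
    t ht x hx
  exact ⟨fun i => sub_eq_zero.1 (hu i), sub_eq_zero.1 hθ, sub_eq_zero.1 hφ⟩
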